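/- Let $n \ge 0$ and let $A_n = \mathbb{C}\mathfrak{S}_n \ltimes \mathbb{C}[X_1,\dots,X_n]$ be the smash product, with $wX_i = X_{w(i)}w$ for $w\in\mathfrak S_n$, graded by $\deg w = 0$ and $\deg X_i = 1$. For a partition $\lambda$ of $n$ let $\lambda'$ be its conjugate, $n(\lambda)=\sum_{i\ge1}(i-1)\lambda_i$, and let $\le$ be the dominance order (with $(n)$ largest). Let $L_\lambda$ be the irreducible representation of $\mathfrak S_n$ indexed by $\lambda$, normalized so that $L_{(n)}$ is trivial and $L_{(1^n)}$ is the sign representation; concretely $L_\lambda=\mathbb C\mathfrak S_n c_\lambda$ for the Young symmetrizer $c_\lambda$ (row symmetrizer times column antisymmetrizer of a bijective filling of the diagram of $\lambda$). Let $e_\lambda=\frac{\dim L_\lambda}{n!}c_\lambda$ be the corresponding idempotent and $P_\lambda=A_ne_\lambda$. For graded $A_n$-modules $M,N$ let $M\langle d\rangle_i=M_{i-d}$, let $\hom_{A_n}(M,N)_j$ be the space of $A_n$-linear maps raising degree by $j$, and $\hom_{A_n}(M,N)=\bigoplus_{j\in\mathbb Z}\hom_{A_n}(M,N)_j$. Put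 $$\widetilde K_\lambda=\frac{P_\lambda}{\sum_{\mu\not\ge\lambda,\ f\in\hom_{A_n}(P_\mu,P_\lambda)}\operatorname{Im} f},\qquad K_\lambda=\frac{\widetilde K_\lambda}{\sum_{j>0,\ f\in\hom_{A_n}(P_\lambda,\widetilde K_\lambda)_j}\operatorname{Im} f},$$ where $\mu$ runs over the partitions of $n$. For $I\subset\{1,\dots,n\}$ let $e_t(I)$ be the $t$-th elementary symmetric polynomial in the variables $X_i$, $i\in I$. For $0\le r\le n$ set $d_r(\lambda)=\lambda'_n+\lambda'_{n-1}+\dots+\lambda'_{n-r+1}$ (where $\lambda'$ is padded by zeros), and let $I_\lambda\subset\mathbb C[X_1,\dots,X_n]$ be the ideal generated by all $e_t(I)$ with $1\le t\le |I|$ and $t>|I|-d_{|I|}(\lambda)$. The ideal $I_\lambda$ is homogeneous and $\mathfrak S_n$-stable, and $R_\lambda=\mathbb C[X_1,\dots,X_n]/I_\lambda$ is a finite-dimensional graded $A_n$-module (the Garsia–Procesi module). Its dual $R_\lambda^*$, with $(R_\lambda^*)_i=((R_\lambda)_{-i})^*$, is a graded $A_n$-module through the anti-automorphism $w\mapsto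 w^{-1}$, $X_i\mapsto X_i$ of $A_n$. Then for every partition $\lambda$ of $n$ there is an isomorphism of graded $A_n$-modules $$R_\lambda^*\langle n(\lambda)\rangle\;\cong\;K_\lambda .$$ -/

import Mathlib

noncomputable section

namespace GarsiaProcesi

/-! ### Partitions -/

/-- Partitions of `n`, given by their Young diagrams in English notation: for `l : Part n` the part
`λ_{i+1}` is `l.1.rowLen i` and the part `λ'_{j+1}` of the conjugate partition is
`l.1.colLen j`. -/
abbrev Part (n : ℕ) : Type := {l : YoungDiagram // l.card = n}

/-- The dominance order: `λ ≤ μ` iff `λ_1 + ⋯ + λ_k ≤ μ_1 + ⋯ + μ_k` for all `k`.  The one-row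
partition `(n)` is the largest element. -/
def DomLE {n : ℕ} (l m : Part n) : Prop :=
  ∀ k : ℕ, ∑ i ∈ Finset.range k, l.1.rowLen i ≤ ∑ i ∈ Finset.range k, m.1.rowLen i

/-- `n(λ) = ∑_{i ≥ 1} (i - 1) λ_i` (a partition of `n` has at most `n` parts). -/
def nStat {n : ℕ} (l : Part n) : ℕ := ∑ i ∈ Finset.range n, i * l.1.rowLen i

/-! ### The graded algebra `A_n = ℂ𝔖_n ⋉ ℂ[X_1, …, X_n]` -/

/-- The polynomial ring `ℂ[X_1, …, X_n]`. -/
abbrev Poly (n : ℕ) : Type := MvPolynomial (Fin n) ℂ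

/-- `𝔖_n` acts on `ℂ[X_1, …, X_n]` by `w • X_i = X_{w(i)}`. -/
instance permAction (n : ℕ) : MulSemiringAction (Equiv.Perm (Fin n)) (Poly n) where
  smul w f := MvPolynomial.rename w f
  one_smul f := by
    change MvPolynomial.rename _ f = f
    rw [Equiv.Perm.coe_one, MvPolynomial.rename_id_apply]
  mul_smul v w f := by
    change MvPolynomial.rename _ f = MvPolynomial.rename _ (MvPolynomial.rename _ f)
    rw [MvPolynomial.rename_rename, Equiv.Perm.coe_mul]
  smul_zero w := map_zero (MvPolynomial.rename (R := ℂ) w)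
  smul_add w := map_add (MvPolynomial.rename (R := ℂ) w)
  smul_one w := map_one (MvPolynomial.rename (R := ℂ) w)
  smul_mul w := map_mul (MvPolynomial.rename (R := ℂ) w)

theorem perm_smul_def {n : ℕ} (w : Equiv.Perm (Fin n)) (f : Poly n) :
    w • f = MvPolynomial.rename w f := rfl

instance permAction_comm (n : ℕ) : SMulCommClass (Equiv.Perm (Fin n)) ℂ (Poly n) where
  smul_comm w c f := map_smul (MvPolynomial.rename (R := ℂ) w) c f

/-- The smash product `A_n = ℂ𝔖_n ⋉ ℂ[X_1, …, X_n]`. -/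
def A (n : ℕ) : Type := SkewMonoidAlgebra (Poly n) (Equiv.Perm (Fin n))

instance algRing (n : ℕ) : Ring (A n) :=
  inferInstanceAs (Ring (SkewMonoidAlgebra (Poly n) (Equiv.Perm (Fin n))))

instance algAlgebra (n : ℕ) : Algebra ℂ (A n) :=
  inferInstanceAs (Algebra ℂ (SkewMonoidAlgebra (Poly n) (Equiv.Perm (Fin n))))

/-- The element `f · w` of `A_n`. -/
def elt {n : ℕ} (w : Equiv.Perm (Fin n)) (f : Poly n) : A n :=
  SkewMonoidAlgebra.single w f

/-- The polynomial `f_w` in `a = ∑_w f_w · w`. -/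
def coeffAt {n : ℕ} (w : Equiv.Perm (Fin n)) (a : A n) : Poly n :=
  SkewMonoidAlgebra.coeff a w

/-- `(f · w) (g · v) = f (w • g) · w v`; in particular `w X_i = X_{w(i)} w`. -/
theorem elt_mul_elt {n : ℕ} (w v : Equiv.Perm (Fin n)) (f g : Poly n) :
    elt w f * elt v g = elt (w * v) (f * (w • g)) :=
  SkewMonoidAlgebra.single_mul_single

theorem elt_one_one {n : ℕ} : elt (1 : Equiv.Perm (Fin n)) 1 = 1 := rfl

theorem elt_add {n : ℕ} (w : Equiv.Perm (Fin n)) (f g : Poly n) :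
    elt w (f + g) = elt w f + elt w g :=
  SkewMonoidAlgebra.single_add w f g

theorem elt_zero {n : ℕ} (w : Equiv.Perm (Fin n)) : elt w 0 = 0 :=
  SkewMonoidAlgebra.single_zero w

theorem smul_elt {n : ℕ} (c : ℂ) (w : Equiv.Perm (Fin n)) (f : Poly n) :
    c • elt w f = elt w (c • f) :=
  SkewMonoidAlgebra.smul_single c w f

theorem elt_induction {n : ℕ} {p : A n → Prop} (a : A n) (zero : p 0)
    (elt : ∀ w f, p (elt w f)) (add : ∀ a b, p a → p b → p (a + b)) : p a :=
  SkewMonoidAlgebra.induction_on (p := p) a zero elt add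

/-- A ring homomorphism out of `A_n` from its values on polynomials and on permutations. -/
def algLift {n : ℕ} {S : Type} [Semiring S] (F : Poly n →+* S) (G : Equiv.Perm (Fin n) →* S)
    (h : ∀ (f : Poly n) (w : Equiv.Perm (Fin n)), F (w • f) * G w = G w * F f) : A n →+* S :=
  SkewMonoidAlgebra.liftNCRingHom F G (fun {f w} => h f w)

theorem algLift_elt {n : ℕ} {S : Type} [Semiring S] (F : Poly n →+* S)
    (G : Equiv.Perm (Fin n) →* S)
    (h : ∀ (f : Poly n) (w : Equiv.Perm (Fin n)), F (w • f) * G w = G w * F f)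
    (w : Equiv.Perm (Fin n)) (f : Poly n) : algLift F G h (elt w f) = F f * G w :=
  SkewMonoidAlgebra.liftNC_single _ _ _ _

/-- The inclusion `ℂ𝔖_n → A_n`. -/
def groupIncl (n : ℕ) : MonoidAlgebra ℂ (Equiv.Perm (Fin n)) →ₐ[ℂ] A n :=
  MonoidAlgebra.lift ℂ (A n) (Equiv.Perm (Fin n))
    { toFun := fun w => elt w 1
      map_one' := rfl
      map_mul' := fun v w => by rw [elt_mul_elt, smul_one, one_mul] }

/-- The homogeneous polynomials of degree `j ∈ ℤ` (only `0` if `j < 0`). -/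
def polyGrading (n : ℕ) (j : ℤ) : Submodule ℂ (Poly n) :=
  if 0 ≤ j then MvPolynomial.homogeneousSubmodule (Fin n) ℂ j.toNat else ⊥

/-- The grading of `A_n` with `deg w = 0` and `deg X_i = 1`. -/
def algGrading (n : ℕ) (j : ℤ) : Submodule ℂ (A n) where
  carrier := {a | ∀ w, coeffAt w a ∈ polyGrading n j}
  zero_mem' _ := (polyGrading n j).zero_mem
  add_mem' {a b} ha hb w := by
    have h : coeffAt w (a + b) = coeffAt w a + coeffAt w b :=
      DFunLike.congr_fun (SkewMonoidAlgebra.coeff_add a b) w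
    rw [h]
    exact (polyGrading n j).add_mem (ha w) (hb w)
  smul_mem' c _ ha w := (polyGrading n j).smul_mem c (ha w)

/-- The anti-automorphism of `A_n` with `w ↦ w⁻¹` and `X_i ↦ X_i`. -/
def antiInv (n : ℕ) : A n →+* (A n)ᵐᵒᵖ :=
  algLift
    { toFun := fun f => MulOpposite.op (elt 1 f)
      map_one' := rfl
      map_zero' := by rw [elt_zero, MulOpposite.op_zero]
      map_add' := fun f g => by rw [elt_add, MulOpposite.op_add]
      map_mul' := fun f g => by
        rw [← MulOpposite.op_mul, elt_mul_elt, mul_one, one_smul, mul_comm] }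
    { toFun := fun w => MulOpposite.op (elt w⁻¹ 1)
      map_one' := by rw [inv_one, elt_one_one, MulOpposite.op_one]
      map_mul' := fun v w => by
        rw [← MulOpposite.op_mul, elt_mul_elt, mul_inv_rev, smul_one, one_mul] }
    (by
      intro f w
      change MulOpposite.op (elt 1 (w • f)) * MulOpposite.op (elt w⁻¹ 1) =
        MulOpposite.op (elt w⁻¹ 1) * MulOpposite.op (elt 1 f)
      rw [← MulOpposite.op_mul, ← MulOpposite.op_mul, elt_mul_elt, elt_mul_elt, inv_smul_smul]
      simp)

/-! ### Graded `A_n`-modules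

A grading of an `A_n`-module `M` is recorded as the family `ℳ : ℤ → Submodule ℂ M` of its
homogeneous pieces. -/

section GradedModules

variable {n : ℕ} {M N : Type} [AddCommGroup M] [Module ℂ M] [Module (A n) M]
  [IsScalarTower ℂ (A n) M] [AddCommGroup N] [Module ℂ N] [Module (A n) N]
  [IsScalarTower ℂ (A n) N]

/-- The shift `M⟨d⟩`, with `(M⟨d⟩)_i = M_{i-d}`. -/
def shift (ℳ : ℤ → Submodule ℂ M) (d : ℤ) : ℤ → Submodule ℂ M := fun i => ℳ (i - d)

/-- The grading of a submodule: `P_i = P ∩ M_i`. -/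
def subGrading (ℳ : ℤ → Submodule ℂ M) (P : Submodule (A n) M) : ℤ → Submodule ℂ P :=
  fun i => (ℳ i).comap (P.subtype.restrictScalars ℂ)

/-- The grading of a quotient: `(M / P)_i` is the image of `M_i`. -/
def quotGrading (ℳ : ℤ → Submodule ℂ M) (P : Submodule (A n) M) : ℤ → Submodule ℂ (M ⧸ P) :=
  fun i => (ℳ i).map (P.mkQ.restrictScalars ℂ)

/-- `hom_A(M, N)_j`: the `A_n`-linear maps that raise the degree by `j`. -/
def homDeg (ℳ : ℤ → Submodule ℂ M) (𝒩 : ℤ → Submodule ℂ N) (j : ℤ) :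
    AddSubgroup (M →ₗ[A n] N) where
  carrier := {f | ∀ i, ∀ x ∈ ℳ i, f x ∈ 𝒩 (i + j)}
  zero_mem' i _ _ := (𝒩 (i + j)).zero_mem
  add_mem' hf hg i x hx := (𝒩 (i + j)).add_mem (hf i x hx) (hg i x hx)
  neg_mem' hf i x hx := (𝒩 (i + j)).neg_mem (hf i x hx)

/-- `hom_A(M, N) = ⨁_j hom_A(M, N)_j`. -/
def gradedHom (ℳ : ℤ → Submodule ℂ M) (𝒩 : ℤ → Submodule ℂ N) : AddSubgroup (M →ₗ[A n] N) :=
  ⨆ j : ℤ, homDeg ℳ 𝒩 j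

end GradedModules

section Dual

variable {n : ℕ} (M : Type) [AddCommGroup M] [Module ℂ M] [Module (A n) M]
  [IsScalarTower ℂ (A n) M]

/-- `A_n` acts on the dual `M^*` through the anti-automorphism `antiInv`:
`(a • φ)(x) = φ (antiInv a • x)`. -/
instance dualModule : Module (A n) (Module.Dual ℂ M) where
  smul a φ := φ.comp (Algebra.lsmul ℂ ℂ M (antiInv n a).unop)
  one_smul φ := by
    refine LinearMap.ext fun x => ?_
    change φ ((antiInv n 1).unop • x) = φ x
    rw [map_one, MulOpposite.unop_one, one_smul]
  mul_smul a b φ := by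
    refine LinearMap.ext fun x => ?_
    change φ ((antiInv n (a * b)).unop • x) =
      φ ((antiInv n b).unop • (antiInv n a).unop • x)
    rw [map_mul, MulOpposite.unop_mul, mul_smul]
  smul_zero a := LinearMap.zero_comp _
  smul_add a φ ψ := LinearMap.add_comp _ _ _
  add_smul a b φ := by
    refine LinearMap.ext fun x => ?_
    change φ ((antiInv n (a + b)).unop • x) =
      φ ((antiInv n a).unop • x) + φ ((antiInv n b).unop • x)
    rw [map_add, MulOpposite.unop_add, add_smul, map_add]
  zero_smul φ := by
    refine LinearMap.ext fun x => ?_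
    change φ ((antiInv n 0).unop • x) = 0
    rw [map_zero, MulOpposite.unop_zero, zero_smul, map_zero]

variable {M} in
/-- The grading of the dual of a finite-dimensional graded module: `(M^*)_i = (M_{-i})^*`, that is,
the functionals that vanish on `M_k` for all `k ≠ -i`. -/
def dualGrading (ℳ : ℤ → Submodule ℂ M) (i : ℤ) : Submodule ℂ (Module.Dual ℂ M) where
  carrier := {φ | ∀ k : ℤ, k ≠ -i → ∀ x ∈ ℳ k, φ x = 0}
  zero_mem' _ _ _ _ := rfl
  add_mem' {φ ψ} hφ hψ k hk x hx := by
    rw [LinearMap.add_apply, hφ k hk x hx, hψ k hk x hx, add_zero]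
  smul_mem' c φ hφ k hk x hx := by
    rw [LinearMap.smul_apply, hφ k hk x hx, smul_zero]

end Dual

/-! ### The irreducible representations `L_λ` and the projective modules `P_λ` -/

/-- A bijective filling of the cells of the Young diagram of `λ` by `{1, …, n}`.  (Another filling
replaces the elements below by conjugates under `𝔖_n`.) -/
def filling {n : ℕ} (l : Part n) : {c // c ∈ l.1.cells} ≃ Fin n :=
  l.1.cells.equivFinOfCardEq l.2

/-- The row of the entry `k` in the filling. -/
def rowOf {n : ℕ} (l : Part n) (k : Fin n) : ℕ := ((filling l).symm k).1.1

/-- The column of the entry `k` in the filling. -/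
def colOf {n : ℕ} (l : Part n) (k : Fin n) : ℕ := ((filling l).symm k).1.2

open Classical in
/-- The Young symmetrizer `c_λ = (∑_p p) (∑_q sgn(q) q)`, where `p` runs over the permutations that
preserve every row of the filling and `q` over those that preserve every column. -/
def youngSymmetrizer {n : ℕ} (l : Part n) : MonoidAlgebra ℂ (Equiv.Perm (Fin n)) :=
  (∑ p : Equiv.Perm (Fin n) with ∀ k, rowOf l (p k) = rowOf l k,
      MonoidAlgebra.of ℂ _ p) *
    (∑ q : Equiv.Perm (Fin n) with ∀ k, colOf l (q k) = colOf l k,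
      ((Equiv.Perm.sign q : ℤ) : ℂ) • MonoidAlgebra.of ℂ _ q)

/-- The irreducible representation `L_λ = ℂ𝔖_n c_λ` of `𝔖_n`; `L_{(n)}` is trivial and `L_{(1^n)}`
is the sign representation. -/
def specht {n : ℕ} (l : Part n) :
    Submodule (MonoidAlgebra ℂ (Equiv.Perm (Fin n))) (MonoidAlgebra ℂ (Equiv.Perm (Fin n))) :=
  Submodule.span _ {youngSymmetrizer l}

/-- The Young idempotent `e_λ = (dim L_λ / n!) c_λ`; it generates the left ideal `L_λ`. -/
def youngIdempotent {n : ℕ} (l : Part n) : MonoidAlgebra ℂ (Equiv.Perm (Fin n)) :=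
  ((Module.finrank ℂ (specht l) : ℂ) / (n.factorial : ℂ)) • youngSymmetrizer l

/-- `P_λ = A_n e_λ`. -/
def P {n : ℕ} (l : Part n) : Submodule (A n) (A n) :=
  Submodule.span (A n) {groupIncl n (youngIdempotent l)}

/-- The grading of `P_λ`. -/
def PGrading {n : ℕ} (l : Part n) : ℤ → Submodule ℂ (P l) :=
  subGrading (algGrading n) (P l)

/-! ### The modules `K̃_λ` and `K_λ` -/

/-- `∑ Im f` over all `μ` with `μ ≱ λ` and all `f ∈ hom_A(P_μ, P_λ)`. -/
def KTildeRel {n : ℕ} (l : Part n) : Submodule (A n) (P l) :=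
  ⨆ (m : Part n) (_ : ¬ DomLE l m) (f : P m →ₗ[A n] P l)
    (_ : f ∈ gradedHom (PGrading m) (PGrading l)), LinearMap.range f

/-- `K̃_λ`, the largest quotient of `P_λ` all of whose graded Jordan–Hölder constituents are shifts
of `L_μ` with `μ ≥ λ`. -/
abbrev KTilde {n : ℕ} (l : Part n) : Type := P l ⧸ KTildeRel l

/-- The grading of `K̃_λ`. -/
def KTildeGrading {n : ℕ} (l : Part n) : ℤ → Submodule ℂ (KTilde l) :=
  quotGrading (PGrading l) (KTildeRel l)

/-- `∑ Im f` over all `j > 0` and all `f ∈ hom_A(P_λ, K̃_λ)_j`. -/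
def KRel {n : ℕ} (l : Part n) : Submodule (A n) (KTilde l) :=
  ⨆ (j : ℤ) (_ : 0 < j) (f : P l →ₗ[A n] KTilde l)
    (_ : f ∈ homDeg (PGrading l) (KTildeGrading l) j), LinearMap.range f

/-- `K_λ`. -/
abbrev K {n : ℕ} (l : Part n) : Type := KTilde l ⧸ KRel l

/-- The grading of `K_λ`. -/
def KGrading {n : ℕ} (l : Part n) : ℤ → Submodule ℂ (K l) :=
  quotGrading (KTildeGrading l) (KRel l)

/-! ### The Garsia–Procesi module `R_λ` -/

/-- `A_n` acts on `ℂ[X_1, …, X_n]`: polynomials by multiplication, permutations by `permAction`. -/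
def polyAction (n : ℕ) : A n →+* Module.End ℂ (Poly n) :=
  algLift (Algebra.lmul ℂ (Poly n)).toRingHom
    { toFun := fun w => (MvPolynomial.rename (R := ℂ) w).toLinearMap
      map_one' := LinearMap.ext fun f => one_smul (Equiv.Perm (Fin n)) f
      map_mul' := fun v w => LinearMap.ext fun f => mul_smul v w f }
    (fun f w => LinearMap.ext fun g => (smul_mul' w f g).symm)

instance polyModule (n : ℕ) : Module (A n) (Poly n) := Module.compHom (Poly n) (polyAction n)

theorem elt_smul_poly {n : ℕ} (w : Equiv.Perm (Fin n)) (f g : Poly n) :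
    elt w f • g = f * (w • g) := by
  change polyAction n (elt w f) g = _
  rw [polyAction, algLift_elt]
  rfl

instance polyTower (n : ℕ) : IsScalarTower ℂ (A n) (Poly n) where
  smul_assoc c a g := by
    induction a using elt_induction with
    | zero => rw [smul_zero, zero_smul, smul_zero]
    | elt w f => rw [smul_elt, elt_smul_poly, elt_smul_poly, smul_mul_assoc]
    | add a b ha hb => rw [smul_add, add_smul, add_smul, ha, hb, smul_add]

/-- `e_t(I)`, the elementary symmetric polynomial of degree `t` in the variables `X_i`, `i ∈ I`. -/
def esymmOn {n : ℕ} (I : Finset (Fin n)) (t : ℕ) : Poly n :=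
  ∑ S ∈ I.powersetCard t, ∏ i ∈ S, MvPolynomial.X i

/-- `d_r(λ) = λ'_n + λ'_{n-1} + ⋯ + λ'_{n-r+1}`, the sum of the last `r` of the `n` parts of the
conjugate partition (padded by zeros), for `r ≤ n`. -/
def dStat {n : ℕ} (l : Part n) (r : ℕ) : ℕ := ∑ j ∈ Finset.Ico (n - r) n, l.1.colLen j

/-- The Tanisaki generators: `e_t(I)` with `|I| = r` and `r ≥ t > r - d_r(λ)`. -/
def tanisakiGens {n : ℕ} (l : Part n) : Set (Poly n) :=
  {f | ∃ (I : Finset (Fin n)) (t : ℕ), 1 ≤ t ∧ t ≤ I.card ∧ I.card < t + dStat l I.card ∧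
    f = esymmOn I t}

/-- The Tanisaki ideal `I_λ`. -/
def tanisakiIdeal {n : ℕ} (l : Part n) : Ideal (Poly n) := Ideal.span (tanisakiGens l)

theorem perm_smul_esymmOn {n : ℕ} (w : Equiv.Perm (Fin n)) (I : Finset (Fin n)) (t : ℕ) :
    w • esymmOn I t = esymmOn (I.map w.toEmbedding) t := by
  rw [perm_smul_def, esymmOn, esymmOn, Finset.powersetCard_map, Finset.sum_map, map_sum]
  refine Finset.sum_congr rfl fun S _ => ?_
  simp [map_prod]

theorem perm_smul_mem_tanisakiIdeal {n : ℕ} (l : Part n) (w : Equiv.Perm (Fin n)) {f : Poly n}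
    (hf : f ∈ tanisakiIdeal l) : w • f ∈ tanisakiIdeal l := by
  have h : tanisakiIdeal l ≤
      (tanisakiIdeal l).comap (MvPolynomial.rename (R := ℂ) w).toRingHom := by
    refine Ideal.span_le.2 ?_
    rintro _ ⟨I, t, h1, h2, h3, rfl⟩
    change w • esymmOn I t ∈ tanisakiIdeal l
    rw [perm_smul_esymmOn]
    exact Ideal.subset_span ⟨I.map w.toEmbedding, t, h1, by simpa using h2, by simpa using h3, rfl⟩
  exact h hf

/-- The Tanisaki ideal, as an `A_n`-submodule of `ℂ[X_1, …, X_n]`. -/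
def tanisakiSubmodule {n : ℕ} (l : Part n) : Submodule (A n) (Poly n) where
  carrier := tanisakiIdeal l
  zero_mem' := (tanisakiIdeal l).zero_mem
  add_mem' := (tanisakiIdeal l).add_mem
  smul_mem' a f hf := by
    induction a using elt_induction with
    | zero =>
      rw [zero_smul]
      exact (tanisakiIdeal l).zero_mem
    | elt w g =>
      rw [elt_smul_poly]
      exact (tanisakiIdeal l).mul_mem_left g (perm_smul_mem_tanisakiIdeal l w hf)
    | add a b ha hb =>
      rw [add_smul]
      exact (tanisakiIdeal l).add_mem ha hb

/-- The Garsia–Procesi module `R_λ = ℂ[X_1, …, X_n] / I_λ`. -/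
abbrev R {n : ℕ} (l : Part n) : Type := Poly n ⧸ tanisakiSubmodule l

/-- The grading of `R_λ` by the degree of polynomials. -/
def RGrading {n : ℕ} (l : Part n) : ℤ → Submodule ℂ (R l) :=
  quotGrading (polyGrading n) (tanisakiSubmodule l)

end GarsiaProcesi

end

/-! Write λ for `l`. The generator of `K l` is sent to a functional on `R l` of lowest degree; this
gives a map `toDual` from `K l` to the dual of `R l`, and the point is that it is bijective.
Everything rests on a concrete description of the dual. For a tableau with row labels `r` and column
labels `c`, `phi S r c` takes the coefficient of `∏ X_i ^ r_i` in the column antisymmetrization of a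
polynomial. The largest ideal killed by all these functionals, `annIdeal`, is the Tanisaki ideal
(`annIdeal_eq_tanIdeal`). Both ideals behave well under the filtration by powers of one variable
X_j, whose i-th graded piece is the quotient attached to the diagram with one corner removed
(`X_pow_mul_mem_iff`), and this yields their equality by induction.

Well-definedness and surjectivity. A polynomial antisymmetrized along the columns of μ lies in the
ideal unless μ ≥ λ, so the dual of `R l` has only constituents L_μ with μ ≥ λ. An antisymmetric
polynomial for the columns of λ has degree at least n(λ), and in that degree it is unique up to
scalars, so L_λ occurs only at the generator. Hence the relations of `KTilde` and `K` are respected.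
The functional of the standard filling generates the dual, because its 𝔖_n-translates have the
Tanisaki ideal as their annihilator and `R l` is finite-dimensional.

Injectivity. If the kernel Y is nonzero, a Nakayama argument gives a functional on Y that kills the
products X_i y with y in Y. A Young symmetrizer of some μ detects it. The relations of `K l` force μ
≥ λ, and μ ≠ λ because L_λ occurs only once in `K l`. So μ > λ, and the kernel would produce a
nontrivial extension of the dual of `R l` by L_μ. After symmetrization along the rows of μ, the
derivatives χ(X_i ·) of such a functional χ become a Koszul 1-cocycle with values in `R l`,
equivariant under the row group of μ. The contradiction is that this cocycle is a coboundary.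

The vanishing theorem (`vanishFor`): if the row lengths of μ strictly dominate those of λ, the
invariant Koszul cohomology of `ℂ[X] / annIdeal` vanishes in degrees 0 and 1. Degree 0 is immediate,
since two variables share a row of μ and a column of λ and their transposition acts by both signs.
Degree 1 goes by induction on the number of variables: remove a variable with maximal label and use
its power filtration. Strict dominance survives on every piece except when μ arises from λ by moving
a last row of one cell up by one row (`Critical`). There the problem is first solved modulo the
monomial f = ∏ X_i ^ p over the last label class, using `vanish_lastRow`; the remaining cocycle has
values in the multiples of f, where f X_k X_l = 0 and f ∑ X_k = 0 over the class, and is integrated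
by hand (`LastBlock.exists_primitive`). -/

noncomputable section
namespace GarsiaProcesi
open Finset

/-! ### Counting cells of Young diagrams -/

/-- The number of cells in the first `k` rows. -/
def topCount (Y : YoungDiagram) (k : ℕ) : ℕ := ∑ i ∈ range k, Y.rowLen i

theorem topCount_succ (Y : YoungDiagram) (k : ℕ) :
    topCount Y (k + 1) = topCount Y k + Y.rowLen k := sum_range_succ _ _

theorem topCount_eq_card (Y : YoungDiagram) (k : ℕ) :
    topCount Y k = #{c ∈ Y.cells | c.1 < k} := by
  rw [card_eq_sum_card_fiberwise (f := Prod.fst) (t := range k)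
    (fun c hc => by simpa using (mem_filter.1 hc).2)]
  refine sum_congr rfl fun i hi => ?_
  rw [YoungDiagram.rowLen_eq_card, filter_filter]
  congr 1
  ext c
  simp only [YoungDiagram.mem_row_iff, mem_filter, YoungDiagram.mem_cells]
  have := mem_range.1 hi
  grind

theorem card_col_lt (Y : YoungDiagram) (k j : ℕ) :
    #{c ∈ Y.cells | c.1 < k ∧ c.2 = j} = min k (Y.colLen j) := by
  have : {c ∈ Y.cells | c.1 < k ∧ c.2 = j} = (range (min k (Y.colLen j))) ×ˢ {j} := by
    ext ⟨a, b⟩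
    simp only [mem_filter, YoungDiagram.mem_cells, mem_product, mem_range, mem_singleton]
    rw [YoungDiagram.mem_iff_lt_colLen]
    grind
  rw [this]; simp

/-- Counting the first `k` rows column by column turns dominance statements into comparisons inside
single columns. -/
theorem topCount_eq_sum_min (Y : YoungDiagram) (k : ℕ) {M : ℕ} (hM : Y.rowLen 0 ≤ M) :
    topCount Y k = ∑ j ∈ range M, min k (Y.colLen j) := by
  rw [topCount_eq_card, card_eq_sum_card_fiberwise (f := Prod.snd) (t := range M)]
  · refine sum_congr rfl fun j _ => ?_
    rw [← card_col_lt, filter_filter]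
  · intro c hc
    have h1 : (c.1, c.2) ∈ Y := (mem_filter.1 hc).1
    have h2 : (0, c.2) ∈ Y := Y.up_left_mem (Nat.zero_le _) le_rfl h1
    rw [YoungDiagram.mem_iff_lt_rowLen] at h2
    simp only [coe_range, Set.mem_Iio]
    omega

theorem topCount_le_card (Y : YoungDiagram) (k : ℕ) : topCount Y k ≤ Y.card := by
  rw [topCount_eq_card]; exact card_filter_le _ _

theorem topCount_eq_card_of_le (Y : YoungDiagram) {k : ℕ} (hk : Y.colLen 0 ≤ k) :
    topCount Y k = Y.card := by
  rw [topCount_eq_card, filter_true_of_mem]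
  rintro ⟨a, b⟩ hc
  have h2 : (a, 0) ∈ Y := Y.up_left_mem le_rfl (Nat.zero_le _) hc
  rw [YoungDiagram.mem_iff_lt_colLen] at h2
  exact h2.trans_le hk

theorem topCount_lt_card_of_lt (Y : YoungDiagram) {k : ℕ} (hk : k < Y.colLen 0) :
    topCount Y k < Y.card := by
  rw [topCount_eq_card]
  refine card_lt_card (filter_ssubset.2 ⟨(k, 0), YoungDiagram.mem_iff_lt_colLen.2 hk, by simp⟩)

theorem card_le_colLen_of_rowLen_zero (Y : YoungDiagram) (M : ℕ) (hM : Y.rowLen 0 ≤ M) :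
    ∑ j ∈ range M, Y.colLen j = Y.card := by
  rw [← topCount_eq_card_of_le Y le_rfl, topCount_eq_sum_min Y _ hM]
  refine sum_congr rfl fun j _ => (min_eq_right (Y.colLen_anti _ _ (Nat.zero_le _))).symm

theorem rowLen_le_card (Y : YoungDiagram) (i : ℕ) : Y.rowLen i ≤ Y.card := by
  rw [YoungDiagram.rowLen_eq_card]; exact card_filter_le _ _

theorem colLen_le_card (Y : YoungDiagram) (i : ℕ) : Y.colLen i ≤ Y.card := by
  rw [YoungDiagram.colLen_eq_card]; exact card_filter_le _ _

theorem rowLen_pos_iff (Y : YoungDiagram) (i : ℕ) : 0 < Y.rowLen i ↔ i < Y.colLen 0 := by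
  rw [← YoungDiagram.mem_iff_lt_rowLen, YoungDiagram.mem_iff_lt_colLen]

theorem rowLen_eq_of_topCount_eq {Y Z : YoungDiagram} (h : ∀ k, topCount Y k = topCount Z k) :
    Y = Z := by
  have h' : ∀ i, Y.rowLen i = Z.rowLen i := fun i => by
    have := h (i + 1); rw [topCount_succ, topCount_succ, h i] at this; omega
  refine YoungDiagram.ext (Finset.ext fun ⟨a, b⟩ => ?_)
  rw [YoungDiagram.mem_cells, YoungDiagram.mem_cells, YoungDiagram.mem_iff_lt_rowLen,
    YoungDiagram.mem_iff_lt_rowLen, h']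

/-! ### Labellings with distinct rows in each column, and dominance. -/

section Pairs

variable {α : Type*} {s : Finset α} {r γ : α → ℕ} {Y : YoungDiagram}

theorem card_pair_le (hinj : Set.InjOn (fun x => (r x, γ x)) s)
    (hcol : ∀ j, #{x ∈ s | γ x = j} ≤ Y.colLen j) (k j : ℕ) :
    #{x ∈ s | r x < k ∧ γ x = j} ≤ min k (Y.colLen j) := by
  refine le_min ?_ ((card_le_card fun x hx => ?_).trans (hcol j))
  · calc _ ≤ #(range k) := by
          refine card_le_card_of_injOn r (fun x hx => ?_) fun x hx y hy hxy => ?_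
          · simpa using (mem_filter.1 hx).2.1
          · have hx' := mem_filter.1 hx
            have hy' := mem_filter.1 hy
            exact hinj hx'.1 hy'.1 (Prod.ext hxy (hx'.2.2.trans hy'.2.2.symm))
      _ = k := card_range k
  · simp only [mem_filter] at hx ⊢; exact ⟨hx.1, hx.2.2⟩

theorem col_lt_rowLen (hcol : ∀ j, #{x ∈ s | γ x = j} ≤ Y.colLen j) {x : α} (hx : x ∈ s) :
    γ x < Y.rowLen 0 := by
  rw [← YoungDiagram.mem_iff_lt_rowLen, YoungDiagram.mem_iff_lt_colLen]
  have : 0 < #{y ∈ s | γ y = γ x} := card_pos.2 ⟨x, by simp [hx]⟩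
  exact this.trans_le (hcol (γ x))

theorem card_eq_sum_pair (hcol : ∀ j, #{x ∈ s | γ x = j} ≤ Y.colLen j) (k : ℕ) :
    #{x ∈ s | r x < k} = ∑ j ∈ range (Y.rowLen 0), #{x ∈ s | r x < k ∧ γ x = j} := by
  rw [card_eq_sum_card_fiberwise (f := γ) (t := range (Y.rowLen 0))]
  · exact sum_congr rfl fun j _ => by rw [filter_filter]
  · intro x hx
    simpa using col_lt_rowLen hcol (mem_filter.1 hx).1

/-- If elements of the same column of `Y` lie in different rows, then the rows are dominated by the
rows of `Y`. -/
theorem card_lt_le_topCount (hinj : Set.InjOn (fun x => (r x, γ x)) s)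
    (hcol : ∀ j, #{x ∈ s | γ x = j} ≤ Y.colLen j) (k : ℕ) :
    #{x ∈ s | r x < k} ≤ topCount Y k := by
  rw [card_eq_sum_pair hcol, topCount_eq_sum_min Y k le_rfl]
  exact sum_le_sum fun j _ => card_pair_le hinj hcol k j

/-- Equality of the totals forces equality in each column. With `k` the full length of the column of
`x`, this says that every element of that column sits in a row below `k`. -/
theorem mem_of_card_lt_eq (hinj : Set.InjOn (fun x => (r x, γ x)) s)
    (hcol : ∀ j, #{x ∈ s | γ x = j} ≤ Y.colLen j)
    (heq : ∀ k, #{x ∈ s | r x < k} = topCount Y k) {x : α} (hx : x ∈ s) :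
    (r x, γ x) ∈ Y := by
  rw [YoungDiagram.mem_iff_lt_colLen]
  set k := Y.colLen (γ x) with hk
  have h := heq k
  rw [card_eq_sum_pair hcol, topCount_eq_sum_min Y k le_rfl] at h
  have h2 := (sum_eq_sum_iff_of_le fun j _ => card_pair_le hinj hcol k j).1 h (γ x)
    (mem_range.2 (col_lt_rowLen hcol hx))
  rw [← hk, min_self] at h2
  have h3 : {x' ∈ s | r x' < k ∧ γ x' = γ x} = {x' ∈ s | γ x' = γ x} := by
    refine eq_of_subset_of_card_le (fun y hy => ?_) ?_
    · simp only [mem_filter] at hy ⊢; exact ⟨hy.1, hy.2.2⟩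
    · rw [h2]; exact hcol _
  have : x ∈ {x' ∈ s | r x' < k ∧ γ x' = γ x} := by rw [h3]; simp [hx]
  exact (mem_filter.1 this).2.1

end Pairs

/-- Layer-cake summation in complementary form: `x` is counted `e x` times in the first sum and once
for each of the `M - e x` thresholds in the second. -/
theorem sum_eq_sum_card_lt {α : Type*} (s : Finset α) (e : α → ℕ) {M : ℕ}
    (hM : ∀ x ∈ s, e x ≤ M) : ∑ x ∈ s, e x + ∑ k ∈ range M, #{x ∈ s | e x < k + 1} = M * #s := by
  have h : ∀ x ∈ s, e x + ∑ k ∈ range M, (if e x < k + 1 then 1 else 0) = M := by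
    intro x hx
    rw [sum_boole]
    have : {k ∈ range M | e x < k + 1} = Ico (e x) M := by
      ext k; simp only [mem_filter, mem_range, mem_Ico]; omega
    rw [this]; simp; exact Nat.add_sub_of_le (hM x hx)
  calc _ = ∑ x ∈ s, (e x + ∑ k ∈ range M, (if e x < k + 1 then 1 else 0)) := by
        rw [sum_add_distrib, sum_comm]
        congr 1
        exact sum_congr rfl fun k _ => by simp
    _ = _ := by rw [sum_congr rfl h]; simp [mul_comm]

theorem sum_le_sum_of_card_lt_le {α β : Type*} (s : Finset α) (t : Finset β) (e : α → ℕ)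
    (r : β → ℕ) (hst : #s = #t) (h : ∀ k, #{x ∈ s | e x < k} ≤ #{x ∈ t | r x < k}) :
    ∑ x ∈ t, r x ≤ ∑ x ∈ s, e x := by
  obtain ⟨M1, h1⟩ : ∃ M, ∀ x ∈ s, e x ≤ M := ⟨s.sup e, fun x hx => le_sup hx⟩
  obtain ⟨M2, h2⟩ : ∃ M, ∀ x ∈ t, r x ≤ M := ⟨t.sup r, fun x hx => le_sup hx⟩
  have e1 := sum_eq_sum_card_lt s e (M := max M1 M2) fun x hx => (h1 x hx).trans (le_max_left _ _)
  have e2 := sum_eq_sum_card_lt t r (M := max M1 M2) fun x hx => (h2 x hx).trans (le_max_right _ _)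
  have e3 : ∑ k ∈ range (max M1 M2), #{x ∈ s | e x < k + 1} ≤
      ∑ k ∈ range (max M1 M2), #{x ∈ t | r x < k + 1} := sum_le_sum fun k _ => h _
  rw [hst] at e1
  omega

/-- The largest element of a set with `m + 1` elements is at least `m`, so replacing it by `m` does
not lower the sum. -/
theorem sum_le_sum_range_of_antitone {f : ℕ → ℕ} (hf : ∀ i j, i ≤ j → f j ≤ f i) (B : Finset ℕ) :
    ∀ {m : ℕ}, #B ≤ m → ∑ x ∈ B, f x ≤ ∑ x ∈ range m, f x := by
  induction B using Finset.induction_on_max with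
  | empty => simp
  | insert a B hB ih =>
    intro m hm
    have ha : a ∉ B := fun h => lt_irrefl _ (hB a h)
    rw [card_insert_of_notMem ha] at hm
    obtain ⟨m, rfl⟩ : ∃ m', m = m' + 1 := ⟨m - 1, by omega⟩
    rw [sum_insert ha, sum_range_succ, add_comm]
    have h1 := ih (m := #B) le_rfl
    have h2 : #B ≤ a := by
      simpa using card_le_card (s := B) (t := range a) fun x hx => mem_range.2 (hB x hx)
    have h3 : ∑ x ∈ range (#B + 1), f x ≤ ∑ x ∈ range (m + 1), f x :=
      sum_le_sum_of_subset (range_mono (by omega))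
    rw [sum_range_succ, sum_range_succ] at h3
    have := hf _ _ h2
    omega

/-! ### Removing a corner -/

/-- The corner of `Y` in the last column that meets row `i`. -/
def cornerAt (Y : YoungDiagram) (i : ℕ) : ℕ × ℕ :=
  (Y.colLen (Y.rowLen i - 1) - 1, Y.rowLen i - 1)

section Corner

variable {Y : YoungDiagram} {i : ℕ}

theorem cornerAt_mem (h : 0 < Y.rowLen i) : cornerAt Y i ∈ Y := by
  have h1 : (i, Y.rowLen i - 1) ∈ Y := YoungDiagram.mem_iff_lt_rowLen.2 (by omega)
  rw [YoungDiagram.mem_iff_lt_colLen] at h1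
  exact YoungDiagram.mem_iff_lt_colLen.2 (by omega)

/-- The rows from `i` down to that of the corner all have the same length. The cell removed is at
the bottom of this block, so that a diagram remains. -/
theorem le_cornerAt (h : 0 < Y.rowLen i) : i ≤ (cornerAt Y i).1 := by
  have h1 : (i, Y.rowLen i - 1) ∈ Y := YoungDiagram.mem_iff_lt_rowLen.2 (by omega)
  rw [YoungDiagram.mem_iff_lt_colLen] at h1
  simp only [cornerAt]; omega

theorem rowLen_cornerAt (h : 0 < Y.rowLen i) : Y.rowLen (cornerAt Y i).1 = Y.rowLen i := by
  refine le_antisymm (Y.rowLen_anti _ _ (le_cornerAt h)) ?_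
  have := YoungDiagram.mem_iff_lt_rowLen.1 (cornerAt_mem h)
  simp only [cornerAt] at this ⊢
  omega

theorem colLen_cornerAt (h : 0 < Y.rowLen i) :
    Y.colLen (cornerAt Y i).2 = (cornerAt Y i).1 + 1 := by
  have := le_cornerAt h
  have h1 := YoungDiagram.mem_iff_lt_colLen.1 (cornerAt_mem h)
  simp only [cornerAt] at this h1 ⊢
  omega

theorem colLen_le_of_cornerAt_lt {x : ℕ} (hx : (cornerAt Y i).2 < x) : Y.colLen x ≤ i := by
  by_contra hc
  have h1 : (i, x) ∈ Y := YoungDiagram.mem_iff_lt_colLen.2 (by omega)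
  rw [YoungDiagram.mem_iff_lt_rowLen] at h1
  simp only [cornerAt] at hx; omega

/-- The Young diagram without its corner `cornerAt Y i`. -/
def shrink (Y : YoungDiagram) (i : ℕ) (h : 0 < Y.rowLen i) : YoungDiagram where
  cells := Y.cells.erase (cornerAt Y i)
  isLowerSet := by
    rintro ⟨a, b⟩ ⟨a', b'⟩ hle hmem
    rw [coe_erase] at hmem ⊢
    refine ⟨Y.isLowerSet hle hmem.1, fun heq => hmem.2 ?_⟩
    have heq' : (a', b') = cornerAt Y i := heq
    have ha : a' ≤ a := hle.1
    have hb : b' ≤ b := hle.2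
    have h0 : (a, b) ∈ Y := hmem.1
    have e1 : a' = (cornerAt Y i).1 := by rw [← heq']
    have e2 : b' = (cornerAt Y i).2 := by rw [← heq']
    have h1 : a' = a := by
      by_contra hne
      have : ((cornerAt Y i).1 + 1, (cornerAt Y i).2) ∈ Y :=
        Y.up_left_mem (by omega) (by omega) h0
      rw [YoungDiagram.mem_iff_lt_colLen, colLen_cornerAt h] at this
      omega
    have h2 : b' = b := by
      by_contra hne
      have : ((cornerAt Y i).1, (cornerAt Y i).2 + 1) ∈ Y :=
        Y.up_left_mem (by omega) (by omega) h0
      rw [YoungDiagram.mem_iff_lt_rowLen, rowLen_cornerAt h] at this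
      simp only [cornerAt] at this
      omega
    change (a, b) = cornerAt Y i
    rw [← heq', h1, h2]

theorem mem_shrink (h : 0 < Y.rowLen i) {c : ℕ × ℕ} :
    c ∈ shrink Y i h ↔ c ≠ cornerAt Y i ∧ c ∈ Y := by
  change c ∈ Y.cells.erase _ ↔ _
  rw [mem_erase]; rfl

theorem card_shrink (h : 0 < Y.rowLen i) : (shrink Y i h).card + 1 = Y.card :=
  card_erase_add_one (s := Y.cells) (cornerAt_mem h)

theorem topCount_shrink (h : 0 < Y.rowLen i) (k : ℕ) :
    topCount (shrink Y i h) k + (if (cornerAt Y i).1 < k then 1 else 0) = topCount Y k := by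
  rw [topCount_eq_card, topCount_eq_card]
  change #{c ∈ Y.cells.erase _ | _} + _ = _
  rw [filter_erase]
  split_ifs with hk
  · exact card_erase_add_one (mem_filter.2 ⟨cornerAt_mem h, hk⟩)
  · rw [erase_eq_of_notMem (by simp [hk]), add_zero]

theorem colLen_shrink (h : 0 < Y.rowLen i) (x : ℕ) :
    (shrink Y i h).colLen x + (if x = (cornerAt Y i).2 then 1 else 0) = Y.colLen x := by
  rw [YoungDiagram.colLen_eq_card, YoungDiagram.colLen_eq_card]
  change #{c ∈ Y.cells.erase _ | _} + _ = #{c ∈ Y.cells | _}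
  rw [filter_erase]
  split_ifs with hk
  · exact card_erase_add_one (mem_filter.2 ⟨cornerAt_mem h, hk.symm⟩)
  · rw [erase_eq_of_notMem (by simp [Ne.symm hk]), add_zero]

theorem rowLen_shrink (h : 0 < Y.rowLen i) (x : ℕ) :
    (shrink Y i h).rowLen x + (if x = (cornerAt Y i).1 then 1 else 0) = Y.rowLen x := by
  rw [YoungDiagram.rowLen_eq_card, YoungDiagram.rowLen_eq_card]
  change #{c ∈ Y.cells.erase _ | _} + _ = #{c ∈ Y.cells | _}
  rw [filter_erase]
  split_ifs with hk
  · exact card_erase_add_one (mem_filter.2 ⟨cornerAt_mem h, hk.symm⟩)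
  · rw [erase_eq_of_notMem (by simp [Ne.symm hk]), add_zero]

end Corner

/-! ### Antisymmetrized coefficient functionals -/

section Tableaux

variable {n : ℕ}

/-- The permutations that fix everything outside `S` and preserve the labels `ρ`. -/
def labelGroup (S : Finset (Fin n)) (ρ : Fin n → ℕ) : Subgroup (Equiv.Perm (Fin n)) where
  carrier := {σ | (∀ i ∉ S, σ i = i) ∧ ∀ i, ρ (σ i) = ρ i}
  one_mem' := ⟨fun _ _ => rfl, fun _ => rfl⟩
  mul_mem' {a b} ha hb := ⟨fun i hi => by rw [Equiv.Perm.mul_apply, hb.1 i hi, ha.1 i hi],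
    fun i => by rw [Equiv.Perm.mul_apply, ha.2, hb.2]⟩
  inv_mem' {a} ha := ⟨fun i hi => by rw [Equiv.Perm.inv_eq_iff_eq, ha.1 i hi],
    fun i => by simpa using (ha.2 (a⁻¹ i)).symm⟩

theorem mem_labelGroup {S : Finset (Fin n)} {ρ : Fin n → ℕ} {σ : Equiv.Perm (Fin n)} :
    σ ∈ labelGroup S ρ ↔ (∀ i ∉ S, σ i = i) ∧ ∀ i, ρ (σ i) = ρ i := Iff.rfl

instance (S : Finset (Fin n)) (ρ : Fin n → ℕ) : DecidablePred (· ∈ labelGroup S ρ) :=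
  fun _ => decidable_of_iff _ mem_labelGroup.symm

theorem labelGroup_apply_mem {S : Finset (Fin n)} {ρ : Fin n → ℕ} {σ : Equiv.Perm (Fin n)}
    (hσ : σ ∈ labelGroup S ρ) {i : Fin n} : σ i ∈ S ↔ i ∈ S := by
  constructor
  · intro h; by_contra hi; rw [hσ.1 i hi] at h; exact hi h
  · intro h; by_contra hi
    have := σ.injective (hσ.1 _ hi); rw [this] at hi; exact hi h

theorem swap_mem_labelGroup {S : Finset (Fin n)} {ρ : Fin n → ℕ} {i k : Fin n} (hi : i ∈ S)
    (hk : k ∈ S) (h : ρ i = ρ k) : Equiv.swap i k ∈ labelGroup S ρ := by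
  refine ⟨fun x hx => Equiv.swap_apply_of_ne_of_ne ?_ ?_, fun x => ?_⟩
  · rintro rfl; exact hx hi
  · rintro rfl; exact hx hk
  · rw [Equiv.swap_apply_def]; split_ifs with h1 h2
    · rw [h1, h]
    · rw [h2, h]
    · rfl

theorem labelGroup_mono {S S' : Finset (Fin n)} (hS : S ⊆ S') (ρ : Fin n → ℕ) :
    labelGroup S ρ ≤ labelGroup S' ρ := fun _ hσ => ⟨fun i hi => hσ.1 i fun h => hi (hS h), hσ.2⟩

/-- `(r, c)` identifies `S` with the cells of `Y`. -/
def IsTab (Y : YoungDiagram) (S : Finset (Fin n)) (r c : Fin n → ℕ) : Prop :=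
  Set.BijOn (fun i => (r i, c i)) (S : Set (Fin n)) (Y.cells : Set (ℕ × ℕ))

section IsTab

variable {Y : YoungDiagram} {S : Finset (Fin n)} {r c : Fin n → ℕ}

theorem IsTab.card_filter (h : IsTab Y S r c) (p : ℕ × ℕ → Prop) [DecidablePred p] :
    #{i ∈ S | p (r i, c i)} = #{x ∈ Y.cells | p x} := by
  refine Finset.card_nbij (fun i => (r i, c i)) (fun i hi => ?_) (h.injOn.mono ?_) ?_
  · rw [mem_coe, mem_filter] at hi ⊢; exact ⟨h.mapsTo hi.1, hi.2⟩
  · intro i hi; exact (mem_filter.1 hi).1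
  · rintro x hx
    rw [mem_coe, mem_filter] at hx
    obtain ⟨i, hi, rfl⟩ := h.surjOn hx.1
    exact ⟨i, by rw [mem_coe, mem_filter]; exact ⟨hi, hx.2⟩, rfl⟩

theorem IsTab.card_lt (h : IsTab Y S r c) (k : ℕ) : #{i ∈ S | r i < k} = topCount Y k := by
  rw [topCount_eq_card]; exact h.card_filter fun x => x.1 < k

theorem IsTab.card_col (h : IsTab Y S r c) (j : ℕ) : #{i ∈ S | c i = j} = Y.colLen j := by
  rw [YoungDiagram.colLen_eq_card]; exact h.card_filter fun x => x.2 = j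

theorem IsTab.mem (h : IsTab Y S r c) {i : Fin n} (hi : i ∈ S) : (r i, c i) ∈ Y := h.mapsTo hi

theorem IsTab.eq_of_eq (h : IsTab Y S r c) {i k : Fin n} (hi : i ∈ S) (hk : k ∈ S)
    (h1 : r i = r k) (h2 : c i = c k) : i = k := h.injOn hi hk (Prod.ext h1 h2)

theorem isTab_of_injOn (hinj : Set.InjOn (fun x => (r x, c x)) (S : Set (Fin n)))
    (hcol : ∀ j, #{x ∈ S | c x = j} = Y.colLen j)
    (heq : ∀ k, #{x ∈ S | r x < k} = topCount Y k) : IsTab Y S r c := by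
  have hmaps : ∀ x ∈ S, (r x, c x) ∈ Y.cells := fun x hx =>
    mem_of_card_lt_eq hinj (fun j => (hcol j).le) heq hx
  refine ⟨hmaps, hinj, Finset.surjOn_of_injOn_of_card_le _ hmaps hinj ?_⟩
  have h1 : #Y.cells = topCount Y (S.sup r + 1 + Y.colLen 0) :=
    (topCount_eq_card_of_le Y (by omega)).symm
  rw [h1, ← heq]
  exact card_filter_le _ _

end IsTab

/-- The exponent vector with entries `r i` for `i ∈ S` and `0` elsewhere. -/
def expVec (S : Finset (Fin n)) (r : Fin n → ℕ) : Fin n →₀ ℕ :=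
  Finsupp.equivFunOnFinite.symm fun i => if i ∈ S then r i else 0

theorem expVec_apply (S : Finset (Fin n)) (r : Fin n → ℕ) (i : Fin n) :
    expVec S r i = if i ∈ S then r i else 0 := rfl

/-- The coefficient of `∏ X_i ^ r_i` in the column antisymmetrization of a polynomial. -/
def phi (S : Finset (Fin n)) (r c : Fin n → ℕ) : Poly n →ₗ[ℂ] ℂ :=
  ∑ q : Equiv.Perm (Fin n) with q ∈ labelGroup S c,
    ((Equiv.Perm.sign q : ℤ) : ℂ) •
      (MvPolynomial.lcoeff ℂ (expVec S r) ∘ₗ (MvPolynomial.rename (R := ℂ) q).toLinearMap)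

theorem phi_apply (S : Finset (Fin n)) (r c : Fin n → ℕ) (f : Poly n) :
    phi S r c f = ∑ q : Equiv.Perm (Fin n) with q ∈ labelGroup S c,
      ((Equiv.Perm.sign q : ℤ) : ℂ) * MvPolynomial.coeff (expVec S r) (q • f) := by
  simp [phi, LinearMap.sum_apply, perm_smul_def]

theorem perm_smul_X (w : Equiv.Perm (Fin n)) (i : Fin n) :
    w • (MvPolynomial.X i : Poly n) = MvPolynomial.X (w i) := MvPolynomial.rename_X _ _

theorem perm_smul_monomial (w : Equiv.Perm (Fin n)) (e : Fin n →₀ ℕ) (a : ℂ) :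
    w • (MvPolynomial.monomial e a : Poly n) = MvPolynomial.monomial (e.mapDomain w) a :=
  MvPolynomial.rename_monomial _ _ _

theorem mapDomain_perm_apply (w : Equiv.Perm (Fin n)) (e : Fin n →₀ ℕ) (i : Fin n) :
    e.mapDomain w (w i) = e i := Finsupp.mapDomain_apply w.injective _ _

theorem perm_coeff_smul (w : Equiv.Perm (Fin n)) (d e : Fin n →₀ ℕ) (h : ∀ i, e (w i) = d i)
    (f : Poly n) : MvPolynomial.coeff e (w • f) = MvPolynomial.coeff d f := by
  have : e = d.mapDomain w := by
    ext i; obtain ⟨i, rfl⟩ := w.surjective i; rw [mapDomain_perm_apply, h]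
  rw [this, perm_smul_def, MvPolynomial.coeff_rename_mapDomain _ w.injective]

/-! ### Vanishing properties of the antisymmetrized coefficients. -/

section phi

variable {Y : YoungDiagram} {S : Finset (Fin n)} {r c : Fin n → ℕ}

theorem phi_perm_smul {σ : Equiv.Perm (Fin n)} (hσ : σ ∈ labelGroup S c) (f : Poly n) :
    phi S r c (σ • f) = ((Equiv.Perm.sign σ : ℤ) : ℂ) * phi S r c f := by
  rw [phi_apply, phi_apply, mul_sum]
  refine sum_bij' (fun q _ => q * σ) (fun q _ => q * σ⁻¹) ?_ ?_ ?_ ?_ ?_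
  · intro q hq; simp only [mem_filter, mem_univ, true_and] at hq ⊢; exact mul_mem hq hσ
  · intro q hq; simp only [mem_filter, mem_univ, true_and] at hq ⊢; exact mul_mem hq (inv_mem hσ)
  · intro q _; simp
  · intro q _; simp
  · intro q _
    rw [smul_smul, Equiv.Perm.sign_mul]
    rcases Int.units_eq_one_or (Equiv.Perm.sign σ) with h | h <;> simp [h]

/-- A transposition inside a column reverses the sign, so φ(f) = -φ(f). Most of the vanishing
statements below come from this. -/
theorem phi_eq_zero_of_swap {i k : Fin n} (hi : i ∈ S) (hk : k ∈ S) (hik : i ≠ k)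
    (h : c i = c k) {f : Poly n} (hf : Equiv.swap i k • f = f) : phi S r c f = 0 := by
  have := phi_perm_smul (r := r) (swap_mem_labelGroup hi hk h) f
  rw [hf, Equiv.Perm.sign_swap hik] at this
  push_cast at this
  linear_combination this / 2

/-- A monomial contributes only if a column permutation carries its exponents to `r`. Composing the
tableau with that permutation shows that the exponents are themselves the row labels of a tableau
with the same columns. -/
theorem isTab_of_phi_ne_zero (hT : IsTab Y S r c) {e : Fin n →₀ ℕ} {a : ℂ}
    (h : phi S r c (MvPolynomial.monomial e a) ≠ 0) :
    IsTab Y S e c ∧ ∀ i ∉ S, e i = 0 := by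
  rw [phi_apply] at h
  obtain ⟨q, hq, hne⟩ := exists_ne_zero_of_sum_ne_zero h
  replace hq : q ∈ labelGroup S c := by simpa using hq
  rw [perm_smul_monomial, MvPolynomial.coeff_monomial] at hne
  have he : e.mapDomain q = expVec S r := by
    by_contra hc; rw [if_neg hc, mul_zero] at hne; exact hne rfl
  have he' : ∀ i, e i = expVec S r (q i) := fun i => by rw [← he, mapDomain_perm_apply]
  refine ⟨?_, fun i hi => ?_⟩
  · have hq' : Set.BijOn q (S : Set (Fin n)) S :=
      ⟨fun i hi => (labelGroup_apply_mem hq).2 hi, q.injective.injOn,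
        fun i hi => ⟨q⁻¹ i, (labelGroup_apply_mem (inv_mem hq)).2 hi, by simp⟩⟩
    refine (hT.comp hq').congr fun i hi => ?_
    simp only [Function.comp]
    rw [he' i, expVec_apply, if_pos ((labelGroup_apply_mem hq).2 hi), hq.2]
  · rw [he', expVec_apply, if_neg]
    rwa [labelGroup_apply_mem hq]

theorem linear_eq_zero_of_monomial {M : Type*} [AddCommGroup M] [Module ℂ M]
    (L : Poly n →ₗ[ℂ] M) (h : ∀ e, L (MvPolynomial.monomial e 1) = 0) (f : Poly n) : L f = 0 := by
  rw [f.as_sum, map_sum]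
  refine sum_eq_zero fun e _ => ?_
  have : (MvPolynomial.monomial e (MvPolynomial.coeff e f) : Poly n) =
      MvPolynomial.coeff e f • MvPolynomial.monomial e 1 := by
    rw [MvPolynomial.smul_monomial, smul_eq_mul, mul_one]
  rw [this, map_smul, h e, smul_zero]

theorem swap_smul_monomial {i k : Fin n} {e : Fin n →₀ ℕ} (h : e i = e k) (a : ℂ) :
    Equiv.swap i k • (MvPolynomial.monomial e a : Poly n) = MvPolynomial.monomial e a := by
  rw [perm_smul_monomial]
  suffices h' : e.mapDomain (Equiv.swap i k) = e by rw [h']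
  refine DFunLike.ext _ _ fun x => ?_
  rw [← Equiv.swap_apply_self i k x, mapDomain_perm_apply, Equiv.swap_apply_self,
    Equiv.swap_apply_def]
  split_ifs with h1 h2 <;> simp_all

/-- Multiples of column-symmetric polynomials without constant term are killed. -/
theorem phi_mul_invariant (hT : IsTab Y S r c) {g : Poly n}
    (hg : ∀ q ∈ labelGroup S c, q • g = g) (h0 : MvPolynomial.coeff 0 g = 0) (p : Poly n) :
    phi S r c (p * g) = 0 := by
  refine linear_eq_zero_of_monomial (phi S r c ∘ₗ LinearMap.mulRight ℂ g) (fun b => ?_) p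
  change phi S r c (MvPolynomial.monomial b 1 * g) = 0
  by_cases hb : ∃ i ∈ S, ∃ k ∈ S, i ≠ k ∧ c i = c k ∧ b i = b k
  · obtain ⟨i, hi, k, hk, hik, hc, hbk⟩ := hb
    refine phi_eq_zero_of_swap hi hk hik hc ?_
    rw [smul_mul', hg _ (swap_mem_labelGroup hi hk hc), swap_smul_monomial hbk]
  · have hinj : Set.InjOn (fun i => (b i, c i)) (S : Set (Fin n)) := by
      intro i hi k hk hik
      by_contra hne
      exact hb ⟨i, hi, k, hk, hne, (Prod.ext_iff.1 hik).2, (Prod.ext_iff.1 hik).1⟩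
    -- The exponents `b` are now distinct within columns, so they are dominated by the rows of `Y`
    -- and already have at least the total degree of a tableau on `S`. Any nonconstant monomial `d`
    -- of `g` overshoots.
    have hcnt := card_lt_le_topCount (Y := Y) hinj fun j => (hT.card_col j).le
    rw [g.as_sum, mul_sum, map_sum]
    refine sum_eq_zero fun d hd => ?_
    rw [MvPolynomial.monomial_mul, one_mul]
    by_contra hne
    obtain ⟨h1, h2⟩ := isTab_of_phi_ne_zero hT hne
    have hd0 : d ≠ 0 := by rintro rfl; exact MvPolynomial.mem_support_iff.1 hd h0
    obtain ⟨i, hi⟩ := Finsupp.ne_iff.1 hd0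
    have hiS : i ∈ S := by
      by_contra hc; have := h2 i hc; simp only [Finsupp.add_apply] at this
      simp only [Finsupp.coe_zero, Pi.zero_apply] at hi; omega
    have h3 := sum_le_sum_of_card_lt_le S S b (b + d : Fin n →₀ ℕ) rfl fun k => by
      rw [h1.card_lt]; exact hcnt k
    have h4 : ∑ x ∈ S, b x < ∑ x ∈ S, (b + d : Fin n →₀ ℕ) x :=
      sum_lt_sum (fun x _ => by simp) ⟨i, hiS, by simpa using Nat.pos_of_ne_zero hi⟩
    omega

theorem phi_X_mul_of_notMem (hT : IsTab Y S r c) {i : Fin n} (hi : i ∉ S) (p : Poly n) :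
    phi S r c (p * MvPolynomial.X i) = 0 := by
  refine phi_mul_invariant hT (fun q hq => ?_) (by simp) p
  rw [perm_smul_X, hq.1 i hi]

theorem phi_conj (w : Equiv.Perm (Fin n)) (hw : ∀ i, w i ∈ S ↔ i ∈ S) (f : Poly n) :
    phi S r c (w • f) = phi S (r ∘ w) (c ∘ w) f := by
  rw [phi_apply, phi_apply]
  refine sum_bij' (fun q _ => w⁻¹ * q * w) (fun q _ => w * q * w⁻¹) ?_ ?_ ?_ ?_ ?_
  · intro q hq; simp only [mem_filter, mem_univ, true_and, mem_labelGroup] at hq ⊢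
    refine ⟨fun i hi => ?_, fun i => ?_⟩
    · simp [hq.1 (w i) (by rwa [hw])]
    · simp [hq.2]
  · intro q hq; simp only [mem_filter, mem_univ, true_and, mem_labelGroup] at hq ⊢
    refine ⟨fun i hi => ?_, fun i => ?_⟩
    · have h1 : w.symm i ∉ S := by rw [← hw]; simpa using hi
      simp [hq.1 _ h1]
    · have := hq.2 (w⁻¹ i); simpa using this
  · intro q _; group
  · intro q _; group
  · intro q _
    have e0 : Equiv.Perm.sign (w⁻¹ * q * w) = Equiv.Perm.sign q := by
      rw [Equiv.Perm.sign_mul, Equiv.Perm.sign_mul, Equiv.Perm.sign_inv, mul_comm, ← mul_assoc,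
        Int.units_mul_self, one_mul]
    rw [e0]
    congr 1
    · have e1 : q • w • f = w • ((w⁻¹ * q * w) • f) := by
        rw [smul_smul, smul_smul]; congr 1; group
      rw [e1]
      refine perm_coeff_smul _ _ _ (fun i => ?_) _
      rw [expVec_apply, expVec_apply]; simp [hw]

theorem IsTab.comp_perm (hT : IsTab Y S r c) {w : Equiv.Perm (Fin n)}
    (hw : ∀ i, w i ∈ S ↔ i ∈ S) : IsTab Y S (r ∘ w) (c ∘ w) := by
  have hq' : Set.BijOn w (S : Set (Fin n)) S :=
    ⟨fun i hi => (hw i).2 hi, w.injective.injOn,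
      fun i hi => ⟨w⁻¹ i, (hw _).1 (by simpa using hi), by simp⟩⟩
  exact Set.BijOn.comp hT hq'

/-! ### The annihilator ideals -/

variable (Y S) in
/-- The largest ideal on which all functionals `phi S r c` vanish. -/
def annIdeal : Ideal (Poly n) where
  carrier := {f | ∀ r c, IsTab Y S r c → ∀ p, phi S r c (p * f) = 0}
  zero_mem' r c _ p := by rw [mul_zero, map_zero]
  add_mem' {f g} hf hg r c h p := by rw [mul_add, map_add, hf r c h, hg r c h, add_zero]
  smul_mem' a f hf r c h p := by rw [smul_eq_mul, ← mul_assoc]; exact hf r c h _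

theorem mem_annIdeal_of_monomial {f : Poly n}
    (h : ∀ r c, IsTab Y S r c → ∀ b, phi S r c (MvPolynomial.monomial b 1 * f) = 0) :
    f ∈ annIdeal Y S := fun r c hT p =>
  linear_eq_zero_of_monomial (phi S r c ∘ₗ LinearMap.mulRight ℂ f) (fun b => h r c hT b) p

theorem perm_smul_mem_annIdeal {w : Equiv.Perm (Fin n)} (hw : ∀ i, w i ∈ S ↔ i ∈ S) {f : Poly n}
    (hf : f ∈ annIdeal Y S) : w • f ∈ annIdeal Y S := fun r c hT p => by
  have : p * w • f = w • (w⁻¹ • p * f) := by rw [smul_mul', smul_inv_smul]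
  rw [this, phi_conj w hw]
  exact hf _ _ (hT.comp_perm hw) _

theorem X_mem_annIdeal {i : Fin n} (hi : i ∉ S) : (MvPolynomial.X i : Poly n) ∈ annIdeal Y S :=
  fun _ _ hT p => phi_X_mul_of_notMem hT hi p

/-- A monomial whose exponents do not fit into `Y` lies in the annihilator. -/
theorem monomial_mem_annIdeal {e : Fin n →₀ ℕ} {k : ℕ} (h : #{i ∈ S | e i < k} < topCount Y k) :
    (MvPolynomial.monomial e 1 : Poly n) ∈ annIdeal Y S := by
  refine mem_annIdeal_of_monomial fun r c hT b => ?_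
  rw [MvPolynomial.monomial_mul]
  by_contra hne
  obtain ⟨h1, -⟩ := isTab_of_phi_ne_zero hT hne
  have h2 := h1.card_lt k
  have h3 : #{i ∈ S | (b + e : Fin n →₀ ℕ) i < k} ≤ #{i ∈ S | e i < k} := by
    refine card_le_card fun i hi => ?_
    rw [mem_filter, Finsupp.add_apply] at hi
    exact mem_filter.2 ⟨hi.1, by omega⟩
  omega

theorem X_pow_mem_annIdeal (hS : #S = Y.card) {j : Fin n} (hj : j ∈ S) {m : ℕ} (hm : Y.colLen 0 ≤ m) :
    (MvPolynomial.X j ^ m : Poly n) ∈ annIdeal Y S := by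
  rw [MvPolynomial.X_pow_eq_monomial]
  refine monomial_mem_annIdeal (k := m) ?_
  rw [topCount_eq_card_of_le Y hm, ← hS]
  refine card_lt_card (filter_ssubset.2 ⟨j, hj, by simp⟩)

/-! ### Removing a corner of a tableau -/

section Corner

variable {i : ℕ} {j : Fin n}

theorem isTab_update (h : 0 < Y.rowLen i) (hj : j ∈ S) (hT : IsTab (shrink Y i h) (S.erase j) r c) :
    IsTab Y S (Function.update r j (cornerAt Y i).1) (Function.update c j (cornerAt Y i).2) := by
  have hne : ∀ x ∈ S, x ≠ j → (r x, c x) ≠ cornerAt Y i ∧ (r x, c x) ∈ Y := fun x hx hxj =>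
    (mem_shrink h).1 (hT.mem (mem_erase.2 ⟨hxj, hx⟩))
  refine ⟨fun x hx => ?_, fun x hx y hy hxy => ?_, fun y hy => ?_⟩
  · by_cases hxj : x = j
    · subst hxj; simpa using cornerAt_mem h
    · simpa [hxj] using (hne x hx hxj).2
  · by_cases hxj : x = j <;> by_cases hyj : y = j
    · rw [hxj, hyj]
    · subst hxj
      simp only [Function.update_self, Function.update_of_ne hyj] at hxy
      exact absurd hxy.symm (hne y hy hyj).1
    · subst hyj
      simp only [Function.update_self, Function.update_of_ne hxj] at hxy
      exact absurd hxy (hne x hx hxj).1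
    · simp only [Function.update_of_ne hxj, Function.update_of_ne hyj] at hxy
      exact hT.injOn (mem_erase.2 ⟨hxj, hx⟩) (mem_erase.2 ⟨hyj, hy⟩) hxy
  · by_cases hyc : y = cornerAt Y i
    · exact ⟨j, hj, by simp [hyc]⟩
    · obtain ⟨x, hx, rfl⟩ := hT.surjOn (show y ∈ (shrink Y i h).cells from (mem_shrink h).2 ⟨hyc, hy⟩)
      have hx' := mem_erase.1 hx
      exact ⟨x, hx'.2, by simp [hx'.1]⟩

/-- A column permutation that moves `j` sends it to a higher cell of the same column, the corner
being at the bottom. Then `X_(q j)` has an exponent larger than the tableau allows. The permutations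
that fix `j` form the column group of the smaller tableau. -/
theorem phi_update (h : 0 < Y.rowLen i) (hj : j ∈ S) (hT : IsTab (shrink Y i h) (S.erase j) r c)
    (p : Poly n) :
    phi S (Function.update r j (cornerAt Y i).1) (Function.update c j (cornerAt Y i).2)
      (MvPolynomial.X j ^ (cornerAt Y i).1 * p) = phi (S.erase j) r c p := by
  set R := (cornerAt Y i).1 with hR
  set C := (cornerAt Y i).2 with hC
  have hT' := isTab_update h hj hT
  rw [← hR, ← hC] at hT'
  set r' := Function.update r j R
  set c' := Function.update c j C
  have hexp : expVec S r' = Finsupp.single j R + expVec (S.erase j) r := by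
    ext x
    rw [Finsupp.add_apply, expVec_apply, expVec_apply]
    by_cases hx : x = j
    · subst hx; simp [r', hj]
    · simp [r', hx, mem_erase]
  rw [phi_apply, phi_apply]
  symm
  have hsub : ∀ q, q ∈ labelGroup (S.erase j) c → q ∈ labelGroup S c' := by
    intro q hq
    have hqj : q j = j := hq.1 j (by simp)
    refine ⟨fun x hx => hq.1 x fun hx' => hx (mem_of_mem_erase hx'), fun x => ?_⟩
    by_cases hx : x = j
    · rw [hx, hqj]
    · have : q x ≠ j := fun h' => hx (q.injective (h'.trans hqj.symm))
      simp only [c', Function.update_of_ne hx, Function.update_of_ne this, hq.2]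
  refine sum_congr_of_eq_on_inter ?_ ?_ ?_
  · intro q hq hq'
    simp only [mem_filter, mem_univ, true_and] at hq hq'
    exact absurd (hsub q hq) hq'
  · intro q hq hq'
    simp only [mem_filter, mem_univ, true_and] at hq hq'
    have hqS : q j ∈ S := (labelGroup_apply_mem hq).2 hj
    have hqj : q j ≠ j := by
      intro hqj
      refine hq' ⟨fun x hx => ?_, fun x => ?_⟩
      · by_cases hxj : x = j
        · rw [hxj, hqj]
        · exact hq.1 x fun h' => hx (mem_erase.2 ⟨hxj, h'⟩)
      · by_cases hx : x = j
        · rw [hx, hqj]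
        · have h1 : q x ≠ j := fun h' => hx (q.injective (h'.trans hqj.symm))
          have := hq.2 x
          simpa only [c', Function.update_of_ne hx, Function.update_of_ne h1] using this
    have hlt : r' (q j) < R := by
      have h1 : (r' (q j), c' (q j)) ∈ Y := hT'.mem hqS
      rw [hq.2 j] at h1
      have h2 : c' j = C := by simp [c']
      rw [h2, YoungDiagram.mem_iff_lt_colLen, hC, colLen_cornerAt h] at h1
      have h3 : r' (q j) ≠ R := fun h3 => hqj (hT'.eq_of_eq hqS hj (by simp [h3, r']) (hq.2 j))
      omega
    rw [smul_mul', smul_pow', perm_smul_X, MvPolynomial.X_pow_eq_monomial,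
      MvPolynomial.coeff_monomial_mul', if_neg, mul_zero]
    intro hle
    have := hle (q j)
    rw [expVec_apply, if_pos hqS, Finsupp.single_eq_same] at this
    omega
  · intro q hq _
    simp only [mem_filter, mem_univ, true_and] at hq
    rw [smul_mul', smul_pow', perm_smul_X, hq.1 j (by simp), MvPolynomial.X_pow_eq_monomial, hexp,
      MvPolynomial.coeff_monomial_mul, one_mul]

/-- Multiplication by a power of `X_j` raises the exponent `i` to the row of the corner, where
`phi_update` applies. The error term is divisible by `X_j` to the length of the corner's column, and
no cell of that column has such a row index. -/
theorem mem_annIdeal_shrink (h : 0 < Y.rowLen i) (hj : j ∈ S) {p : Poly n}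
    (hp : MvPolynomial.X j ^ i * p ∈ annIdeal Y S ⊔ Ideal.span {MvPolynomial.X j ^ (i + 1)}) :
    p ∈ annIdeal (shrink Y i h) (S.erase j) := by
  obtain ⟨u, hu, v, hv, huv⟩ := Submodule.mem_sup.1 hp
  obtain ⟨w, rfl⟩ := Ideal.mem_span_singleton'.1 hv
  intro r c hT q
  rw [← phi_update h hj hT]
  have hT' := isTab_update h hj hT
  obtain ⟨m, hm⟩ : ∃ m, (cornerAt Y i).1 = m + i := ⟨_, (Nat.sub_add_cancel (le_cornerAt h)).symm⟩
  have hcol : Y.colLen (cornerAt Y i).2 = m + (i + 1) := by rw [colLen_cornerAt h, hm]; ring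
  have e1 : MvPolynomial.X j ^ (cornerAt Y i).1 * (q * p) =
      (MvPolynomial.X j ^ m * q) * u + q * w * MvPolynomial.X j ^ (m + (i + 1)) := by
    rw [hm]
    linear_combination (-(MvPolynomial.X j ^ m * q)) * huv
  rw [e1, map_add, hu _ _ hT', zero_add]
  refine linear_eq_zero_of_monomial (phi _ _ _ ∘ₗ LinearMap.mulRight ℂ _) (fun b => ?_) (q * w)
  change phi _ _ _ (MvPolynomial.monomial b 1 * _) = 0
  rw [MvPolynomial.X_pow_eq_monomial, MvPolynomial.monomial_mul]
  by_contra hne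
  have h1 := (isTab_of_phi_ne_zero hT' hne).1.mem hj
  rw [Function.update_self, YoungDiagram.mem_iff_lt_colLen, hcol, Finsupp.add_apply,
    Finsupp.single_eq_same] at h1
  omega

end Corner

end phi

end Tableaux

/-! ### Tanisaki ideals -/

section Tanisaki

variable {n : ℕ} {Y : YoungDiagram} {S : Finset (Fin n)}

theorem esymmOn_zero (I : Finset (Fin n)) : esymmOn I 0 = 1 := by simp [esymmOn]

theorem esymmOn_eq_zero {I : Finset (Fin n)} {t : ℕ} (h : #I < t) : esymmOn I t = 0 := by
  rw [esymmOn, powersetCard_eq_empty.2 h, sum_empty]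

theorem esymmOn_insert {I : Finset (Fin n)} {j : Fin n} (hj : j ∉ I) (t : ℕ) :
    esymmOn (insert j I) (t + 1) = esymmOn I (t + 1) + MvPolynomial.X j * esymmOn I t := by
  rw [esymmOn, powersetCard_succ_insert hj, sum_union, sum_image, esymmOn, esymmOn, mul_sum]
  · congr 1
    refine sum_congr rfl fun A hA => prod_insert fun h => hj ((mem_powersetCard.1 hA).1 h)
  · intro A hA B hB hAB
    have hA' : j ∉ A := fun h => hj ((mem_powersetCard.1 hA).1 h)
    have hB' : j ∉ B := fun h => hj ((mem_powersetCard.1 hB).1 h)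
    rw [← erase_insert hA', ← erase_insert hB']
    exact congrArg (fun x => erase x j) hAB
  · rw [disjoint_left]
    rintro A hA hA'
    obtain ⟨B, -, rfl⟩ := mem_image.1 hA'
    exact hj ((mem_powersetCard.1 hA).1 (mem_insert_self _ _))

theorem coeff_zero_esymmOn (I : Finset (Fin n)) {t : ℕ} (ht : 0 < t) :
    MvPolynomial.coeff 0 (esymmOn I t) = 0 := by
  rw [← MvPolynomial.constantCoeff_eq, esymmOn, map_sum]
  refine sum_eq_zero fun A hA => ?_
  rw [map_prod]
  obtain ⟨i, hi⟩ : A.Nonempty := card_pos.1 (by rw [(mem_powersetCard.1 hA).2]; exact ht)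
  exact prod_eq_zero hi (by simp)

/-- In the expansion of e_t(U ∪ V) into products e_s(V) e_{t-s}(U) only s ≤ |V| < t occurs, so each
term has a factor of positive degree in `U`. -/
theorem esymmOn_union_mem {J : Ideal (Poly n)} {U : Finset (Fin n)}
    (hU : ∀ t, 0 < t → esymmOn U t ∈ J) (V : Finset (Fin n)) :
    Disjoint U V → ∀ t, #V < t → esymmOn (U ∪ V) t ∈ J := by
  induction V using Finset.induction_on with
  | empty => intro _ t ht; rw [union_empty]; exact hU t (by simpa using ht)
  | insert v V hv ih =>
    intro hd t ht
    rw [card_insert_of_notMem hv] at ht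
    have hd' : Disjoint U V := hd.mono_right (subset_insert _ _)
    have hvU : v ∉ U := fun h => disjoint_left.1 hd h (mem_insert_self _ _)
    obtain ⟨t, rfl⟩ : ∃ t', t = t' + 1 := ⟨t - 1, by omega⟩
    rw [union_insert, esymmOn_insert (by simp [hv, hvU])]
    exact J.add_mem (ih hd' _ (by omega)) (J.mul_mem_left _ (ih hd' _ (by omega)))

/-- The number of cells in the last `r` of the first `s` columns. -/
def lastCols (Y : YoungDiagram) (s r : ℕ) : ℕ := ∑ j ∈ Ico (s - r) s, Y.colLen j

theorem lastCols_add (Y : YoungDiagram) {s r : ℕ} (hs : Y.card = s) :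
    ∑ j ∈ range (s - r), Y.colLen j + lastCols Y s r = s := by
  rw [lastCols, sum_range_add_sum_Ico _ (Nat.sub_le _ _), card_le_colLen_of_rowLen_zero, hs]
  rw [← hs]; exact rowLen_le_card _ _

variable (Y S) in
/-- The Tanisaki generators in the variables `X_i`, `i ∈ S`, and the other variables. -/
def tanGens : Set (Poly n) :=
  {f | (∃ i ∉ S, f = MvPolynomial.X i) ∨
    ∃ I ⊆ S, ∃ t, 1 ≤ t ∧ t ≤ #I ∧ #I < t + lastCols Y #S #I ∧ f = esymmOn I t}

variable (Y S) in
/-- The Tanisaki ideal in the variables `X_i`, `i ∈ S`. -/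
def tanIdeal : Ideal (Poly n) := Ideal.span (tanGens Y S)

theorem esymmOn_mem_tanIdeal {I : Finset (Fin n)} (hI : I ⊆ S) {t : ℕ} (h1 : 1 ≤ t)
    (h : #I < t + lastCols Y #S #I) : esymmOn I t ∈ tanIdeal Y S := by
  by_cases ht : t ≤ #I
  · exact Ideal.subset_span (Or.inr ⟨I, hI, t, h1, ht, h, rfl⟩)
  · rw [esymmOn_eq_zero (by omega)]; exact Ideal.zero_mem _

/-- The positive elementary symmetric polynomials of a union of full columns are column-symmetric,
hence killed. An arbitrary `I` consists of its full columns and too few further elements for e_t to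
survive. -/
theorem tanIdeal_le_annIdeal (hS : #S = Y.card) : tanIdeal Y S ≤ annIdeal Y S := by
  refine Ideal.span_le.2 ?_
  rintro _ (⟨i, hi, rfl⟩ | ⟨I, hI, t, -, -, ht, rfl⟩)
  · exact X_mem_annIdeal hi
  · intro r c hT
    let J : Ideal (Poly n) :=
      { carrier := {f | ∀ p, phi S r c (p * f) = 0}
        zero_mem' := fun p => by rw [mul_zero, map_zero]
        add_mem' := fun {f g} hf hg p => by rw [mul_add, map_add, hf, hg, add_zero]
        smul_mem' := fun a f hf p => by rw [smul_eq_mul, ← mul_assoc]; exact hf _ }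
    -- `U` collects the elements of `I` whose whole column lies in `I`; the column group permutes
    -- it.
    set U := {i ∈ I | ∀ k ∈ S, c k = c i → k ∈ I} with hUdef
    have hUI : U ⊆ I := filter_subset _ _
    have hUS : U ⊆ S := hUI.trans hI
    have hU : ∀ t, 0 < t → esymmOn U t ∈ J := by
      intro t ht p
      refine phi_mul_invariant hT (fun q hq => ?_) (coeff_zero_esymmOn _ ht) p
      rw [perm_smul_esymmOn]
      congr 1
      refine eq_of_subset_of_card_le (fun x hx => ?_) (by simp)
      obtain ⟨i, hi, rfl⟩ := mem_map.1 hx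
      obtain ⟨hiI, hi'⟩ := mem_filter.1 hi
      simp only [Equiv.coe_toEmbedding]
      refine mem_filter.2 ⟨hi' _ ((labelGroup_apply_mem hq).2 (hI hiI)) (hq.2 i), fun k hk hck => ?_⟩
      exact hi' k hk (hck.trans (hq.2 i))
    have key := esymmOn_union_mem hU (I \ U) disjoint_sdiff t
    rw [union_sdiff_of_subset hUI] at key
    refine key ?_
    -- The complement of `U` lies in the columns that meet `S \ I`. There are at most `#S - #I` of
    -- them, and the first columns of `Y` are the longest.
    have h1 : #(S \ U) ≤ ∑ j ∈ range (#S - #I), Y.colLen j := by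
      have hB : #((S \ I).image c) ≤ #S - #I := card_image_le.trans (card_sdiff_of_subset hI).le
      refine le_trans ?_ (sum_le_sum_range_of_antitone Y.colLen_anti _ hB)
      rw [← sum_congr rfl fun j _ => hT.card_col j, ← card_biUnion]
      · refine card_le_card fun i hi => ?_
        obtain ⟨hiS, hiU⟩ := mem_sdiff.1 hi
        refine mem_biUnion.2 ⟨c i, ?_, by simp [hiS]⟩
        by_cases hiI : i ∈ I
        · have : ¬ ∀ k ∈ S, c k = c i → k ∈ I := fun h => hiU (mem_filter.2 ⟨hiI, h⟩)
          push Not at this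
          obtain ⟨k, hk, hck, hkI⟩ := this
          exact mem_image.2 ⟨k, mem_sdiff.2 ⟨hk, hkI⟩, hck⟩
        · exact mem_image_of_mem _ (mem_sdiff.2 ⟨hiS, hiI⟩)
      · intro a _ b _ hab
        rw [Function.onFun, disjoint_left]
        intro x hx hx'
        exact hab ((mem_filter.1 hx).2.symm.trans (mem_filter.1 hx').2)
    have h2 := lastCols_add Y (s := #S) (r := #I) hS.symm
    rw [card_sdiff_of_subset hUS] at h1
    rw [card_sdiff_of_subset hUI]
    have := card_le_card hUS
    have := card_le_card hUI
    have := card_le_card hI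
    omega

theorem lastCols_self (hS : #S = Y.card) : lastCols Y #S #S = #S := by
  simpa using lastCols_add Y (s := #S) (r := #S) hS.symm

theorem X_mul_esymmOn_mem {J : Ideal (Poly n)} {I : Finset (Fin n)} {j : Fin n} (hj : j ∉ I) {t : ℕ}
    (h : esymmOn (insert j I) (t + 1) ∈ J) :
    esymmOn I (t + 1) + MvPolynomial.X j * esymmOn I t ∈ J := by
  rwa [← esymmOn_insert hj]

/-- Modulo `J`, `esymmOn_insert` reads X_j e_t(I) ≡ -e_{t+1}(I). Iteration gives X_j^i e_t(I) ≡ ±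
e_{t+i}(I). -/
theorem X_pow_mul_esymmOn_mem {J : Ideal (Poly n)} {I : Finset (Fin n)} {j : Fin n} (hj : j ∉ I) (i : ℕ) :
    ∀ {t : ℕ}, (∀ u, 1 ≤ u → esymmOn (insert j I) (t + u) ∈ J) →
      esymmOn I (t + i) ∈ J → MvPolynomial.X j ^ i * esymmOn I t ∈ J := by
  induction i with
  | zero => intro t _ h; simpa using h
  | succ i ih =>
    intro t h1 h2
    have h3 := ih (t := t + 1) (fun u hu => by have := h1 (u + 1) (by omega); rwa [show t + 1 + u = t + (u + 1) by ring])
      (by rwa [show t + 1 + i = t + (i + 1) by ring])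
    have h4 := J.mul_mem_left (MvPolynomial.X j ^ i) (X_mul_esymmOn_mem hj (h1 1 le_rfl))
    have e : MvPolynomial.X j ^ (i + 1) * esymmOn I t = MvPolynomial.X j ^ i *
      (esymmOn I (t + 1) + MvPolynomial.X j * esymmOn I t) -
        MvPolynomial.X j ^ i * esymmOn I (t + 1) := by ring
    rw [e]
    exact J.sub_mem h4 h3

/-- Up to sign the power is e_m(S \ {j}) with m the length of the first column, modulo the symmetric
polynomials of all of `S`; this is exactly the first degree allowed for subsets of size `#S - 1`. -/
theorem X_pow_mem_tanIdeal (hS : #S = Y.card) {j : Fin n} (hj : j ∈ S) :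
    (MvPolynomial.X j ^ (Y.colLen 0) : Poly n) ∈ tanIdeal Y S := by
  have := X_pow_mul_esymmOn_mem (J := tanIdeal Y S) (notMem_erase j S) (Y.colLen 0) (t := 0) ?_ ?_
  · rwa [esymmOn_zero, mul_one] at this
  · intro u hu
    rw [insert_erase hj]
    exact esymmOn_mem_tanIdeal subset_rfl (by omega) (by rw [lastCols_self hS]; omega)
  · have hpos : 0 < #S := card_pos.2 ⟨j, hj⟩
    have h0 : 0 < Y.colLen 0 := by
      by_contra h0
      have := topCount_eq_card_of_le Y (k := 0) (by omega)
      simp only [topCount, range_zero, sum_empty] at this; omega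
    have h1 := lastCols_add Y (s := #S) (r := #S - 1) hS.symm
    rw [show #S - (#S - 1) = 1 by omega] at h1
    simp only [range_one, sum_singleton] at h1
    refine esymmOn_mem_tanIdeal (erase_subset _ _) (by omega) ?_
    rw [card_erase_of_mem hj]; omega

theorem X_pow_mul_mem_of_shrink {i : ℕ} (h : 0 < Y.rowLen i) (hS : #S = Y.card) {j : Fin n}
    (hj : j ∈ S) {p : Poly n} (hp : p ∈ tanIdeal (shrink Y i h) (S.erase j)) :
    MvPolynomial.X j ^ i * p ∈ tanIdeal Y S ⊔ Ideal.span {MvPolynomial.X j ^ (i + 1)} := by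
  set J := tanIdeal Y S ⊔ Ideal.span {(MvPolynomial.X j ^ (i + 1) : Poly n)} with hJ
  have hle : tanIdeal Y S ≤ J := le_sup_left
  have hX : (MvPolynomial.X j ^ (i + 1) : Poly n) ∈ J :=
    (le_sup_right : _ ≤ J) (Ideal.mem_span_singleton_self _)
  have key : tanIdeal (shrink Y i h) (S.erase j) ≤
      Submodule.comap (LinearMap.mulLeft (Poly n) (MvPolynomial.X j ^ i)) J := by
    refine Ideal.span_le.2 ?_
    rintro _ (⟨k, hk, rfl⟩ | ⟨I, hI, t, ht1, ht2, ht, rfl⟩)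
    · change MvPolynomial.X j ^ i * MvPolynomial.X k ∈ J
      by_cases hkj : k = j
      · rw [hkj, ← pow_succ]; exact hX
      · exact J.mul_mem_left _ (hle (Ideal.subset_span (Or.inl ⟨k, fun h' => hk (mem_erase.2 ⟨hkj, h'⟩), rfl⟩)))
    · change MvPolynomial.X j ^ i * esymmOn I t ∈ J
      have hjI : j ∉ I := fun h' => (mem_erase.1 (hI h')).1 rfl
      have hIS : I ⊆ S := hI.trans (erase_subset _ _)
      have hcI : #(insert j I) = #I + 1 := card_insert_of_notMem hjI
      have hpos : 0 < #S := card_pos.2 ⟨j, hj⟩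
      have hIlt : #I + 1 ≤ #S := by rw [← hcI]; exact card_le_card (insert_subset hj hIS)
      have hce : #(S.erase j) = #S - 1 := card_erase_of_mem hj
      have hcs := card_shrink h
      set C := (cornerAt Y i).2 with hC
      -- compare the column sums
      have hcmp : lastCols (shrink Y i h) (#S - 1) #I +
          (if #S - 1 - #I ≤ C then 1 else 0) = lastCols Y #S (#I + 1) := by
        have h1 := lastCols_add (shrink Y i h) (s := #S - 1) (r := #I) (by omega)
        have h2 := lastCols_add Y (s := #S) (r := #I + 1) hS.symm
        have h3 : ∑ x ∈ range (#S - 1 - #I), (shrink Y i h).colLen x +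
            (if C < #S - 1 - #I then 1 else 0) = ∑ x ∈ range (#S - 1 - #I), Y.colLen x := by
          rw [← sum_congr rfl fun x _ => colLen_shrink h x, sum_add_distrib, sum_ite_eq']
          simp [hC]
        rw [show #S - (#I + 1) = #S - 1 - #I by omega] at h2
        split_ifs at h3 ⊢ <;> omega
      rw [hce] at ht
      -- If the corner's column is counted, e_t of `I` enlarged by `j` is a generator for `Y`, and
      -- it differs from e_t(I) by a multiple of X_j. Otherwise all e_{t+u} of the enlarged set with
      -- u ≥ 1 are available, and so is e_{t+i}(I), since the additional column lies to the right of
      -- the corner and has length at most `i`.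
      by_cases hc : #S - 1 - #I ≤ C
      · rw [if_pos hc] at hcmp
        obtain ⟨t, rfl⟩ : ∃ t', t = t' + 1 := ⟨t - 1, by omega⟩
        have h1 : esymmOn (insert j I) (t + 1) ∈ J :=
          hle (esymmOn_mem_tanIdeal (insert_subset hj hIS) (by omega) (by rw [hcI]; omega))
        have e : MvPolynomial.X j ^ i * esymmOn I (t + 1) =
            MvPolynomial.X j ^ i * esymmOn (insert j I) (t + 1) -
              esymmOn I t * MvPolynomial.X j ^ (i + 1) := by
          rw [esymmOn_insert hjI]; ring
        rw [e]
        exact J.sub_mem (J.mul_mem_left _ h1) (J.mul_mem_left _ hX)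
      · rw [if_neg hc] at hcmp
        refine hle (X_pow_mul_esymmOn_mem hjI i (fun u hu => ?_) ?_)
        · exact esymmOn_mem_tanIdeal (insert_subset hj hIS) (by omega) (by rw [hcI]; omega)
        · refine esymmOn_mem_tanIdeal hIS (by omega) ?_
          have h1 := lastCols_add Y (s := #S) (r := #I) hS.symm
          have h2 := lastCols_add Y (s := #S) (r := #I + 1) hS.symm
          rw [show #S - #I = #S - (#I + 1) + 1 by omega, sum_range_succ] at h1
          have h3 : Y.colLen (#S - (#I + 1)) ≤ i := colLen_le_of_cornerAt_lt (by omega)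
          omega
  exact key hp

/-- For the empty diagram the only functional is the constant coefficient, and its kernel is
generated by the variables. -/
theorem annIdeal_empty_le (hY : Y.card = 0) : annIdeal Y (∅ : Finset (Fin n)) ≤ tanIdeal Y ∅ := by
  intro f hf
  have hT : IsTab Y (∅ : Finset (Fin n)) 0 0 := by
    have : Y.cells = ∅ := card_eq_zero.1 hY
    simp [IsTab, this]
  have h0 := hf 0 0 hT 1
  rw [one_mul, phi_apply, sum_eq_single 1] at h0
  · have hz : expVec (∅ : Finset (Fin n)) 0 = 0 := by ext; simp [expVec_apply]
    rw [one_smul, hz] at h0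
    simp only [Equiv.Perm.sign_one, Units.val_one, Int.cast_one, one_mul] at h0
    rw [f.as_sum]
    refine Ideal.sum_mem _ fun e he => ?_
    have he0 : e ≠ 0 := by rintro rfl; exact MvPolynomial.mem_support_iff.1 he h0
    obtain ⟨i, hi⟩ := Finsupp.ne_iff.1 he0
    have : (MvPolynomial.X i : Poly n) ∣ MvPolynomial.monomial e (MvPolynomial.coeff e f) := by
      rw [MvPolynomial.X_dvd_monomial]; exact Or.inr hi
    exact Ideal.mem_of_dvd _ this (Ideal.subset_span (Or.inl ⟨i, by simp, rfl⟩))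
  · intro q hq hq1
    refine absurd ?_ hq1
    ext i
    have := (mem_filter.1 hq).2.1 i (by simp)
    simp [this]
  · intro h; exact absurd (by simp [one_mem]) h

/-- The Tanisaki ideal is the annihilator of the antisymmetrized coefficient functionals. -/
theorem annIdeal_eq_tanIdeal : ∀ (s : ℕ) (Y : YoungDiagram) (S : Finset (Fin n)), #S = s →
    Y.card = s → annIdeal Y S = tanIdeal Y S := by
  intro s
  induction s with
  | zero =>
    intro Y S hS hY
    obtain rfl := card_eq_zero.1 hS
    exact le_antisymm (annIdeal_empty_le hY) (tanIdeal_le_annIdeal (by simp [hY]))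
  | succ s ih =>
    intro Y S hS hY
    have hSY : #S = Y.card := by omega
    have hle := tanIdeal_le_annIdeal hSY
    refine le_antisymm ?_ hle
    obtain ⟨j, hj⟩ : S.Nonempty := card_pos.1 (by omega)
    -- Push an element of the annihilator into higher powers of `X_j`: the coefficient of `X_j ^ i`
    -- lies in the annihilator for a smaller diagram, which is a Tanisaki ideal by induction, and
    -- this lifts back modulo `X_j ^ (i + 1)`. The process ends because `X_j` is nilpotent modulo
    -- the Tanisaki ideal.
    have step : ∀ i, i ≤ Y.colLen 0 → annIdeal Y S ≤
        tanIdeal Y S ⊔ Ideal.span {(MvPolynomial.X j ^ i : Poly n)} := by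
      intro i
      induction i with
      | zero => intro _; simp
      | succ i ihi =>
        intro hi p hp
        obtain ⟨u, hu, v, hv, rfl⟩ := Submodule.mem_sup.1 (ihi (by omega) hp)
        obtain ⟨w, rfl⟩ := Ideal.mem_span_singleton'.1 hv
        have h : 0 < Y.rowLen i := (rowLen_pos_iff Y i).2 (by omega)
        have h1 : MvPolynomial.X j ^ i * w ∈ annIdeal Y S := by
          have := (annIdeal Y S).sub_mem hp (hle hu)
          rwa [add_sub_cancel_left, mul_comm] at this
        have h2 := mem_annIdeal_shrink h hj (Ideal.mem_sup_left h1)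
        have hc := card_shrink h
        rw [ih (shrink Y i h) (S.erase j) (by rw [card_erase_of_mem hj]; omega) (by omega)] at h2
        have h3 := X_pow_mul_mem_of_shrink h hSY hj h2
        rw [mul_comm] at h3
        exact Ideal.add_mem _ (Ideal.mem_sup_left hu) h3
    refine (step _ le_rfl).trans (sup_le le_rfl ?_)
    rw [Ideal.span_singleton_le_iff_mem]
    exact X_pow_mem_tanIdeal hSY hj

/-- The Garsia–Procesi recursion: multiplication by `X_j ^ i` identifies the quotient for the
shrunken diagram with the i-th piece of the `X_j`-adic filtration. One direction uses the
functionals, the other the Tanisaki generators. -/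
theorem X_pow_mul_mem_iff {i : ℕ} (h : 0 < Y.rowLen i) (hS : #S = Y.card) {j : Fin n}
    (hj : j ∈ S) {p : Poly n} :
    MvPolynomial.X j ^ i * p ∈ annIdeal Y S ⊔ Ideal.span {MvPolynomial.X j ^ (i + 1)} ↔
      p ∈ annIdeal (shrink Y i h) (S.erase j) := by
  refine ⟨mem_annIdeal_shrink h hj, fun hp => ?_⟩
  have hc := card_shrink h
  have hpos : 0 < #S := card_pos.2 ⟨j, hj⟩
  rw [annIdeal_eq_tanIdeal _ _ _ rfl (by rw [card_erase_of_mem hj]; omega)] at hp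
  rw [annIdeal_eq_tanIdeal _ _ _ rfl hS.symm]
  exact X_pow_mul_mem_of_shrink h hS hj hp

end Tanisaki

/-! ### Vanishing of equivariant Koszul cohomology -/

section Vanishing

variable {n : ℕ}

/-- `I` is stable under `G`. -/
def Stable (G : Subgroup (Equiv.Perm (Fin n))) (I : Ideal (Poly n)) : Prop :=
  ∀ σ ∈ G, ∀ f ∈ I, σ • f ∈ I

/-- The `G`-equivariant Koszul cohomology of `I₂ / I₁` vanishes in degrees `0` and `1`. -/
structure Vanish (I₁ I₂ : Ideal (Poly n)) (G : Subgroup (Equiv.Perm (Fin n))) : Prop where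
  h0 : ∀ y ∈ I₂, (∀ σ ∈ G, σ • y - y ∈ I₁) → (∀ i, MvPolynomial.X i * y ∈ I₁) → y ∈ I₁
  h1 : ∀ y : Fin n → Poly n, (∀ i, y i ∈ I₂) →
    (∀ i k, MvPolynomial.X i * y k - MvPolynomial.X k * y i ∈ I₁) →
    (∀ σ ∈ G, ∀ i, σ • y i - y (σ i) ∈ I₁) → ∃ g ∈ I₂, ∀ i, y i - MvPolynomial.X i * g ∈ I₁

variable {I₁ I₂ I₃ : Ideal (Poly n)} {G : Subgroup (Equiv.Perm (Fin n))}

theorem Stable.sup (h1 : Stable G I₁) (h2 : Stable G I₂) : Stable G (I₁ ⊔ I₂) := by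
  intro σ hσ f hf
  obtain ⟨u, hu, v, hv, rfl⟩ := Submodule.mem_sup.1 hf
  rw [smul_add]
  exact Ideal.add_mem _ (Ideal.mem_sup_left (h1 σ hσ u hu)) (Ideal.mem_sup_right (h2 σ hσ v hv))

theorem stable_span_singleton {m : Poly n} (h : ∀ σ ∈ G, σ • m = m) :
    Stable G (Ideal.span {m}) := by
  intro σ hσ f hf
  obtain ⟨a, rfl⟩ := Ideal.mem_span_singleton'.1 hf
  rw [smul_mul', h σ hσ]
  exact Ideal.mul_mem_left _ _ (Ideal.mem_span_singleton_self _)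

theorem stable_annIdeal (Y : YoungDiagram) (S : Finset (Fin n)) (ρ : Fin n → ℕ) :
    Stable (labelGroup S ρ) (annIdeal Y S) := fun _ hσ _ hf =>
  perm_smul_mem_annIdeal (fun _ => labelGroup_apply_mem hσ) hf

theorem Stable.mono {G' : Subgroup (Equiv.Perm (Fin n))} (h : Stable G I₁) (hG : G' ≤ G) :
    Stable G' I₁ := fun σ hσ => h σ (hG hσ)

/-- Enlarging the group only strengthens the hypotheses on `y`; the conclusions do not mention it.
So vanishing may be proved for the stabilizer of one variable. -/
theorem Vanish.mono {G' : Subgroup (Equiv.Perm (Fin n))} (h : Vanish I₁ I₂ G') (hG : G' ≤ G) :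
    Vanish I₁ I₂ G :=
  ⟨fun y hy hG' => h.h0 y hy fun σ hσ => hG' σ (hG hσ),
    fun y hy hc hG' => h.h1 y hy hc fun σ hσ => hG' σ (hG hσ)⟩

theorem vanish_self (I : Ideal (Poly n)) : Vanish I I G :=
  ⟨fun _ hy _ _ => hy, fun _ hy _ _ => ⟨0, I.zero_mem, fun i => by simpa using hy i⟩⟩

/-- A primitive of an equivariant cocycle may be chosen invariant. -/
theorem exists_invariant_primitive (hI : Stable G I₂) (hI₃ : Stable G I₃) {y : Fin n → Poly n}
    (hy : ∀ σ ∈ G, ∀ i, σ • y i - y (σ i) ∈ I₂) {g₀ : Poly n} (hg₀ : g₀ ∈ I₃)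
    (h : ∀ i, y i - MvPolynomial.X i * g₀ ∈ I₂) :
    ∃ g ∈ I₃, (∀ σ ∈ G, σ • g = g) ∧ ∀ i, y i - MvPolynomial.X i * g ∈ I₂ := by
  classical
  have hN : (Fintype.card G : ℂ) ≠ 0 := Nat.cast_ne_zero.2 Fintype.card_ne_zero
  refine ⟨(Fintype.card G : ℂ)⁻¹ • ∑ σ : G, (σ : Equiv.Perm (Fin n)) • g₀, ?_, ?_, ?_⟩
  · rw [MvPolynomial.smul_eq_C_mul]
    exact I₃.mul_mem_left _ (I₃.sum_mem fun σ _ => hI₃ σ σ.2 _ hg₀)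
  · intro τ hτ
    rw [smul_comm, smul_sum]
    congr 1
    refine Fintype.sum_equiv (Equiv.mulLeft (⟨τ, hτ⟩ : G)) _ _ fun σ => ?_
    rw [smul_smul]; rfl
  · intro i
    have e : y i - MvPolynomial.X i * ((Fintype.card G : ℂ)⁻¹ •
        ∑ σ : G, (σ : Equiv.Perm (Fin n)) • g₀) = (Fintype.card G : ℂ)⁻¹ •
          ∑ σ : G, (y i - MvPolynomial.X i * (σ : Equiv.Perm (Fin n)) • g₀) := by
      rw [sum_sub_distrib, smul_sub, sum_const, card_univ, ← Nat.cast_smul_eq_nsmul ℂ, smul_smul,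
        inv_mul_cancel₀ hN, one_smul, mul_smul_comm, mul_sum]
    rw [e, MvPolynomial.smul_eq_C_mul]
    refine I₂.mul_mem_left _ (I₂.sum_mem fun σ _ => ?_)
    obtain ⟨σ, hσ⟩ := σ
    obtain ⟨k, rfl⟩ := σ.surjective i
    have e2 : y (σ k) - MvPolynomial.X (σ k) * σ • g₀ =
        σ • (y k - MvPolynomial.X k * g₀) - (σ • y k - y (σ k)) := by
      rw [smul_sub, smul_mul', perm_smul_X]; ring
    change y (σ k) - MvPolynomial.X (σ k) * σ • g₀ ∈ I₂
    rw [e2]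
    exact I₂.sub_mem (hI σ hσ _ (h k)) (hy σ hσ k)

/-- The long exact sequence of 0 → I₂/I₁ → I₃/I₁ → I₃/I₂ → 0. The primitive modulo `I₂` is made
invariant first, so that subtracting its coboundary keeps the cocycle equivariant. -/
theorem Vanish.trans (h12 : Vanish I₁ I₂ G) (h23 : Vanish I₂ I₃ G) (hle : I₁ ≤ I₂) (hle' : I₂ ≤ I₃)
    (hs2 : Stable G I₂) (hs3 : Stable G I₃) : Vanish I₁ I₃ G := by
  refine ⟨fun y hy hG hX => ?_, fun y hy hc hG => ?_⟩
  · exact h12.h0 y (h23.h0 y hy (fun σ hσ => hle (hG σ hσ)) fun i => hle (hX i)) hG hX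
  · obtain ⟨g₀, hg₀, h⟩ := h23.h1 y hy (fun i k => hle (hc i k)) fun σ hσ i => hle (hG σ hσ i)
    obtain ⟨g, hg, hginv, h⟩ := exists_invariant_primitive hs2 hs3
      (fun σ hσ i => hle (hG σ hσ i)) hg₀ h
    obtain ⟨g', hg', h'⟩ := h12.h1 (fun i => y i - MvPolynomial.X i * g) h (fun i k => by
      have e : MvPolynomial.X i * (y k - MvPolynomial.X k * g) -
        MvPolynomial.X k * (y i - MvPolynomial.X i * g) =
          MvPolynomial.X i * y k - MvPolynomial.X k * y i := by ring
      rw [e]; exact hc i k) (fun σ hσ i => by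
      have e : σ • (y i - MvPolynomial.X i * g) - (y (σ i) - MvPolynomial.X (σ i) * g) =
          σ • y i - y (σ i) := by
        rw [smul_sub, smul_mul', perm_smul_X, hginv σ hσ]; ring
      rw [e]; exact hG σ hσ i)
    refine ⟨g + g', I₃.add_mem hg (hle' hg'), fun i => ?_⟩
    have e : y i - MvPolynomial.X i * (g + g') =
      y i - MvPolynomial.X i * g - MvPolynomial.X i * g' := by ring
    rw [e]; exact h' i

/-- Multiplication by the invariant element `m` is an equivariant isomorphism from ℂ[X]/J onto (I₁ +
(m))/I₁, and vanishing is transported along it. -/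
theorem Vanish.of_colon {J : Ideal (Poly n)} (hJ : Vanish J ⊤ G) {m : Poly n}
    (hm : ∀ σ ∈ G, σ • m = m) (hs : Stable G I₁) (h : ∀ w, m * w ∈ I₁ ↔ w ∈ J) :
    Vanish I₁ (I₁ ⊔ Ideal.span {m}) G := by
  have key : ∀ y ∈ I₁ ⊔ Ideal.span {m}, ∃ w, y - m * w ∈ I₁ := by
    intro y hy
    obtain ⟨u, hu, v, hv, rfl⟩ := Submodule.mem_sup.1 hy
    obtain ⟨w, rfl⟩ := Ideal.mem_span_singleton'.1 hv
    exact ⟨w, by rwa [mul_comm m, add_sub_cancel_right]⟩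
  refine ⟨fun y hy hG hX => ?_, fun y hy hc hG => ?_⟩
  · obtain ⟨w, hw⟩ := key y hy
    have h1 : w ∈ J := by
      refine hJ.h0 w trivial (fun σ hσ => ?_) fun i => ?_
      · rw [← h]
        have e : m * (σ • w - w) = σ • y - y - (σ • (y - m * w) - (y - m * w)) := by
          rw [smul_sub, smul_mul', hm σ hσ]; ring
        rw [e]
        exact I₁.sub_mem (hG σ hσ) (I₁.sub_mem (hs σ hσ _ hw) hw)
      · rw [← h]
        have e : m * (MvPolynomial.X i * w) =
          MvPolynomial.X i * y - MvPolynomial.X i * (y - m * w) := by ring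
        rw [e]
        exact I₁.sub_mem (hX i) (I₁.mul_mem_left _ hw)
    have := I₁.add_mem hw ((h w).2 h1)
    rwa [sub_add_cancel] at this
  · choose w hw using fun i => key (y i) (hy i)
    obtain ⟨g, -, hg⟩ := hJ.h1 w (fun _ => trivial) (fun i k => by
      rw [← h]
      have e : m * (MvPolynomial.X i * w k - MvPolynomial.X k * w i) =
        (MvPolynomial.X i * y k - MvPolynomial.X k * y i) -
          (MvPolynomial.X i * (y k - m * w k) - MvPolynomial.X k * (y i - m * w i)) := by ring
      rw [e]
      exact I₁.sub_mem (hc i k) (I₁.sub_mem (I₁.mul_mem_left _ (hw k)) (I₁.mul_mem_left _ (hw i))))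
      (fun σ hσ i => by
      rw [← h]
      have e : m * (σ • w i - w (σ i)) = (σ • y i - y (σ i)) -
          (σ • (y i - m * w i) - (y (σ i) - m * w (σ i))) := by
        rw [smul_sub, smul_mul', hm σ hσ]; ring
      rw [e]
      exact I₁.sub_mem (hG σ hσ i) (I₁.sub_mem (hs σ hσ _ (hw i)) (hw _)))
    refine ⟨m * g, Ideal.mul_mem_right _ _ (Ideal.mem_sup_right (Ideal.mem_span_singleton_self m)),
      fun i => ?_⟩
    have e : y i - MvPolynomial.X i * (m * g) =
      (y i - m * w i) + m * (w i - MvPolynomial.X i * g) := by ring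
    rw [e]
    exact I₁.add_mem (hw i) ((h _).2 (hg i))

end Vanishing

/-! ### Monomials that are constant on a set of variables -/

section LastRow

variable {n : ℕ} {Y : YoungDiagram} {S B : Finset (Fin n)} {p : ℕ}

/-- The monomial `∏_{i ∈ B} X_i ^ p`. -/
def blockMonomial (B : Finset (Fin n)) (p : ℕ) : Poly n :=
  MvPolynomial.monomial (expVec B fun _ => p) 1

theorem perm_smul_blockMonomial {w : Equiv.Perm (Fin n)} (hw : ∀ i, w i ∈ B ↔ i ∈ B) :
    w • blockMonomial B p = blockMonomial B p := by
  rw [blockMonomial, perm_smul_monomial]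
  suffices h : (expVec B fun _ => p).mapDomain w = expVec B fun _ => p by rw [h]
  refine DFunLike.ext _ _ fun x => ?_
  obtain ⟨x, rfl⟩ := w.surjective x
  rw [mapDomain_perm_apply, expVec_apply, expVec_apply]
  simp [hw]

theorem blockMonomial_eq_X_pow_mul {j : Fin n} (hj : j ∈ B) :
    blockMonomial B p = MvPolynomial.X j ^ p * blockMonomial (B.erase j) p := by
  rw [blockMonomial, blockMonomial, MvPolynomial.X_pow_eq_monomial, MvPolynomial.monomial_mul,
    one_mul]
  suffices h : (expVec B fun _ => p) = Finsupp.single j p + expVec (B.erase j) fun _ => p by rw [h]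
  refine DFunLike.ext _ _ fun x => ?_
  rw [Finsupp.add_apply, expVec_apply, expVec_apply]
  by_cases hx : x = j
  · subst hx; simp [hj]
  · simp [hx]

theorem swap_mem_iff {k l : Fin n} (hk : k ∈ B) (hl : l ∈ B) (i : Fin n) :
    Equiv.swap k l i ∈ B ↔ i ∈ B := by
  rw [Equiv.swap_apply_def]
  split_ifs with h1 h2
  · subst h1; exact ⟨fun _ => hk, fun _ => hl⟩
  · subst h2; exact ⟨fun _ => hl, fun _ => hk⟩
  · rfl

theorem perm_smul_of_mem_supported {w : Equiv.Perm (Fin n)} (hw : ∀ i ∉ B, w i = i) {f : Poly n}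
    (hf : f ∈ MvPolynomial.supported ℂ ((B : Set (Fin n))ᶜ)) : w • f = f := by
  refine Algebra.adjoin_induction (p := fun f _ => w • f = f) ?_ ?_ ?_ ?_ hf
  · rintro _ ⟨i, hi, rfl⟩; rw [perm_smul_X, hw i hi]
  · intro a; exact MvPolynomial.rename_C _ _
  · intro a b _ _ ha hb; rw [smul_add, ha, hb]
  · intro a b _ _ ha hb; rw [smul_mul', ha, hb]

theorem swap_smul_of_mem_supported {k l : Fin n} (hk : k ∈ B) (hl : l ∈ B) {f : Poly n}
    (hf : f ∈ MvPolynomial.supported ℂ ((B : Set (Fin n))ᶜ)) : Equiv.swap k l • f = f :=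
  perm_smul_of_mem_supported (B := B) (fun _ hi => Equiv.swap_apply_of_ne_of_ne
    (fun h => hi (h ▸ hk)) fun h => hi (h ▸ hl)) hf

/-- Every polynomial is of degree at most one in the variables `X_k`, `k ∈ B`, modulo an ideal that
contains the products of two such variables. -/
theorem exists_linear_part (I : Ideal (Poly n))
    (hI : ∀ k ∈ B, ∀ l ∈ B, (MvPolynomial.X k * MvPolynomial.X l : Poly n) ∈ I) (u : Poly n) :
    ∃ u₀ ∈ MvPolynomial.supported ℂ ((B : Set (Fin n))ᶜ), ∃ u₁ : Fin n → Poly n,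
      (∀ k, u₁ k ∈ MvPolynomial.supported ℂ ((B : Set (Fin n))ᶜ)) ∧
        u - u₀ - ∑ k ∈ B, MvPolynomial.X k * u₁ k ∈ I := by
  induction u using MvPolynomial.induction_on with
  | C a => exact ⟨MvPolynomial.C a, Subalgebra.algebraMap_mem _ a, 0, fun _ => zero_mem _, by simp⟩
  | add f g hf hg =>
    obtain ⟨f₀, hf₀, f₁, hf₁, hf⟩ := hf
    obtain ⟨g₀, hg₀, g₁, hg₁, hg⟩ := hg
    refine ⟨f₀ + g₀, add_mem hf₀ hg₀, f₁ + g₁, fun k => add_mem (hf₁ k) (hg₁ k), ?_⟩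
    have e : f + g - (f₀ + g₀) - ∑ k ∈ B, MvPolynomial.X k * (f₁ + g₁) k =
        (f - f₀ - ∑ k ∈ B, MvPolynomial.X k * f₁ k) +
          (g - g₀ - ∑ k ∈ B, MvPolynomial.X k * g₁ k) := by
      simp only [Pi.add_apply, mul_add, sum_add_distrib]; ring
    rw [e]; exact I.add_mem hf hg
  | mul_X f i hf =>
    obtain ⟨f₀, hf₀, f₁, hf₁, hf⟩ := hf
    by_cases hi : i ∈ B
    · refine ⟨0, zero_mem _, Pi.single i f₀, fun k => ?_, ?_⟩
      · by_cases hk : k = i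
        · subst hk; simpa using hf₀
        · simp [hk]
      · have e : f * MvPolynomial.X i - 0 -
            ∑ k ∈ B, MvPolynomial.X k * (Pi.single i f₀ : Fin n → Poly n) k =
            MvPolynomial.X i * (f - f₀ - ∑ k ∈ B, MvPolynomial.X k * f₁ k) +
              ∑ k ∈ B, f₁ k * (MvPolynomial.X k * MvPolynomial.X i) := by
          rw [sum_eq_single_of_mem i hi fun k _ hk => by simp [hk], Pi.single_eq_same, mul_sub,
            mul_sum]
          have : ∑ k ∈ B, f₁ k * (MvPolynomial.X k * MvPolynomial.X i) =
            ∑ k ∈ B, MvPolynomial.X i * (MvPolynomial.X k * f₁ k) :=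
              sum_congr rfl fun k _ => by ring
          rw [this]; ring
        rw [e]
        exact I.add_mem (I.mul_mem_left _ hf)
          (I.sum_mem fun k hk => I.mul_mem_left _ (hI k hk i hi))
    · have hXi : (MvPolynomial.X i : Poly n) ∈ MvPolynomial.supported ℂ ((B : Set (Fin n))ᶜ) :=
        MvPolynomial.X_mem_supported.2 (by simpa using hi)
      refine ⟨f₀ * MvPolynomial.X i, mul_mem hf₀ hXi, fun k => f₁ k * MvPolynomial.X i,
        fun k => mul_mem (hf₁ k) hXi, ?_⟩
      have e : f * MvPolynomial.X i - f₀ * MvPolynomial.X i -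
          ∑ k ∈ B, MvPolynomial.X k * (f₁ k * MvPolynomial.X i) =
          MvPolynomial.X i * (f - f₀ - ∑ k ∈ B, MvPolynomial.X k * f₁ k) := by
        rw [mul_sub, mul_sub, mul_sum]
        have : ∑ k ∈ B, MvPolynomial.X k * (f₁ k * MvPolynomial.X i) =
          ∑ k ∈ B, MvPolynomial.X i * (MvPolynomial.X k * f₁ k) :=
            sum_congr rfl fun k _ => by ring
        rw [this]; ring
      rw [e]; exact I.mul_mem_left _ hf

theorem eq_zero_of_mem_supported {f : Poly n}
    (hf : f ∈ MvPolynomial.supported ℂ ((B : Set (Fin n))ᶜ)) {e : Fin n →₀ ℕ} (he : e ∈ f.support)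
    {k : Fin n} (hk : k ∈ B) : e k = 0 := by
  by_contra hne
  have h1 : k ∈ f.vars := (MvPolynomial.mem_vars_iff_mem_support k).2 ⟨e, he, Finsupp.mem_support_iff.2 hne⟩
  exact (MvPolynomial.mem_supported.1 hf h1) hk

end LastRow

/-! ### Cocycles in the exceptional case -/

section Exceptional

variable {n : ℕ}

theorem exists_monomial_eq_mul_X {b : Fin n →₀ ℕ} {k : Fin n} (hb : b k ≠ 0) :
    ∃ b', (MvPolynomial.monomial b 1 : Poly n) = MvPolynomial.monomial b' 1 * MvPolynomial.X k := by
  refine ⟨b - Finsupp.single k 1, ?_⟩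
  rw [MvPolynomial.X, MvPolynomial.monomial_mul, one_mul, tsub_add_cancel_of_le]
  rw [Finsupp.single_le_iff]; omega

/-- `Y` has its last two rows in positions `p` and `p + 1`, the last one consists of one cell, and
`B` is as large as these two rows together. -/
structure LastBlock (Y : YoungDiagram) (S B : Finset (Fin n)) (p : ℕ) : Prop where
  subset : B ⊆ S
  card : #S = Y.card
  top : topCount Y p + #B = #S
  top_succ : topCount Y (p + 1) + 1 = #S
  rowLen : Y.rowLen (p + 1) = 1
  colLen : Y.colLen 0 = p + 2

namespace LastBlock

variable {Y : YoungDiagram} {S B : Finset (Fin n)} {p : ℕ} (h : LastBlock Y S B p)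
include h

/-- The rows from `p` on have `#B` cells in total. Once all of `B` lies there, nothing else does. -/
theorem mem_block {u c : Fin n → ℕ} (hT : IsTab Y S u c) (hu : ∀ k ∈ B, p ≤ u k) {l : Fin n}
    (hl : l ∈ S) (hp : p ≤ u l) : l ∈ B := by
  by_contra hlB
  have h1 := hT.card_lt p
  have h2 : #{i ∈ S | u i < p} < #(S \ B) := by
    refine card_lt_card ⟨fun i hi => ?_, fun hc => ?_⟩
    · rw [mem_filter] at hi
      exact mem_sdiff.2 ⟨hi.1, fun hiB => by have := hu i hiB; omega⟩
    · have := (mem_filter.1 (hc (mem_sdiff.2 ⟨hl, hlB⟩))).2; omega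
  rw [card_sdiff_of_subset h.subset, h1] at h2
  have := h.top; omega

theorem exists_cell {u c : Fin n → ℕ} (hT : IsTab Y S u c) {i : ℕ} (hi : i < p + 2) :
    ∃ l ∈ S, u l = i ∧ c l = 0 := by
  have : (i, 0) ∈ Y := by rw [YoungDiagram.mem_iff_lt_colLen, h.colLen]; exact hi
  obtain ⟨l, hl, he⟩ := hT.surjOn this
  exact ⟨l, hl, (Prod.ext_iff.1 he).1, (Prod.ext_iff.1 he).2⟩

/-- Either one exponent reaches `p + 2`, the number of rows, or two exponents exceed `p` while only
one cell lies below row `p`. -/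
theorem mul_X_mul_X_mem {k l : Fin n} (hk : k ∈ B) (hl : l ∈ B) :
    blockMonomial B p * (MvPolynomial.X k * MvPolynomial.X l) ∈ annIdeal Y S := by
  rw [blockMonomial, MvPolynomial.X, MvPolynomial.X, MvPolynomial.monomial_mul,
    MvPolynomial.monomial_mul, one_mul, one_mul]
  by_cases hkl : k = l
  · subst hkl
    refine monomial_mem_annIdeal (k := p + 2) ?_
    rw [topCount_eq_card_of_le Y h.colLen.le, ← h.card]
    refine card_lt_card (filter_ssubset.2 ⟨k, h.subset hk, ?_⟩)
    simp [expVec_apply, hk]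
  · refine monomial_mem_annIdeal (k := p + 1) ?_
    have h1 : {i ∈ S | (expVec B (fun _ => p) +
        (Finsupp.single k 1 + Finsupp.single l 1) : Fin n →₀ ℕ) i < p + 1} ⊆ (S.erase k).erase l := by
      intro i hi
      rw [mem_filter] at hi
      refine mem_erase.2 ⟨?_, mem_erase.2 ⟨?_, hi.1⟩⟩
      · rintro rfl; have := hi.2; simp [expVec_apply, hl] at this
      · rintro rfl; have := hi.2; simp [expVec_apply, hk] at this
    have h2 := card_le_card h1
    rw [card_erase_of_mem (mem_erase.2 ⟨Ne.symm hkl, h.subset hl⟩),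
      card_erase_of_mem (h.subset hk)] at h2
    have h3 : 1 < #S := one_lt_card.2 ⟨k, h.subset hk, l, h.subset hl, hkl⟩
    have := h.top_succ
    omega

/-- In a surviving term X_k puts `k` into the single cell of the last row, and some `l` in `B`
occupies the cell above it. The transposition of `k` and `l` lies in the column group and fixes the
whole symmetric product. -/
theorem mul_sum_X_mem : blockMonomial B p * ∑ k ∈ B, MvPolynomial.X k ∈ annIdeal Y S := by
  refine mem_annIdeal_of_monomial fun r c hT b => ?_
  by_cases hb : ∃ k ∈ B, b k ≠ 0
  · obtain ⟨k, hk, hbk⟩ := hb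
    obtain ⟨b', hb'⟩ := exists_monomial_eq_mul_X hbk
    have : (blockMonomial B p * ∑ l ∈ B, MvPolynomial.X k * MvPolynomial.X l : Poly n) ∈
        annIdeal Y S := by
      rw [mul_sum]; exact sum_mem fun l hl => h.mul_X_mul_X_mem hk hl
    rw [← this r c hT (MvPolynomial.monomial b' 1), hb', ← mul_sum]
    congr 1; ring
  · push Not at hb
    by_contra hne
    have e1 : MvPolynomial.monomial b 1 * (blockMonomial B p * ∑ k ∈ B, MvPolynomial.X k) =
        ∑ k ∈ B, MvPolynomial.monomial (b + ((expVec B fun _ => p) + Finsupp.single k 1)) (1 : ℂ) := by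
      rw [mul_sum, mul_sum]
      refine sum_congr rfl fun k _ => ?_
      rw [blockMonomial, MvPolynomial.X, MvPolynomial.monomial_mul, MvPolynomial.monomial_mul,
        one_mul, one_mul]
    have hne' := hne
    rw [e1, map_sum] at hne'
    obtain ⟨k, hk, hk'⟩ := exists_ne_zero_of_sum_ne_zero hne'
    obtain ⟨hu, -⟩ := isTab_of_phi_ne_zero hT hk'
    have huB : ∀ l ∈ B, p ≤ (b + ((expVec B fun _ => p) + Finsupp.single k 1) : Fin n →₀ ℕ) l := by
      intro l hl; simp only [Finsupp.add_apply, expVec_apply, if_pos hl]; omega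
    obtain ⟨l, hlS, hul, hcl⟩ := h.exists_cell hu (i := p) (by omega)
    have hlB := h.mem_block hu huB hlS hul.ge
    have huk : (b + ((expVec B fun _ => p) + Finsupp.single k 1) : Fin n →₀ ℕ) k = p + 1 := by
      simp [expVec_apply, hk, hb k hk]
    have hkl : k ≠ l := by rintro rfl; omega
    have hck : c k = 0 := by
      have := hu.mem (h.subset hk)
      rw [huk, YoungDiagram.mem_iff_lt_rowLen, h.rowLen] at this; omega
    refine hne (phi_eq_zero_of_swap (h.subset hk) hlS hkl (by omega) ?_)
    rw [smul_mul', smul_mul', swap_smul_monomial (by rw [hb k hk, hb l hlB]),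
      perm_smul_blockMonomial (swap_mem_iff hk hlB), smul_sum]
    congr 2
    refine sum_bij' (fun i _ => Equiv.swap k l i) (fun i _ => Equiv.swap k l i) ?_ ?_ ?_ ?_ ?_
    · intro i hi; exact (swap_mem_iff hk hlB i).2 hi
    · intro i hi; exact (swap_mem_iff hk hlB i).2 hi
    · intro i _; simp
    · intro i _; simp
    · intro i _; rw [perm_smul_X]

theorem swap_smul_mem {k l : Fin n} (hk : k ∈ B) (hl : l ∈ B) {f : Poly n}
    (hf : f ∈ annIdeal Y S) : Equiv.swap k l • f ∈ annIdeal Y S :=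
  perm_smul_mem_annIdeal (swap_mem_iff (h.subset hk) (h.subset hl)) hf

/-- Transpositions turn the hypothesis for `j` into the one for every `k` in `B`, which handles test
monomials divisible by a block variable. For the others all exponents on `B` equal `p`, and the cell
in row `p + 1` stays empty. -/
theorem mul_mem_of_mul_X {w : Poly n} (hw : w ∈ MvPolynomial.supported ℂ ((B : Set (Fin n))ᶜ))
    {j : Fin n} (hj : j ∈ B) (hm : blockMonomial B p * (MvPolynomial.X j * w) ∈ annIdeal Y S) :
    blockMonomial B p * w ∈ annIdeal Y S := by
  refine mem_annIdeal_of_monomial fun r c hT b => ?_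
  by_cases hb : ∃ k ∈ B, b k ≠ 0
  · obtain ⟨k, hk, hbk⟩ := hb
    obtain ⟨b', hb'⟩ := exists_monomial_eq_mul_X hbk
    have := h.swap_smul_mem hj hk hm
    rw [smul_mul', smul_mul', perm_smul_blockMonomial (swap_mem_iff hj hk), perm_smul_X,
      Equiv.swap_apply_left, swap_smul_of_mem_supported hj hk hw] at this
    rw [← this r c hT (MvPolynomial.monomial b' 1), hb']
    congr 1; ring
  · push Not at hb
    rw [w.as_sum, mul_sum, mul_sum, map_sum]
    refine sum_eq_zero fun e he => ?_
    rw [blockMonomial, MvPolynomial.monomial_mul, MvPolynomial.monomial_mul, one_mul, one_mul]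
    by_contra hne
    obtain ⟨hu, -⟩ := isTab_of_phi_ne_zero hT hne
    have huB : ∀ l ∈ B, (b + ((expVec B fun _ => p) + e) : Fin n →₀ ℕ) l = p := by
      intro l hl; simp [expVec_apply, hl, hb l hl, eq_zero_of_mem_supported hw he hl]
    obtain ⟨l, hlS, hul, -⟩ := h.exists_cell hu (i := p + 1) (by omega)
    have hlB := h.mem_block hu (fun k hk => (huB k hk).ge) hlS (by omega)
    have := huB l hlB
    omega

/-- Transpositions give f (X_k - X_m) w = 0 in the quotient for all `m` in `B`. In the sum over `m`,
f ∑ X_m = 0 leaves #B f X_k w = 0, and `mul_mem_of_mul_X` removes X_k. -/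
theorem mul_mem_of_mul_sub {w : Poly n} (hw : w ∈ MvPolynomial.supported ℂ ((B : Set (Fin n))ᶜ))
    {k l : Fin n} (hk : k ∈ B) (hl : l ∈ B) (hkl : k ≠ l)
    (hm : blockMonomial B p * ((MvPolynomial.X k - MvPolynomial.X l) * w) ∈ annIdeal Y S) :
    blockMonomial B p * w ∈ annIdeal Y S := by
  have h1 : ∀ m ∈ B,
      blockMonomial B p * ((MvPolynomial.X k - MvPolynomial.X m) * w) ∈ annIdeal Y S := by
    intro m hmB
    by_cases hmk : m = k
    · subst hmk; simp
    · have := h.swap_smul_mem hl hmB hm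
      rwa [smul_mul', smul_mul', smul_sub, perm_smul_blockMonomial (swap_mem_iff hl hmB),
        perm_smul_X, perm_smul_X, Equiv.swap_apply_left,
        Equiv.swap_apply_of_ne_of_ne hkl (Ne.symm hmk), swap_smul_of_mem_supported hl hmB hw] at this
  have h2 := sum_mem h1
  have e : ∑ m ∈ B, blockMonomial B p * ((MvPolynomial.X k - MvPolynomial.X m) * w) =
      MvPolynomial.C (#B : ℂ) * (blockMonomial B p * (MvPolynomial.X k * w)) -
        w * (blockMonomial B p * ∑ m ∈ B, MvPolynomial.X m) := by
    rw [← mul_sum, ← sum_mul, sum_sub_distrib, sum_const, nsmul_eq_mul, map_natCast]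
    ring
  rw [e] at h2
  have h3 := add_mem h2 (Ideal.mul_mem_left _ w h.mul_sum_X_mem)
  rw [sub_add_cancel] at h3
  have hB0 : (#B : ℂ) ≠ 0 := Nat.cast_ne_zero.2 (card_pos.2 ⟨k, hk⟩).ne'
  have h4 := Ideal.mul_mem_left _ (MvPolynomial.C (#B : ℂ)⁻¹) h3
  rw [← mul_assoc, ← MvPolynomial.C_mul, inv_mul_cancel₀ hB0, MvPolynomial.C_1, one_mul] at h4
  exact h.mul_mem_of_mul_X hw hk h4

/-- The coefficients of the linear part of a polynomial that is invariant under transpositions. -/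
theorem mul_sub_mem_of_swap {u u₀ : Poly n} {u₁ : Fin n → Poly n}
    (hu₀ : u₀ ∈ MvPolynomial.supported ℂ ((B : Set (Fin n))ᶜ))
    (hu₁ : ∀ k, u₁ k ∈ MvPolynomial.supported ℂ ((B : Set (Fin n))ᶜ))
    (hu : blockMonomial B p * (u - u₀ - ∑ k ∈ B, MvPolynomial.X k * u₁ k) ∈ annIdeal Y S)
    {k l : Fin n} (hk : k ∈ B) (hl : l ∈ B)
    (hs : blockMonomial B p * (Equiv.swap k l • u - u) ∈ annIdeal Y S) :
    blockMonomial B p * (u₁ k - u₁ l) ∈ annIdeal Y S := by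
  by_cases hkl : k = l
  · subst hkl; simp
  refine h.mul_mem_of_mul_sub (sub_mem (hu₁ k) (hu₁ l)) hk hl hkl ?_
  have h1 := h.swap_smul_mem hk hl hu
  rw [smul_mul', smul_sub, smul_sub, perm_smul_blockMonomial (swap_mem_iff hk hl),
    swap_smul_of_mem_supported hk hl hu₀, smul_sum] at h1
  have e : ∑ m ∈ B, Equiv.swap k l • (MvPolynomial.X m * u₁ m) - ∑ m ∈ B, MvPolynomial.X m * u₁ m =
      -((MvPolynomial.X k - MvPolynomial.X l) * (u₁ k - u₁ l)) := by
    rw [← sum_sub_distrib, sum_eq_add_of_mem k l hk hl hkl]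
    · rw [smul_mul', smul_mul', perm_smul_X, perm_smul_X, Equiv.swap_apply_left,
        Equiv.swap_apply_right, swap_smul_of_mem_supported hk hl (hu₁ k),
        swap_smul_of_mem_supported hk hl (hu₁ l)]
      ring
    · rintro m - ⟨hmk, hml⟩
      rw [smul_mul', perm_smul_X, Equiv.swap_apply_of_ne_of_ne hmk hml,
        swap_smul_of_mem_supported hk hl (hu₁ m), sub_self]
  have h2 := sub_mem (sub_mem h1 hu) hs
  have e2 : ∀ a b c d : Poly n,
    blockMonomial B p * (a - u₀ - c) - blockMonomial B p * (b - u₀ - d) -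
      blockMonomial B p * (a - b) = blockMonomial B p * (-(c - d)) := fun a b c d => by ring
  rw [e2, e, neg_neg] at h2
  exact h2

/-- Write y_i = f u_i, where u_i matters only up to its part linear in the block variables.
Equivariance reduces these linear parts to one polynomial `Q`, the cocycle condition removes the
constant term on the block, and f Q is the primitive. -/
theorem exists_primitive (hB : 1 < #B) {G : Subgroup (Equiv.Perm (Fin n))}
    (hG : ∀ k ∈ B, ∀ l ∈ B, Equiv.swap k l ∈ G) {y : Fin n → Poly n}
    (hy : ∀ i, y i ∈ annIdeal Y S ⊔ Ideal.span {blockMonomial B p})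
    (hc : ∀ i k, MvPolynomial.X i * y k - MvPolynomial.X k * y i ∈ annIdeal Y S)
    (he : ∀ σ ∈ G, ∀ i, σ • y i - y (σ i) ∈ annIdeal Y S) :
    ∃ g, ∀ i, y i - MvPolynomial.X i * g ∈ annIdeal Y S := by
  set J := annIdeal Y S with hJ
  set f := blockMonomial B p with hf
  have key : ∀ i, ∃ u, y i - f * u ∈ J := by
    intro i
    obtain ⟨a, ha, v, hv, hav⟩ := Submodule.mem_sup.1 (hy i)
    obtain ⟨w, rfl⟩ := Ideal.mem_span_singleton'.1 hv
    exact ⟨w, by rwa [← hav, mul_comm f, add_sub_cancel_right]⟩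
  choose u hu using key
  have key2 : ∀ i, ∃ u₀ ∈ MvPolynomial.supported ℂ ((B : Set (Fin n))ᶜ), ∃ u₁ : Fin n → Poly n,
      (∀ k, u₁ k ∈ MvPolynomial.supported ℂ ((B : Set (Fin n))ᶜ)) ∧
        f * (u i - u₀ - ∑ k ∈ B, MvPolynomial.X k * u₁ k) ∈ J := fun i =>
    exists_linear_part (Submodule.comap (LinearMap.mulLeft (Poly n) f) J)
      (fun k hk l hl => h.mul_X_mul_X_mem hk hl) (u i)
  choose u₀ hu₀ u₁ hu₁ huu using key2
  have hswap : ∀ k ∈ B, ∀ l ∈ B, Equiv.swap k l • f = f := fun k hk l hl =>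
    perm_smul_blockMonomial (swap_mem_iff hk hl)
  have hsu : ∀ i, ∀ k ∈ B, ∀ l ∈ B, i ≠ k → i ≠ l → f * (u₁ i k - u₁ i l) ∈ J := by
    intro i k hk l hl hik hil
    refine h.mul_sub_mem_of_swap (hu₀ i) (hu₁ i) (huu i) hk hl ?_
    have h1 := he _ (hG k hk l hl) i
    rw [Equiv.swap_apply_of_ne_of_ne hik hil] at h1
    have h2 := h.swap_smul_mem hk hl (hu i)
    rw [smul_sub, smul_mul', hswap k hk l hl] at h2
    have h3 := sub_mem h1 (sub_mem h2 (hu i))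
    rw [show Equiv.swap k l • y i - y i - (Equiv.swap k l • y i - f * Equiv.swap k l • u i -
      (y i - f * u i)) = f * (Equiv.swap k l • u i - u i) by ring] at h3
    exact h3
  -- All coefficients of the linear part agree after multiplication by f, so that part is a multiple
  -- of f ∑ X_k and vanishes.
  have hout : ∀ i ∉ B, y i - f * u₀ i ∈ J := by
    intro i hi
    obtain ⟨k, hk⟩ : B.Nonempty := card_pos.1 (by omega)
    have hne : ∀ m ∈ B, i ≠ m := fun m hm hh => hi (hh ▸ hm)
    have h1 : ∑ m ∈ B, MvPolynomial.X m * (f * (u₁ i m - u₁ i k)) ∈ J :=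
      sum_mem fun m hm => J.mul_mem_left _ (hsu i m hm k hk (hne m hm) (hne k hk))
    have h2 := add_mem (add_mem (add_mem (hu i) (huu i)) h1)
      (J.mul_mem_left (u₁ i k) h.mul_sum_X_mem)
    have e : ∑ m ∈ B, MvPolynomial.X m * (f * (u₁ i m - u₁ i k)) =
        f * ∑ m ∈ B, MvPolynomial.X m * u₁ i m - u₁ i k * (f * ∑ m ∈ B, MvPolynomial.X m) := by
      simp only [mul_sum, ← sum_sub_distrib]
      exact sum_congr rfl fun m _ => by ring
    rw [e, ← hf] at h2
    convert h2 using 1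
    ring
  obtain ⟨j, hj, k, hk, hjk⟩ := one_lt_card.1 hB
  set P := u₀ j with hP
  set Q := u₁ j j - u₁ j k with hQ
  have hPs : P ∈ MvPolynomial.supported ℂ ((B : Set (Fin n))ᶜ) := hu₀ j
  have hQs : Q ∈ MvPolynomial.supported ℂ ((B : Set (Fin n))ᶜ) := sub_mem (hu₁ j j) (hu₁ j k)
  -- Only the coefficients other than that of X_j need agree. Subtracting their common value times f
  -- ∑ X_m leaves the single linear term X_j Q.
  have hyj : y j - f * (P + MvPolynomial.X j * Q) ∈ J := by
    have h1 : ∑ m ∈ B.erase j, MvPolynomial.X m * (f * (u₁ j m - u₁ j k)) ∈ J :=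
      sum_mem fun m hm => J.mul_mem_left _ (hsu j m (mem_of_mem_erase hm) k hk
        (ne_of_mem_erase hm).symm hjk)
    have h2 := add_mem (add_mem (add_mem (hu j) (huu j)) h1)
      (J.mul_mem_left (u₁ j k) h.mul_sum_X_mem)
    have e : ∑ m ∈ B.erase j, MvPolynomial.X m * (f * (u₁ j m - u₁ j k)) =
        f * ∑ m ∈ B.erase j, MvPolynomial.X m * u₁ j m -
          u₁ j k * (f * ∑ m ∈ B.erase j, MvPolynomial.X m) := by
      simp only [mul_sum, ← sum_sub_distrib]
      exact sum_congr rfl fun m _ => by ring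
    rw [e, ← hf, ← add_sum_erase B _ hj, ← add_sum_erase B (fun m => (MvPolynomial.X m : Poly n)) hj]
      at h2
    convert h2 using 1
    rw [hP, hQ]
    ring
  have hyB : ∀ m ∈ B, y m - f * (P + MvPolynomial.X m * Q) ∈ J := by
    intro m hm
    have h1 := h.swap_smul_mem hj hm hyj
    have h2 := he _ (hG j hj m hm) j
    rw [Equiv.swap_apply_left] at h2
    rw [smul_sub, smul_mul', smul_add, smul_mul', hswap j hj m hm, perm_smul_X,
      Equiv.swap_apply_left, swap_smul_of_mem_supported hj hm hPs,
      swap_smul_of_mem_supported hj hm hQs] at h1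
    convert sub_mem h1 h2 using 1
    ring
  -- The X_j X_k Q terms of X_j y_k - X_k y_j cancel, and f (X_j - X_k) P remains.
  have hfP : f * P ∈ J := by
    refine h.mul_mem_of_mul_sub hPs hj hk hjk ?_
    have h1 := hc j k
    have h2 := J.mul_mem_left (MvPolynomial.X j) (hyB k hk)
    have h3 := J.mul_mem_left (MvPolynomial.X k) (hyB j hj)
    convert add_mem (sub_mem h1 h2) h3 using 1
    ring
  refine ⟨f * Q, fun i => ?_⟩
  by_cases hi : i ∈ B
  · convert add_mem (hyB i hi) hfP using 1
    ring
  · have hXi : (MvPolynomial.X i : Poly n) ∈ MvPolynomial.supported ℂ ((B : Set (Fin n))ᶜ) :=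
      MvPolynomial.X_mem_supported.2 (by simpa using hi)
    have h1 : f * (MvPolynomial.X i * Q - u₀ i) ∈ J := by
      refine h.mul_mem_of_mul_X (sub_mem (mul_mem hXi hQs) (hu₀ i)) hj ?_
      have h2 := hc i j
      have h3 := J.mul_mem_left (MvPolynomial.X i) (hyB j hj)
      have h4 := J.mul_mem_left (MvPolynomial.X j) (hout i hi)
      have h5 := J.mul_mem_left (MvPolynomial.X i) hfP
      convert sub_mem (add_mem (sub_mem h2 h3) h4) h5 using 1
      ring
    convert sub_mem (hout i hi) h1 using 1
    ring

end LastBlock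

end Exceptional

/-! ### The vanishing theorem -/

section Main

variable {n : ℕ}

/-- The number of elements of `S` with label less than `k`. -/
def labelCount (S : Finset (Fin n)) (ρ : Fin n → ℕ) (k : ℕ) : ℕ := #{i ∈ S | ρ i < k}

/-- The sizes of the label classes form a partition. -/
def AntitoneLabels (S : Finset (Fin n)) (ρ : Fin n → ℕ) : Prop :=
  ∀ i j, i ≤ j → #{x ∈ S | ρ x = j} ≤ #{x ∈ S | ρ x = i}

variable {Y : YoungDiagram} {S : Finset (Fin n)} {ρ : Fin n → ℕ} {p : ℕ} {j : Fin n}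

theorem labelCount_succ (S : Finset (Fin n)) (ρ : Fin n → ℕ) (k : ℕ) :
    labelCount S ρ (k + 1) = labelCount S ρ k + #{i ∈ S | ρ i = k} := by
  rw [labelCount, labelCount, ← card_union_of_disjoint, ← filter_or]
  · congr 1; ext i; simp only [mem_filter]; refine and_congr_right fun _ => ?_; omega
  · refine disjoint_filter.2 fun i _ h => ?_; omega

theorem labelCount_le_card (S : Finset (Fin n)) (ρ : Fin n → ℕ) (k : ℕ) :
    labelCount S ρ k ≤ #S := card_filter_le _ _

theorem labelCount_eq_card (hρ : ∀ i ∈ S, ρ i ≤ p) {k : ℕ} (hk : p < k) :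
    labelCount S ρ k = #S := by
  rw [labelCount, filter_true_of_mem fun i hi => (hρ i hi).trans_lt hk]

theorem labelCount_erase (hj : j ∈ S) (k : ℕ) :
    labelCount (S.erase j) ρ k + (if ρ j < k then 1 else 0) = labelCount S ρ k := by
  rw [labelCount, labelCount, filter_erase]
  split_ifs with h
  · exact card_erase_add_one (mem_filter.2 ⟨hj, h⟩)
  · rw [erase_eq_of_notMem (by simp [h]), add_zero]

theorem AntitoneLabels.erase (h : AntitoneLabels S ρ) (hmax : ∀ i ∈ S, ρ i ≤ ρ j) :
    AntitoneLabels (S.erase j) ρ := by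
  intro a b hab
  rw [filter_erase, filter_erase]
  by_cases ha : ρ j = a
  · by_cases hb : b = a
    · rw [hb]
    · have : {x ∈ S | ρ x = b} = ∅ := filter_eq_empty_iff.2 fun x hx hxb => by
        have := hmax x hx; omega
      rw [this]; simp
  · rw [erase_eq_of_notMem (s := {x ∈ S | ρ x = a}) (by simp [ha])]
    exact (card_le_card (erase_subset _ _)).trans (h a b hab)

/-- Removing `j` lowers the label counts only at thresholds above its label, and removing the corner
lowers the diagram counts only above the corner's row. The alternatives in `h` are those in which a
strict inequality remains or arises. -/
theorem exists_lt_labelCount_shrink (hS : #S = Y.card) (hj : j ∈ S)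
    (hmax : ∀ i ∈ S, ρ i ≤ ρ j) (hle : ∀ k, topCount Y k ≤ labelCount S ρ k) {i : ℕ}
    (hi : 0 < Y.rowLen i)
    (h : (cornerAt Y i).1 < ρ j ∨ (∃ k ≤ ρ j, topCount Y k < labelCount S ρ k) ∨
      ((cornerAt Y i).1 ≤ ρ j ∧ topCount Y (ρ j + 1) < #S) ∨ topCount Y (ρ j + 1) + 1 < #S) :
    ∃ k, topCount (shrink Y i hi) k < labelCount (S.erase j) ρ k := by
  have key : ∀ k, topCount (shrink Y i hi) k + (if (cornerAt Y i).1 < k then 1 else 0) =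
      topCount Y k := topCount_shrink hi
  have key2 : ∀ k, labelCount (S.erase j) ρ k + (if ρ j < k then 1 else 0) = labelCount S ρ k :=
    labelCount_erase hj
  rcases h with h | ⟨k, hk, hlt⟩ | ⟨h, hlt⟩ | h
  · refine ⟨ρ j, ?_⟩
    have h1 := key (ρ j); have h2 := key2 (ρ j); have h3 := hle (ρ j)
    rw [if_pos h] at h1; rw [if_neg (lt_irrefl _)] at h2
    omega
  · refine ⟨k, ?_⟩
    have h1 := key k; have h2 := key2 k
    rw [if_neg (by omega)] at h2
    omega
  · refine ⟨ρ j + 1, ?_⟩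
    have h1 := key (ρ j + 1); have h2 := key2 (ρ j + 1)
    rw [if_pos (by omega)] at h1 h2
    rw [labelCount_eq_card hmax (Nat.lt_succ_self _)] at h2
    omega
  · refine ⟨ρ j + 1, ?_⟩
    have h1 := key (ρ j + 1); have h2 := key2 (ρ j + 1)
    rw [if_pos (by omega)] at h2
    rw [labelCount_eq_card hmax (Nat.lt_succ_self _)] at h2
    omega

theorem topCount_shrink_le (hS : #S = Y.card) (hj : j ∈ S) (hmax : ∀ i ∈ S, ρ i ≤ ρ j)
    (hle : ∀ k, topCount Y k ≤ labelCount S ρ k) {i : ℕ} (hi : 0 < Y.rowLen i) (k : ℕ) :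
    topCount (shrink Y i hi) k ≤ labelCount (S.erase j) ρ k := by
  have h1 := topCount_shrink hi k
  have h2 := labelCount_erase (ρ := ρ) hj k
  have h3 := hle k
  by_cases hk : ρ j < k
  · rw [if_pos hk, labelCount_eq_card hmax hk] at h2
    have := topCount_le_card (shrink Y i hi) k
    have := card_shrink hi
    omega
  · rw [if_neg hk] at h2
    omega

/-- Strictness prevents `(ρ, c)` from being injective for any column labelling `c` of `Y`, so some
transposition preserves both label and column. By invariance and antisymmetry φ(y) = -φ(y).
Nonconstant multiples of `y` are killed by the socle hypothesis. -/
theorem vanish_h0 (hlt : ∃ k, topCount Y k < labelCount S ρ k) {y : Poly n}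
    (hG : ∀ σ ∈ labelGroup S ρ, σ • y - y ∈ annIdeal Y S)
    (hX : ∀ i, MvPolynomial.X i * y ∈ annIdeal Y S) : y ∈ annIdeal Y S := by
  refine mem_annIdeal_of_monomial fun r c hT b => ?_
  by_cases hb : b = 0
  · subst hb
    obtain ⟨k, hk⟩ := hlt
    have hni : ¬ Set.InjOn (fun i => (ρ i, c i)) (S : Set (Fin n)) := fun hinj => by
      have := card_lt_le_topCount (Y := Y) hinj (fun m => (hT.card_col m).le) k
      exact absurd hk (not_lt.2 this)
    simp only [Set.InjOn, not_forall] at hni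
    obtain ⟨i, hi, l, hl, hil, hne⟩ := hni
    have h1 := hG _ (swap_mem_labelGroup hi hl (Prod.ext_iff.1 hil).1) r c hT 1
    rw [one_mul, map_sub, phi_perm_smul (swap_mem_labelGroup hi hl (Prod.ext_iff.1 hil).2),
      Equiv.Perm.sign_swap hne] at h1
    push_cast at h1
    change phi S r c (1 * y) = 0
    rw [one_mul]
    linear_combination -h1 / 2
  · obtain ⟨i, hi⟩ := Finsupp.ne_iff.1 hb
    obtain ⟨b', hb'⟩ := exists_monomial_eq_mul_X hi
    rw [hb', mul_assoc]
    exact hX i r c hT _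

theorem smul_X_of_erase {σ : Equiv.Perm (Fin n)} (hσ : σ ∈ labelGroup (S.erase j) ρ) :
    σ • (MvPolynomial.X j : Poly n) = MvPolynomial.X j := by
  rw [perm_smul_X, hσ.1 j (notMem_erase j S)]

theorem stable_top (G : Subgroup (Equiv.Perm (Fin n))) : Stable G ⊤ := fun _ _ _ _ => trivial

theorem stable_sup_X_pow (Y : YoungDiagram) (S : Finset (Fin n)) (ρ : Fin n → ℕ) (j : Fin n)
    (m : ℕ) : Stable (labelGroup (S.erase j) ρ)
      (annIdeal Y S ⊔ Ideal.span {(MvPolynomial.X j ^ m : Poly n)}) :=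
  ((stable_annIdeal Y S ρ).mono (labelGroup_mono (erase_subset _ _) ρ)).sup
    (stable_span_singleton fun σ hσ => by rw [smul_pow', smul_X_of_erase hσ])

theorem sup_sup_span_eq {I : Ideal (Poly n)} {a b : Poly n} (h : b ∣ a) :
    I ⊔ Ideal.span {a} ⊔ Ideal.span {b} = I ⊔ Ideal.span {b} := by
  rw [sup_assoc, sup_eq_right.2 ((Ideal.span_singleton_le_span_singleton).2 h)]

theorem sup_span_le {I : Ideal (Poly n)} {a b : Poly n} (h : b ∣ a) :
    I ⊔ Ideal.span {a} ≤ I ⊔ Ideal.span {b} :=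
  sup_le_sup_left ((Ideal.span_singleton_le_span_singleton).2 h) _

/-- The filtration of `ℂ[X] / annIdeal Y S` by the powers of one variable. -/
theorem vanish_sup_X_pow (hS : #S = Y.card) (hj : j ∈ S) (m : ℕ) (hm : m ≤ Y.colLen 0)
    (h : ∀ i < m, ∀ hi : 0 < Y.rowLen i, Vanish (annIdeal (shrink Y i hi) (S.erase j)) ⊤
      (labelGroup (S.erase j) ρ)) :
    Vanish (annIdeal Y S ⊔ Ideal.span {(MvPolynomial.X j ^ m : Poly n)}) ⊤
      (labelGroup (S.erase j) ρ) := by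
  induction m with
  | zero =>
    rw [pow_zero, Ideal.span_singleton_one, sup_top_eq]
    exact vanish_self _
  | succ m ih =>
    have h1 := ih (by omega) fun i hi => h i (by omega)
    have hrow : 0 < Y.rowLen m := (rowLen_pos_iff Y m).2 (by omega)
    have h2 := (h m (by omega) hrow).of_colon (m := MvPolynomial.X j ^ m)
      (fun σ hσ => by rw [smul_pow', smul_X_of_erase hσ]) (stable_sup_X_pow Y S ρ j (m + 1))
      fun w => X_pow_mul_mem_iff hrow hS hj
    rw [sup_sup_span_eq (pow_dvd_pow _ (Nat.le_succ m))] at h2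
    exact h2.trans h1 (sup_span_le (pow_dvd_pow _ (Nat.le_succ m))) le_top
      (stable_sup_X_pow Y S ρ j m) (stable_top _)

theorem X_pow_mul_mem_sup_iff {i : ℕ} (hi : 0 < Y.rowLen i) (hS : #S = Y.card) (hj : j ∈ S)
    (g w : Poly n) :
    MvPolynomial.X j ^ i * w ∈ annIdeal Y S ⊔ Ideal.span {MvPolynomial.X j ^ (i + 1)} ⊔
        Ideal.span {MvPolynomial.X j ^ i * g} ↔
      w ∈ annIdeal (shrink Y i hi) (S.erase j) ⊔ Ideal.span {g} := by
  constructor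
  · intro h
    obtain ⟨u, hu, v, hv, huv⟩ := Submodule.mem_sup.1 h
    obtain ⟨a, rfl⟩ := Ideal.mem_span_singleton'.1 hv
    have h1 : MvPolynomial.X j ^ i * (w - a * g) ∈
        annIdeal Y S ⊔ Ideal.span {MvPolynomial.X j ^ (i + 1)} := by
      convert hu using 1
      linear_combination -huv
    rw [X_pow_mul_mem_iff hi hS hj] at h1
    have := add_mem
      (Ideal.mem_sup_left h1 : _ ∈ annIdeal (shrink Y i hi) (S.erase j) ⊔ Ideal.span {g})
      (Ideal.mem_sup_right (Ideal.mul_mem_left _ a (Ideal.mem_span_singleton_self g)))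
    rwa [sub_add_cancel] at this
  · intro h
    obtain ⟨u, hu, v, hv, rfl⟩ := Submodule.mem_sup.1 h
    obtain ⟨a, rfl⟩ := Ideal.mem_span_singleton'.1 hv
    rw [mul_add]
    refine add_mem (Ideal.mem_sup_left ((X_pow_mul_mem_iff hi hS hj).2 hu))
      (Ideal.mem_sup_right (Ideal.mem_span_singleton'.2 ⟨a, by ring⟩))

theorem sup_X_pow_eq (hS : #S = Y.card) (hj : j ∈ S) {m : ℕ} (hm : Y.colLen 0 ≤ m) :
    annIdeal Y S ⊔ Ideal.span {(MvPolynomial.X j ^ m : Poly n)} = annIdeal Y S :=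
  sup_eq_left.2 ((Ideal.span_singleton_le_iff_mem _).2 (X_pow_mem_annIdeal hS hj hm))

variable (n) in
/-- The vanishing theorem for sets with `s` elements. -/
def VanishFor (s : ℕ) : Prop :=
  ∀ (Y : YoungDiagram) (S : Finset (Fin n)) (ρ : Fin n → ℕ), #S = s → #S = Y.card →
    AntitoneLabels S ρ → (∀ k, topCount Y k ≤ labelCount S ρ k) →
    (∃ k, topCount Y k < labelCount S ρ k) → Vanish (annIdeal Y S) ⊤ (labelGroup S ρ)

theorem perm_smul_blockMonomial_label {q : ℕ} {σ : Equiv.Perm (Fin n)} (hσ : σ ∈ labelGroup S ρ) :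
    σ • blockMonomial {i ∈ S | ρ i = q} q = blockMonomial {i ∈ S | ρ i = q} q :=
  perm_smul_blockMonomial fun i => by
    rw [mem_filter, mem_filter, labelGroup_apply_mem hσ, hσ.2]

theorem filter_erase_eq {q : ℕ} :
    {i ∈ S.erase j | ρ i = q} = ({i ∈ S | ρ i = q} : Finset (Fin n)).erase j := filter_erase _ _ _

/-- Vanishing modulo the monomial of the last row. -/
theorem vanish_lastRow {N : ℕ} (ih : ∀ s < N, VanishFor n s) (a : ℕ) :
    ∀ (Y : YoungDiagram) (S : Finset (Fin n)) (ρ : Fin n → ℕ), #{i ∈ S | ρ i = p} = a → #S ≤ N →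
      #S = Y.card → AntitoneLabels S ρ → (∀ i ∈ S, ρ i ≤ p) →
      (∀ k, topCount Y k = labelCount S ρ k) → (0 < p → Y.rowLen p < Y.rowLen (p - 1)) →
      Vanish (annIdeal Y S ⊔ Ideal.span {blockMonomial {i ∈ S | ρ i = p} p}) ⊤
        (labelGroup S ρ) := by
  induction a with
  | zero =>
    intro Y S ρ hB _ _ _ _ _ _
    have : blockMonomial {i ∈ S | ρ i = p} p = 1 := by
      rw [card_eq_zero.1 hB, blockMonomial]
      have : expVec (∅ : Finset (Fin n)) (fun _ => p) = 0 := by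
        ext i; simp [expVec_apply]
      rw [this]; rfl
    rw [this, Ideal.span_singleton_one, sup_top_eq]
    exact vanish_self _
  | succ a iha =>
    intro Y S ρ hB hN hS hanti hρ heq hlast
    obtain ⟨j, hjB⟩ : ({i ∈ S | ρ i = p} : Finset (Fin n)).Nonempty := card_pos.1 (by omega)
    obtain ⟨hj, hjp⟩ := mem_filter.1 hjB
    subst hjp
    have hcard : #(S.erase j) + 1 = #S := card_erase_add_one hj
    have hcol : Y.colLen 0 ≤ ρ j + 1 := by
      by_contra hc
      have h1 := topCount_lt_card_of_lt Y (k := ρ j + 1) (by omega)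
      rw [heq, labelCount_eq_card hρ (Nat.lt_succ_self _)] at h1
      omega
    have hrow : Y.rowLen (ρ j) = a + 1 := by
      have h1 := topCount_succ Y (ρ j)
      rw [heq, heq, labelCount_succ, hB] at h1
      omega
    have hrow0 : 0 < Y.rowLen (ρ j) := by omega
    have hcol' : Y.colLen 0 = ρ j + 1 := by
      have := (rowLen_pos_iff Y (ρ j)).1 hrow0; omega
    have hcorner : (cornerAt Y (ρ j)).1 = ρ j := by
      have h1 := le_cornerAt hrow0
      have h2 : (cornerAt Y (ρ j)).1 < Y.colLen 0 := by
        rw [← rowLen_pos_iff, rowLen_cornerAt hrow0]; exact hrow0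
      omega
    refine Vanish.mono ?_ (labelGroup_mono (erase_subset j S) ρ)
    -- For `i < ρ j` the corner lies strictly above the last row because the last row is strictly
    -- shorter than the one before. Its removal makes the dominance strict, and induction applies.
    have hchain := vanish_sup_X_pow (ρ := ρ) hS hj (ρ j) (by omega) fun i hi hi0 => by
      refine ih _ (by omega) _ _ _ rfl ?_ (hanti.erase hρ)
        (topCount_shrink_le hS hj hρ (fun k => (heq k).le) hi0)
        (exists_lt_labelCount_shrink hS hj hρ (fun k => (heq k).le) hi0 (Or.inl ?_))
      · have := card_shrink hi0; omega
      · have h1 : (cornerAt Y i).1 < Y.colLen 0 := by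
          rw [← rowLen_pos_iff, rowLen_cornerAt hi0]; exact hi0
        have h2 : (cornerAt Y i).1 ≠ ρ j := fun hc => by
          have h3 := rowLen_cornerAt hi0
          rw [hc] at h3
          have h4 := hlast (by omega)
          have h5 := Y.rowLen_anti i (ρ j - 1) (by omega)
          omega
        omega
    set f' := blockMonomial (({i ∈ S | ρ i = ρ j} : Finset (Fin n)).erase j) (ρ j) with hf'
    have hff : blockMonomial {i ∈ S | ρ i = ρ j} (ρ j) = MvPolynomial.X j ^ ρ j * f' :=
      blockMonomial_eq_X_pow_mul hjB
    -- On the piece of `X_j ^ ρ j` the diagram loses a cell of its last row, as the labels do;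
    -- equality persists and the block loses `j`.
    have hsub := iha (shrink Y (ρ j) hrow0) (S.erase j) ρ
      (by rw [filter_erase_eq, card_erase_of_mem hjB, hB]; rfl) (by omega)
      (by have := card_shrink hrow0; omega) (hanti.erase hρ)
      (fun i hi => hρ i (mem_of_mem_erase hi)) (fun k => by
        have h1 := topCount_shrink hrow0 k
        have h2 := labelCount_erase (ρ := ρ) hj k
        rw [hcorner, heq] at h1
        omega) (fun hp => by
        have h1 := rowLen_shrink hrow0 (ρ j)
        have h2 := rowLen_shrink hrow0 (ρ j - 1)
        have h3 := hlast hp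
        rw [hcorner] at h1 h2
        rw [if_pos rfl] at h1
        rw [if_neg (by omega)] at h2
        omega)
    rw [filter_erase_eq, ← hf'] at hsub
    have hst : Stable (labelGroup (S.erase j) ρ)
        (annIdeal Y S ⊔ Ideal.span {blockMonomial {i ∈ S | ρ i = ρ j} (ρ j)}) :=
      ((stable_annIdeal Y S ρ).sup (stable_span_singleton fun σ hσ =>
        perm_smul_blockMonomial_label hσ)).mono (labelGroup_mono (erase_subset j S) ρ)
    have h2 := hsub.of_colon (m := MvPolynomial.X j ^ ρ j)
      (fun σ hσ => by rw [smul_pow', smul_X_of_erase hσ]) hst fun w => by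
        have := X_pow_mul_mem_sup_iff hrow0 hS hj f' w
        rwa [sup_X_pow_eq hS hj hcol, ← hff] at this
    rw [sup_sup_span_eq ⟨_, hff⟩] at h2
    exact h2.trans hchain (sup_span_le ⟨_, hff⟩) le_top
      (stable_sup_X_pow Y S ρ j _) (stable_top _)

end Main

/-! ### Critical shapes and the end of the induction. -/

section Main

variable {n : ℕ} {Y : YoungDiagram} {S : Finset (Fin n)} {ρ : Fin n → ℕ} {j : Fin n}

theorem stable_sup_block (Y : YoungDiagram) (S : Finset (Fin n)) (ρ : Fin n → ℕ) (q : ℕ) :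
    Stable (labelGroup S ρ) (annIdeal Y S ⊔ Ideal.span {blockMonomial {i ∈ S | ρ i = q} q}) :=
  (stable_annIdeal Y S ρ).sup (stable_span_singleton fun _ hσ => perm_smul_blockMonomial_label hσ)

/-- The shapes for which removing a corner in the last row may destroy strictness. -/
structure Critical (Y : YoungDiagram) (S : Finset (Fin n)) (ρ : Fin n → ℕ) (j : Fin n) : Prop where
  card : #S = Y.card
  mem : j ∈ S
  max : ∀ i ∈ S, ρ i ≤ ρ j
  anti : AntitoneLabels S ρ
  le : ∀ k, topCount Y k ≤ labelCount S ρ k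
  eq : ∀ k ≤ ρ j, topCount Y k = labelCount S ρ k
  top : topCount Y (ρ j + 1) + 1 = #S

namespace Critical

variable (h : Critical Y S ρ j)
include h

theorem card_block : #{i ∈ S | ρ i = ρ j} = Y.rowLen (ρ j) + 1 := by
  have h1 := labelCount_succ S ρ (ρ j)
  rw [labelCount_eq_card h.max (Nat.lt_succ_self _), ← h.eq _ le_rfl, ← h.top, topCount_succ] at h1
  omega

theorem rowLen_succ : Y.rowLen (ρ j + 1) = 1 := by
  have h1 : ρ j + 1 < Y.colLen 0 := by
    by_contra hc
    have := topCount_eq_card_of_le Y (not_lt.1 hc)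
    have := h.top; have := h.card; omega
  have h2 := (rowLen_pos_iff Y _).2 h1
  have h3 := topCount_le_card Y (ρ j + 2)
  rw [topCount_succ] at h3
  have := h.top; have := h.card; omega

theorem colLen : Y.colLen 0 = ρ j + 2 := by
  have h1 : ρ j + 1 < Y.colLen 0 := by
    rw [← rowLen_pos_iff, h.rowLen_succ]; exact one_pos
  by_contra hc
  have h2 := topCount_lt_card_of_lt Y (k := ρ j + 2) (by omega)
  rw [topCount_succ, h.rowLen_succ] at h2
  have := h.top; have := h.card; omega

theorem rowLen_pos : 0 < Y.rowLen (ρ j) :=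
  lt_of_lt_of_le (by rw [h.rowLen_succ]; exact one_pos) (Y.rowLen_anti _ _ (Nat.le_succ (ρ j)))

/-- The last label class has one element more than row `ρ j`, and by antitone class sizes it is no
larger than the previous class, which has the size of row `ρ j - 1`. -/
theorem rowLen_lt (hp : 0 < ρ j) : Y.rowLen (ρ j) < Y.rowLen (ρ j - 1) := by
  have h1 := h.anti (ρ j - 1) (ρ j) (Nat.sub_le _ _)
  have h2 := labelCount_succ S ρ (ρ j - 1)
  have h3 := topCount_succ Y (ρ j - 1)
  rw [Nat.sub_add_cancel hp] at h2 h3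
  rw [← h.eq _ le_rfl, ← h.eq _ (Nat.sub_le _ _)] at h2
  have := h.card_block
  omega

theorem lastBlock : LastBlock Y S {i ∈ S | ρ i = ρ j} (ρ j) where
  subset := filter_subset _ _
  card := h.card
  top := by
    rw [h.eq _ le_rfl, ← labelCount_succ, labelCount_eq_card h.max (Nat.lt_succ_self _)]
  top_succ := h.top
  rowLen := h.rowLen_succ
  colLen := h.colLen

theorem mem_block : j ∈ ({i ∈ S | ρ i = ρ j} : Finset (Fin n)) := mem_filter.2 ⟨h.mem, rfl⟩

theorem rowLen_succ_pos : 0 < Y.rowLen (ρ j + 1) := by rw [h.rowLen_succ]; exact one_pos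

theorem cornerAt_succ : cornerAt Y (ρ j + 1) = (ρ j + 1, 0) := by
  rw [cornerAt, h.rowLen_succ, h.colLen]; rfl

theorem cornerAt_fst_lt {i : ℕ} (hi : 0 < Y.rowLen i) : (cornerAt Y i).1 < ρ j + 2 := by
  rw [← h.colLen, ← rowLen_pos_iff, rowLen_cornerAt hi]; exact hi

/-- Vanishing for the shape without the last row. -/
theorem vanish_shrink (ih : ∀ s < #S, VanishFor n s) :
    Vanish (annIdeal (shrink Y (ρ j + 1) h.rowLen_succ_pos) (S.erase j) ⊔
      Ideal.span {blockMonomial (({i ∈ S | ρ i = ρ j} : Finset (Fin n)).erase j) (ρ j)}) ⊤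
        (labelGroup (S.erase j) ρ) := by
  have hcard : #(S.erase j) + 1 = #S := card_erase_add_one h.mem
  have hsh := card_shrink h.rowLen_succ_pos
  have := vanish_lastRow (p := ρ j) ih _ (shrink Y (ρ j + 1) h.rowLen_succ_pos) (S.erase j) ρ rfl
    (by omega) (by have := h.card; omega) (h.anti.erase h.max)
    (fun i hi => h.max i (mem_of_mem_erase hi)) (fun k => ?_) (fun hp => ?_)
  · rwa [filter_erase_eq] at this
  · have h1 := topCount_shrink h.rowLen_succ_pos k
    have h2 := labelCount_erase (ρ := ρ) h.mem k
    rw [h.cornerAt_succ] at h1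
    by_cases hk : k ≤ ρ j
    · rw [if_neg (by simp only; omega)] at h1
      rw [if_neg (by omega), ← h.eq k hk] at h2
      omega
    · rw [labelCount_eq_card h.max (not_le.1 hk), if_pos (by omega)] at h2
      by_cases hk' : k = ρ j + 1
      · subst hk'
        rw [if_neg (by simp)] at h1
        have := h.top; omega
      · rw [if_pos (by simp only; omega), topCount_eq_card_of_le Y (by rw [h.colLen]; omega)] at h1
        have := h.card; omega
  · have h1 := rowLen_shrink h.rowLen_succ_pos (ρ j)
    have h2 := rowLen_shrink h.rowLen_succ_pos (ρ j - 1)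
    rw [h.cornerAt_succ, if_neg (by simp)] at h1
    rw [h.cornerAt_succ, if_neg (by simp only; omega)] at h2
    have := h.rowLen_lt hp
    omega

theorem vanish_piece (ih : ∀ s < #S, VanishFor n s) {i : ℕ} (hi : 0 < Y.rowLen i)
    (hc : (cornerAt Y i).1 ≤ ρ j) : Vanish (annIdeal (shrink Y i hi) (S.erase j)) ⊤
      (labelGroup (S.erase j) ρ) := by
  have hcard : #(S.erase j) + 1 = #S := card_erase_add_one h.mem
  refine ih _ (by omega) _ _ _ rfl ?_ (h.anti.erase h.max)
    (topCount_shrink_le h.card h.mem h.max h.le hi)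
    (exists_lt_labelCount_shrink h.card h.mem h.max h.le hi (Or.inr (Or.inr (Or.inl ⟨hc, ?_⟩))))
  · have := card_shrink hi; have := h.card; omega
  · have := h.top; omega

theorem blockMonomial_eq : blockMonomial {i ∈ S | ρ i = ρ j} (ρ j) =
    MvPolynomial.X j ^ ρ j * blockMonomial (({i ∈ S | ρ i = ρ j} : Finset (Fin n)).erase j) (ρ j) :=
  blockMonomial_eq_X_pow_mul h.mem_block

theorem X_pow_succ_mul_mem_iff (g w : Poly n) :
    MvPolynomial.X j ^ (ρ j + 1) * w ∈
        annIdeal Y S ⊔ Ideal.span {MvPolynomial.X j ^ (ρ j + 1) * g} ↔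
      w ∈ annIdeal (shrink Y (ρ j + 1) h.rowLen_succ_pos) (S.erase j) ⊔ Ideal.span {g} := by
  have := X_pow_mul_mem_sup_iff h.rowLen_succ_pos h.card h.mem g w
  rwa [sup_X_pow_eq h.card h.mem h.colLen.le] at this

/-- Only the piece of `X_j ^ (ρ j + 1)` loses the cell of the last row and with it the strictness.
It suffices to kill f' there, that is, to work modulo X_j f. -/
theorem exists_primitive_of_two_le (ih : ∀ s < #S, VanishFor n s) (h2 : 2 ≤ Y.rowLen (ρ j)) :
    ∃ I ≤ annIdeal Y S ⊔ Ideal.span {blockMonomial {i ∈ S | ρ i = ρ j} (ρ j)},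
      annIdeal Y S ≤ I ∧ Vanish I ⊤ (labelGroup (S.erase j) ρ) := by
  have hchain := vanish_sup_X_pow (ρ := ρ) h.card h.mem (ρ j + 1) (by rw [h.colLen]; omega)
    fun i hi hi0 => by
      refine h.vanish_piece ih hi0 ?_
      have h1 := h.cornerAt_fst_lt hi0
      have h3 : (cornerAt Y i).1 ≠ ρ j + 1 := fun hc => by
        have h4 := rowLen_cornerAt hi0
        rw [hc, h.rowLen_succ] at h4
        have h5 := Y.rowLen_anti i (ρ j) (by omega)
        omega
      omega
  set f' := blockMonomial (({i ∈ S | ρ i = ρ j} : Finset (Fin n)).erase j) (ρ j) with hf'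
  have e : MvPolynomial.X j ^ (ρ j + 1) * f' =
      blockMonomial {i ∈ S | ρ i = ρ j} (ρ j) * MvPolynomial.X j := by
    rw [h.blockMonomial_eq]; ring
  refine ⟨annIdeal Y S ⊔ Ideal.span {MvPolynomial.X j ^ (ρ j + 1) * f'},
    sup_span_le ⟨_, e⟩, le_sup_left, ?_⟩
  have hst : Stable (labelGroup (S.erase j) ρ)
      (annIdeal Y S ⊔ Ideal.span {MvPolynomial.X j ^ (ρ j + 1) * f'}) := by
    refine ((stable_annIdeal Y S ρ).mono (labelGroup_mono (erase_subset j S) ρ)).sup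
      (stable_span_singleton fun σ hσ => ?_)
    rw [e, smul_mul', smul_X_of_erase hσ,
      perm_smul_blockMonomial_label (labelGroup_mono (erase_subset j S) ρ hσ)]
  have h3 := (h.vanish_shrink ih).of_colon (m := MvPolynomial.X j ^ (ρ j + 1))
    (fun σ hσ => by rw [smul_pow', smul_X_of_erase hσ]) hst (h.X_pow_succ_mul_mem_iff f')
  rw [sup_sup_span_eq (Dvd.intro _ rfl)] at h3
  exact h3.trans hchain (sup_span_le (Dvd.intro _ rfl)) le_top
    (stable_sup_X_pow Y S ρ j _) (stable_top _)

theorem shrink_eq (h1 : Y.rowLen (ρ j) = 1) :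
    shrink Y (ρ j) h.rowLen_pos = shrink Y (ρ j + 1) h.rowLen_succ_pos := by
  have hc : cornerAt Y (ρ j) = cornerAt Y (ρ j + 1) := by
    rw [cornerAt, cornerAt, h1, h.rowLen_succ]
  ext c
  change c ∈ Y.cells.erase _ ↔ c ∈ Y.cells.erase _
  rw [hc]

/-- The block is `{j, l}`, and f X_l may be replaced by -f X_j. So a multiple of f is f v₀ plus a
multiple of f X_j, and the task is to show that f v₀ vanishes. -/
theorem X_pow_succ_mul_mem_block_iff (h1 : Y.rowLen (ρ j) = 1) (w : Poly n) :
    MvPolynomial.X j ^ (ρ j + 1) * w ∈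
        annIdeal Y S ⊔ Ideal.span {blockMonomial {i ∈ S | ρ i = ρ j} (ρ j)} ↔
      w ∈ annIdeal (shrink Y (ρ j + 1) h.rowLen_succ_pos) (S.erase j) ⊔
        Ideal.span {blockMonomial (({i ∈ S | ρ i = ρ j} : Finset (Fin n)).erase j) (ρ j)} := by
  set B : Finset (Fin n) := {i ∈ S | ρ i = ρ j} with hB
  set f' := blockMonomial (B.erase j) (ρ j) with hf'
  set f := blockMonomial B (ρ j) with hf
  have hff : f = MvPolynomial.X j ^ ρ j * f' := h.blockMonomial_eq
  have e : MvPolynomial.X j ^ (ρ j + 1) * f' = f * MvPolynomial.X j := by rw [hff]; ring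
  have hjB : j ∈ B := h.mem_block
  have hL : LastBlock Y S B (ρ j) := h.lastBlock
  rw [← h.X_pow_succ_mul_mem_iff]
  refine ⟨fun hw => ?_, fun hw => sup_span_le ⟨_, e⟩ hw⟩
  obtain ⟨l, hl⟩ := card_eq_one.1 (show #(B.erase j) = 1 by
    rw [card_erase_of_mem hjB, h.card_block, h1])
  have hlB : l ∈ B := mem_of_mem_erase (hl ▸ mem_singleton_self l)
  obtain ⟨u, hu, v, hv, huv⟩ := Submodule.mem_sup.1 hw
  obtain ⟨v, rfl⟩ := Ideal.mem_span_singleton'.1 hv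
  obtain ⟨v₀, hv₀, v₁, hv₁, hvv⟩ := exists_linear_part
    (Submodule.comap (LinearMap.mulLeft (Poly n) f) (annIdeal Y S))
      (fun k hk m hm => hL.mul_X_mul_X_mem hk hm) v
  replace hvv : f * (v - v₀ - ∑ k ∈ B, MvPolynomial.X k * v₁ k) ∈ annIdeal Y S := hvv
  have hsum := hL.mul_sum_X_mem
  rw [← add_sum_erase B _ hjB, hl, sum_singleton] at hvv hsum
  have h3 : f * (v - v₀ - MvPolynomial.X j * (v₁ j - v₁ l)) ∈ annIdeal Y S := by
    convert add_mem hvv (Ideal.mul_mem_left _ (v₁ l) hsum) using 1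
    rw [← hf]; ring
  -- Divide the relation by `X_j ^ ρ j`. In the quotient for the smaller diagram X_j is zero, and
  -- only f' v₀ is left.
  have h4 : f' * v₀ ∈ annIdeal (shrink Y (ρ j + 1) h.rowLen_succ_pos) (S.erase j) := by
    have h5 : MvPolynomial.X j ^ ρ j * (MvPolynomial.X j * w - f' * v₀ -
        MvPolynomial.X j * (f' * (v₁ j - v₁ l))) ∈
        annIdeal Y S ⊔ Ideal.span {MvPolynomial.X j ^ (ρ j + 1)} := by
      refine Ideal.mem_sup_left ?_
      convert add_mem hu h3 using 1
      rw [hff] at huv ⊢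
      linear_combination -huv
    have h6 := mem_annIdeal_shrink h.rowLen_pos h.mem h5
    rw [h.shrink_eq h1] at h6
    have hX : (MvPolynomial.X j : Poly n) ∈
        annIdeal (shrink Y (ρ j + 1) h.rowLen_succ_pos) (S.erase j) :=
      X_mem_annIdeal (notMem_erase j S)
    have h7 := sub_mem (Ideal.mul_mem_left _ (w - f' * (v₁ j - v₁ l)) hX) h6
    convert h7 using 1
    ring
  have h5 : f * v₀ ∈ annIdeal Y S := by
    refine hL.mul_mem_of_mul_X hv₀ hjB ?_
    have := (X_pow_mul_mem_iff h.rowLen_succ_pos h.card h.mem).2 h4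
    rw [sup_X_pow_eq h.card h.mem h.colLen.le] at this
    convert this using 1
    rw [← hf, hff]; ring
  have h6 : MvPolynomial.X j ^ (ρ j + 1) * w =
      (u + f * (v - v₀ - MvPolynomial.X j * (v₁ j - v₁ l)) + f * v₀) +
        (v₁ j - v₁ l) * (MvPolynomial.X j ^ (ρ j + 1) * f') := by
    rw [e]; linear_combination -huv
  rw [h6]
  exact add_mem (Ideal.mem_sup_left (add_mem (add_mem hu h3) h5))
    (Ideal.mem_sup_right (Ideal.mul_mem_left _ _ (Ideal.mem_span_singleton_self _)))

/-- The pieces of exponents `ρ j` and `ρ j + 1` now belong to the same diagram, the one without the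
last row. Both are treated modulo f'; the lower ones remain strict. -/
theorem vanish_of_rowLen_eq_one (ih : ∀ s < #S, VanishFor n s) (h1 : Y.rowLen (ρ j) = 1) :
    Vanish (annIdeal Y S ⊔ Ideal.span {blockMonomial {i ∈ S | ρ i = ρ j} (ρ j)}) ⊤
      (labelGroup (S.erase j) ρ) := by
  have hchain := vanish_sup_X_pow (ρ := ρ) h.card h.mem (ρ j) (by rw [h.colLen]; omega)
    fun i hi hi0 => by
      refine h.vanish_piece ih hi0 ?_
      have h2 := h.cornerAt_fst_lt hi0
      have h3 : (cornerAt Y i).1 ≠ ρ j + 1 := fun hc => by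
        have h4 := rowLen_cornerAt hi0
        rw [hc, h.rowLen_succ] at h4
        have h5 := Y.rowLen_anti i (ρ j - 1) (by omega)
        have h6 := h.rowLen_lt (by omega)
        omega
      omega
  have hsub := h.vanish_shrink ih
  have hiff := h.X_pow_succ_mul_mem_block_iff h1
  have hff := h.blockMonomial_eq
  have hst := (stable_sup_block Y S ρ (ρ j)).mono (labelGroup_mono (erase_subset j S) ρ)
  set f' := blockMonomial (({i ∈ S | ρ i = ρ j} : Finset (Fin n)).erase j) (ρ j) with hf'
  set f := blockMonomial {i ∈ S | ρ i = ρ j} (ρ j) with hf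
  have hmid : Stable (labelGroup (S.erase j) ρ)
      (annIdeal Y S ⊔ Ideal.span {MvPolynomial.X j ^ (ρ j + 1)} ⊔ Ideal.span {f}) :=
    (stable_sup_X_pow Y S ρ j _).sup (stable_span_singleton fun σ hσ =>
      perm_smul_blockMonomial_label (labelGroup_mono (erase_subset j S) ρ hσ))
  have h2 := hsub.of_colon (m := MvPolynomial.X j ^ ρ j)
    (fun σ hσ => by rw [smul_pow', smul_X_of_erase hσ]) hmid fun w => by
      have := X_pow_mul_mem_sup_iff h.rowLen_pos h.card h.mem f' w
      rwa [h.shrink_eq h1, ← hff] at this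
  rw [sup_sup_span_eq ⟨_, hff⟩, sup_sup_span_eq (pow_dvd_pow _ (Nat.le_succ _))]
    at h2
  have h3 := hsub.of_colon (m := MvPolynomial.X j ^ (ρ j + 1))
    (fun σ hσ => by rw [smul_pow', smul_X_of_erase hσ]) hst hiff
  rw [sup_right_comm] at h3
  refine h3.trans (h2.trans hchain ?_ le_top (stable_sup_X_pow Y S ρ j _) (stable_top _)) ?_ le_top
    hmid (stable_top _)
  · refine sup_le (sup_span_le (pow_dvd_pow _ (Nat.le_succ _))) (le_trans ?_ le_sup_right)
    exact (Ideal.span_singleton_le_span_singleton).2 ⟨_, hff⟩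
  · exact sup_le (le_sup_left.trans le_sup_left) le_sup_right

/-- A primitive modulo (f) is averaged over the full label group and subtracted. The remaining
equivariant cocycle has values in the multiples of f and is handled by the last block. -/
theorem exists_primitive (ih : ∀ s < #S, VanishFor n s) {y : Fin n → Poly n}
    (hc : ∀ i k, MvPolynomial.X i * y k - MvPolynomial.X k * y i ∈ annIdeal Y S)
    (he : ∀ σ ∈ labelGroup S ρ, ∀ i, σ • y i - y (σ i) ∈ annIdeal Y S) :
    ∃ g, ∀ i, y i - MvPolynomial.X i * g ∈ annIdeal Y S := by
  set J₁ := annIdeal Y S ⊔ Ideal.span {blockMonomial {i ∈ S | ρ i = ρ j} (ρ j)} with hJ₁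
  obtain ⟨I, hI, hJI, hV⟩ : ∃ I ≤ J₁, annIdeal Y S ≤ I ∧ Vanish I ⊤ (labelGroup (S.erase j) ρ) := by
    by_cases h1 : Y.rowLen (ρ j) = 1
    · exact ⟨_, le_rfl, le_sup_left, h.vanish_of_rowLen_eq_one ih h1⟩
    · exact h.exists_primitive_of_two_le ih (by have := h.rowLen_pos; omega)
  obtain ⟨g₀, -, hg₀⟩ := hV.h1 y (fun _ => trivial) (fun i k => hJI (hc i k)) fun σ hσ i =>
    hJI (he σ (labelGroup_mono (erase_subset j S) ρ hσ) i)
  obtain ⟨g, -, hginv, hg⟩ := exists_invariant_primitive (G := labelGroup S ρ) (I₃ := ⊤)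
    (stable_sup_block Y S ρ (ρ j)) (stable_top _) (fun σ hσ i => (le_sup_left : _ ≤ J₁) (he σ hσ i))
    (g₀ := g₀) trivial fun i => hI (hg₀ i)
  obtain ⟨g', hg'⟩ := h.lastBlock.exists_primitive (G := labelGroup S ρ)
    (by rw [h.card_block]; have := h.rowLen_pos; omega)
    (fun k hk l hl => by
      rw [mem_filter] at hk hl
      exact swap_mem_labelGroup hk.1 hl.1 (by rw [hk.2, hl.2]))
    (y := fun i => y i - MvPolynomial.X i * g) hg
    (fun i k => by convert hc i k using 1; ring)
    (fun σ hσ i => by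
      convert he σ hσ i using 1
      rw [smul_sub, smul_mul', perm_smul_X, hginv σ hσ]; ring)
  exact ⟨g + g', fun i => by convert hg' i using 1; ring⟩

end Critical

/-- Induction on the number of variables, with `j` of maximal label. Outside the critical case every
piece of the `X_j`-adic filtration again satisfies strict dominance. -/
theorem vanishFor (s : ℕ) : VanishFor n s := by
  induction s using Nat.strong_induction_on with
  | _ s ih =>
    intro Y S ρ hs hS hanti hle hlt
    refine ⟨fun y _ => vanish_h0 hlt, fun y hy hc he => ?_⟩
    have hne : S.Nonempty := by
      obtain ⟨k, hk⟩ := hlt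
      exact card_pos.1 (((Nat.zero_le _).trans_lt hk).trans_le (labelCount_le_card S ρ k))
    obtain ⟨j, hj, hmax⟩ := S.exists_max_image ρ hne
    subst hs
    by_cases hcr : (∀ k ≤ ρ j, topCount Y k = labelCount S ρ k) ∧ topCount Y (ρ j + 1) + 1 = #S
    · obtain ⟨g, hg⟩ := Critical.exists_primitive
        ⟨hS, hj, hmax, hanti, hle, hcr.1, hcr.2⟩ ih hc he
      exact ⟨g, trivial, hg⟩
    · have hcard : #(S.erase j) + 1 = #S := card_erase_add_one hj
      have key : ∀ i (hi : 0 < Y.rowLen i),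
          ∃ k, topCount (shrink Y i hi) k < labelCount (S.erase j) ρ k := by
        intro i hi
        refine exists_lt_labelCount_shrink hS hj hmax hle hi (Or.inr ?_)
        by_cases hk : ∃ k ≤ ρ j, topCount Y k < labelCount S ρ k
        · exact Or.inl hk
        · have heq : ∀ k ≤ ρ j, topCount Y k = labelCount S ρ k := fun k hk' =>
            le_antisymm (hle k) (not_lt.1 fun h => hk ⟨k, hk', h⟩)
          obtain ⟨k, hk'⟩ := hlt
          have h1 : ρ j < k := by
            by_contra hc; exact hk ⟨k, not_lt.1 hc, hk'⟩
          rw [labelCount_eq_card hmax h1] at hk'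
          have h2 : topCount Y (ρ j + 1) ≤ topCount Y k :=
            sum_le_sum_of_subset (range_subset_range.2 h1)
          have h3 : topCount Y (ρ j + 1) + 1 ≠ #S := fun h => hcr ⟨heq, h⟩
          exact Or.inr (Or.inr (by omega))
      have hchain := vanish_sup_X_pow (ρ := ρ) hS hj (Y.colLen 0) le_rfl fun i _ hi0 => by
        refine ih _ (by omega) _ _ _ rfl ?_ (hanti.erase hmax)
          (topCount_shrink_le hS hj hmax hle hi0) (key i hi0)
        have := card_shrink hi0; omega
      rw [sup_X_pow_eq hS hj le_rfl] at hchain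
      exact (hchain.mono (labelGroup_mono (erase_subset j S) ρ)).h1 y hy hc he

end Main

/-! ### Young symmetrizers -/

section YoungSymmetrizers

variable {n : ℕ}

/-- The group algebra `ℂ𝔖_n`. -/
abbrev GroupAlg (n : ℕ) : Type := MonoidAlgebra ℂ (Equiv.Perm (Fin n))

/-- The sum of the permutations that preserve the labels `ρ`. -/
def rowSum (ρ : Fin n → ℕ) : GroupAlg n :=
  ∑ p : Equiv.Perm (Fin n) with p ∈ labelGroup univ ρ, MonoidAlgebra.single p 1

/-- The signed sum of the permutations that preserve the labels `γ`. -/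
def colSum (γ : Fin n → ℕ) : GroupAlg n :=
  ∑ q : Equiv.Perm (Fin n) with q ∈ labelGroup univ γ,
    MonoidAlgebra.single q ((Equiv.Perm.sign q : ℤ) : ℂ)

theorem mem_labelGroup_univ {ρ : Fin n → ℕ} {σ : Equiv.Perm (Fin n)} :
    σ ∈ labelGroup univ ρ ↔ ∀ i, ρ (σ i) = ρ i := by
  simp [mem_labelGroup]

theorem youngSymmetrizer_eq (l : Part n) :
    youngSymmetrizer l = rowSum (rowOf l) * colSum (colOf l) := by
  rw [youngSymmetrizer, rowSum, colSum]
  congr 1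
  · refine sum_congr ?_ fun _ _ => rfl
    ext p; simp only [mem_filter, mem_univ, true_and, mem_labelGroup_univ]
  · refine sum_congr ?_ fun q _ => ?_
    · ext p; simp only [mem_filter, mem_univ, true_and, mem_labelGroup_univ]
    · rw [MonoidAlgebra.of_apply, MonoidAlgebra.smul_single, smul_eq_mul, mul_one]

variable {ρ γ : Fin n → ℕ} {σ : Equiv.Perm (Fin n)}

theorem rowSum_mul_single (hσ : σ ∈ labelGroup univ ρ) :
    rowSum ρ * MonoidAlgebra.single σ 1 = rowSum ρ := by
  rw [rowSum, sum_mul]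
  refine sum_bij' (fun p _ => p * σ) (fun p _ => p * σ⁻¹) ?_ ?_ ?_ ?_ ?_
  · intro q hq; simp only [mem_filter, mem_univ, true_and] at hq ⊢; exact mul_mem hq hσ
  · intro q hq; simp only [mem_filter, mem_univ, true_and] at hq ⊢; exact mul_mem hq (inv_mem hσ)
  · intro q _; simp
  · intro q _; simp
  · intro q _; rw [MonoidAlgebra.single_mul_single, one_mul]

theorem single_mul_rowSum (hσ : σ ∈ labelGroup univ ρ) :
    MonoidAlgebra.single σ 1 * rowSum ρ = rowSum ρ := by
  rw [rowSum, mul_sum]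
  refine sum_bij' (fun p _ => σ * p) (fun p _ => σ⁻¹ * p) ?_ ?_ ?_ ?_ ?_
  · intro q hq; simp only [mem_filter, mem_univ, true_and] at hq ⊢; exact mul_mem hσ hq
  · intro q hq; simp only [mem_filter, mem_univ, true_and] at hq ⊢; exact mul_mem (inv_mem hσ) hq
  · intro q _; simp
  · intro q _; simp
  · intro q _; rw [MonoidAlgebra.single_mul_single, one_mul]

theorem sign_mul_self (σ : Equiv.Perm (Fin n)) :
    ((Equiv.Perm.sign σ : ℤ) : ℂ) * ((Equiv.Perm.sign σ : ℤ) : ℂ) = 1 := by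
  rcases Int.units_eq_one_or (Equiv.Perm.sign σ) with h | h <;> simp [h]

theorem colSum_mul_single (hσ : σ ∈ labelGroup univ γ) :
    colSum γ * MonoidAlgebra.single σ 1 = ((Equiv.Perm.sign σ : ℤ) : ℂ) • colSum γ := by
  rw [colSum, sum_mul, smul_sum]
  refine sum_bij' (fun p _ => p * σ) (fun p _ => p * σ⁻¹) ?_ ?_ ?_ ?_ ?_
  · intro q hq; simp only [mem_filter, mem_univ, true_and] at hq ⊢; exact mul_mem hq hσ
  · intro q hq; simp only [mem_filter, mem_univ, true_and] at hq ⊢; exact mul_mem hq (inv_mem hσ)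
  · intro q _; simp
  · intro q _; simp
  · intro q _
    rw [MonoidAlgebra.single_mul_single, mul_one, MonoidAlgebra.smul_single, smul_eq_mul,
      Equiv.Perm.sign_mul]
    push_cast
    rw [mul_comm ((Equiv.Perm.sign q : ℤ) : ℂ), ← mul_assoc, sign_mul_self, one_mul]

theorem single_mul_colSum (hσ : σ ∈ labelGroup univ γ) :
    MonoidAlgebra.single σ 1 * colSum γ = ((Equiv.Perm.sign σ : ℤ) : ℂ) • colSum γ := by
  rw [colSum, mul_sum, smul_sum]
  refine sum_bij' (fun p _ => σ * p) (fun p _ => σ⁻¹ * p) ?_ ?_ ?_ ?_ ?_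
  · intro q hq; simp only [mem_filter, mem_univ, true_and] at hq ⊢; exact mul_mem hσ hq
  · intro q hq; simp only [mem_filter, mem_univ, true_and] at hq ⊢; exact mul_mem (inv_mem hσ) hq
  · intro q _; simp
  · intro q _; simp
  · intro q _
    rw [MonoidAlgebra.single_mul_single, one_mul, MonoidAlgebra.smul_single, smul_eq_mul,
      Equiv.Perm.sign_mul]
    push_cast
    rw [← mul_assoc, sign_mul_self, one_mul]

theorem single_mul_single_comm (g w : Equiv.Perm (Fin n)) :
    (MonoidAlgebra.single w 1 * MonoidAlgebra.single g 1 : GroupAlg n) =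
      MonoidAlgebra.single g 1 * MonoidAlgebra.single (g⁻¹ * w * g) 1 := by
  rw [MonoidAlgebra.single_mul_single, MonoidAlgebra.single_mul_single]
  congr 1; group

theorem eq_zero_of_eq_neg {M : Type*} [AddCommGroup M] [Module ℂ M] {x : M} (h : x = -x) :
    x = 0 := by
  have h1 : (2 : ℂ) • x = 0 := by
    rw [two_smul]; nth_rewrite 1 [h]; exact neg_add_cancel x
  exact (smul_eq_zero.1 h1).resolve_left two_ne_zero

theorem neg_eq_swap_smul (hσ : ∃ i k, i ≠ k ∧ σ = Equiv.swap i k) (x : GroupAlg n) :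
    ((Equiv.Perm.sign σ : ℤ) : ℂ) • x = -x := by
  obtain ⟨i, k, hik, rfl⟩ := hσ
  rw [Equiv.Perm.sign_swap hik]; simp

theorem conj_swap (g : Equiv.Perm (Fin n)) (i k : Fin n) :
    g * Equiv.swap i k * g⁻¹ = Equiv.swap (g i) (g k) := by
  rw [Equiv.mul_swap_eq_swap_mul, mul_inv_cancel_right]

/-- The row sum absorbs the transposition of two elements in a common row; moved across `g` it
becomes a transposition within a column and changes the sign of the column sum. -/
theorem rowSum_mul_colSum_eq_zero (g : Equiv.Perm (Fin n))
    (h : ¬ Function.Injective fun i => (ρ i, γ (g⁻¹ i))) :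
    rowSum ρ * MonoidAlgebra.single g 1 * colSum γ = 0 := by
  simp only [Function.Injective, not_forall] at h
  obtain ⟨i, k, hik, hne⟩ := h
  have h1 := swap_mem_labelGroup (mem_univ i) (mem_univ k) (Prod.ext_iff.1 hik).1
  have h2 := swap_mem_labelGroup (mem_univ (g⁻¹ i)) (mem_univ (g⁻¹ k)) (Prod.ext_iff.1 hik).2
  have hc : g⁻¹ * Equiv.swap i k * g = Equiv.swap (g⁻¹ i) (g⁻¹ k) := by
    have := conj_swap g⁻¹ i k; rwa [inv_inv] at this
  refine eq_zero_of_eq_neg ?_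
  conv_lhs => rw [← rowSum_mul_single h1]
  rw [mul_assoc (rowSum ρ), single_mul_single_comm, hc, mul_assoc, mul_assoc,
    single_mul_colSum h2, neg_eq_swap_smul ⟨_, _, fun hh => hne (g⁻¹.injective hh), rfl⟩, mul_neg,
    mul_neg, mul_assoc]

theorem colSum_mul_rowSum_eq_zero (g : Equiv.Perm (Fin n))
    (h : ¬ Function.Injective fun i => (ρ i, γ (g i))) :
    colSum γ * MonoidAlgebra.single g 1 * rowSum ρ = 0 := by
  simp only [Function.Injective, not_forall] at h
  obtain ⟨i, k, hik, hne⟩ := h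
  have h1 := swap_mem_labelGroup (mem_univ i) (mem_univ k) (Prod.ext_iff.1 hik).1
  have h2 := swap_mem_labelGroup (mem_univ (g i)) (mem_univ (g k)) (Prod.ext_iff.1 hik).2
  have hc : g⁻¹ * Equiv.swap (g i) (g k) * g = Equiv.swap i k := by
    rw [← conj_swap]; group
  refine eq_zero_of_eq_neg ?_
  rw [← neg_eq_swap_smul ⟨_, _, fun hh => hne (g.injective hh), rfl⟩, ← smul_mul_assoc,
    ← smul_mul_assoc, ← colSum_mul_single h2, mul_assoc (colSum γ) _ (MonoidAlgebra.single g 1),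
    single_mul_single_comm, hc, ← mul_assoc, mul_assoc _ (MonoidAlgebra.single (Equiv.swap i k) 1), single_mul_rowSum h1,
    mul_assoc]

theorem rowSum_mul_mul_colSum_eq_zero
    (h : ∀ g : Equiv.Perm (Fin n), ¬ Function.Injective fun i => (ρ i, γ (g i))) (x : GroupAlg n) :
    rowSum ρ * x * colSum γ = 0 := by
  induction x using MonoidAlgebra.induction_on with
  | of g => exact rowSum_mul_colSum_eq_zero g (h g⁻¹)
  | add a b ha hb => rw [mul_add, add_mul, ha, hb, add_zero]
  | smul c a ha => rw [mul_smul_comm, smul_mul_assoc, ha, smul_zero]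

theorem colSum_mul_mul_rowSum_eq_zero
    (h : ∀ g : Equiv.Perm (Fin n), ¬ Function.Injective fun i => (ρ i, γ (g i))) (x : GroupAlg n) :
    colSum γ * x * rowSum ρ = 0 := by
  induction x using MonoidAlgebra.induction_on with
  | of g => exact colSum_mul_rowSum_eq_zero g (h g)
  | add a b ha hb => rw [mul_add, add_mul, ha, hb, add_zero]
  | smul c a ha => rw [mul_smul_comm, smul_mul_assoc, ha, smul_zero]

/-! ### The standard filling -/

theorem isTab_filling (l : Part n) : IsTab l.1 univ (rowOf l) (colOf l) := by
  have h : ∀ i, (rowOf l i, colOf l i) = ((filling l).symm i).1 := fun i => rfl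
  refine ⟨fun i _ => ?_, fun i _ k _ hik => ?_, fun c hc => ⟨filling l ⟨c, hc⟩, by simp, ?_⟩⟩
  · simp only [h]; exact ((filling l).symm i).2
  · exact (filling l).symm.injective (Subtype.ext hik)
  · simp [h]

theorem domLE_iff {l m : Part n} : DomLE l m ↔ ∀ k, topCount l.1 k ≤ topCount m.1 k := Iff.rfl

theorem eq_of_domLE {l m : Part n} (h1 : DomLE l m) (h2 : DomLE m l) : l = m :=
  Subtype.ext (rowLen_eq_of_topCount_eq fun k => le_antisymm (h1 k) (h2 k))

theorem labelCount_rowOf (l : Part n) (k : ℕ) : labelCount univ (rowOf l) k = topCount l.1 k :=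
  (isTab_filling l).card_lt k

theorem card_colOf_comp (m : Part n) (g : Equiv.Perm (Fin n)) (j : ℕ) :
    #{x | colOf m (g x) = j} = m.1.colLen j := by
  rw [← (isTab_filling m).card_col j]
  exact card_bij' (fun i _ => g i) (fun i _ => g⁻¹ i) (by simp) (by simp) (by simp) (by simp)

theorem domLE_of_injective {l m : Part n} {g : Equiv.Perm (Fin n)}
    (h : Function.Injective fun i => (rowOf l i, colOf m (g i))) : DomLE l m := by
  intro k
  have h1 := card_lt_le_topCount (Y := m.1) (s := univ) (r := rowOf l) (γ := colOf m ∘ g)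
    (fun a _ b _ hab => h hab) (fun j => (card_colOf_comp m g j).le) k
  have h2 := labelCount_rowOf l k
  rw [labelCount] at h2
  rw [h2] at h1
  exact h1

/-- Two fillings of the same diagram are related by a permutation. -/
theorem IsTab.exists_perm {Y : YoungDiagram} {r c r' c' : Fin n → ℕ} (h : IsTab Y univ r c)
    (h' : IsTab Y univ r' c') :
    ∃ w : Equiv.Perm (Fin n), (∀ i, r (w i) = r' i) ∧ ∀ i, c (w i) = c' i := by
  have key : ∀ i, ∃ k, r k = r' i ∧ c k = c' i := fun i => by
    obtain ⟨k, -, hk⟩ := h.surjOn (h'.mapsTo (mem_coe.2 (mem_univ i)))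
    exact ⟨k, Prod.ext_iff.1 hk⟩
  choose w hw using key
  have hinj : Function.Injective w := fun i k hik => h'.eq_of_eq (mem_univ _) (mem_univ _)
    (by rw [← (hw i).1, ← (hw k).1, hik]) (by rw [← (hw i).2, ← (hw k).2, hik])
  exact ⟨Equiv.ofBijective w (Finite.injective_iff_bijective.1 hinj), fun i => (hw i).1,
    fun i => (hw i).2⟩

theorem isTab_of_injective {l : Part n} {g : Equiv.Perm (Fin n)}
    (h : Function.Injective fun i => (rowOf l i, colOf l (g i))) :
    IsTab l.1 univ (rowOf l) (colOf l ∘ g) :=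
  isTab_of_injOn (fun _ _ _ _ hab => h hab) (fun j => card_colOf_comp l g j)
    fun k => (isTab_filling l).card_lt k

/-- For distinct shapes dominance fails in one direction. Accordingly either the inner column and
row sums or the outer row and column sums annihilate each other. -/
theorem youngSymmetrizer_mul_mul_eq_zero {l m : Part n} (hlm : l ≠ m) (x : GroupAlg n) :
    youngSymmetrizer l * x * youngSymmetrizer m = 0 := by
  rw [youngSymmetrizer_eq, youngSymmetrizer_eq]
  by_cases h : DomLE l m
  · have h' : ¬ DomLE m l := fun h' => hlm (eq_of_domLE h h')
    have := colSum_mul_mul_rowSum_eq_zero (ρ := rowOf m) (γ := colOf l)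
      (fun g hg => h' (domLE_of_injective hg)) x
    rw [mul_assoc (rowSum _), mul_assoc (rowSum _), ← mul_assoc (_ * x), this, zero_mul, mul_zero]
  · have := rowSum_mul_mul_colSum_eq_zero (ρ := rowOf l) (γ := colOf m)
      (fun g hg => h (domLE_of_injective hg)) (colSum (colOf l) * x * rowSum (rowOf m))
    rw [← this]; simp only [mul_assoc]

/-- If no two elements share a row and a transported column, `g` is a row permutation times a column
permutation and is absorbed up to sign. Otherwise the product is zero. -/
theorem exists_rowSum_mul_mul_colSum (l : Part n) (x : GroupAlg n) :
    ∃ t : ℂ, rowSum (rowOf l) * x * colSum (colOf l) = t • youngSymmetrizer l := by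
  rw [youngSymmetrizer_eq]
  induction x using MonoidAlgebra.induction_on with
  | of g =>
    by_cases h : Function.Injective fun i => (rowOf l i, colOf l (g⁻¹ i))
    · obtain ⟨p, hp1, hp2⟩ := (isTab_filling l).exists_perm (isTab_of_injective h)
      have hp : p ∈ labelGroup univ (rowOf l) := mem_labelGroup_univ.2 hp1
      have hq : g⁻¹ * p⁻¹ ∈ labelGroup univ (colOf l) := mem_labelGroup_univ.2 fun i => by
        have := hp2 (p⁻¹ i)
        simp only [Function.comp] at this
        rw [Equiv.Perm.mul_apply, ← this]; simp
      have hg : g = p⁻¹ * (g⁻¹ * p⁻¹)⁻¹ := by group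
      refine ⟨((Equiv.Perm.sign (g⁻¹ * p⁻¹)⁻¹ : ℤ) : ℂ), ?_⟩
      have e : (MonoidAlgebra.of ℂ (Equiv.Perm (Fin n)) g : GroupAlg n) =
          MonoidAlgebra.single p⁻¹ 1 * MonoidAlgebra.single (g⁻¹ * p⁻¹)⁻¹ 1 := by
        rw [MonoidAlgebra.single_mul_single, one_mul, ← hg]; rfl
      rw [e, ← mul_assoc, rowSum_mul_single (inv_mem hp), mul_assoc,
        single_mul_colSum (inv_mem hq), mul_smul_comm]
    · exact ⟨0, by rw [zero_smul]; exact rowSum_mul_colSum_eq_zero g h⟩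
  | add a b ha hb =>
    obtain ⟨s, hs⟩ := ha
    obtain ⟨t, ht⟩ := hb
    exact ⟨s + t, by rw [mul_add, add_mul, hs, ht, add_smul]⟩
  | smul c a ha =>
    obtain ⟨s, hs⟩ := ha
    exact ⟨c * s, by rw [mul_smul_comm, smul_mul_assoc, hs, smul_smul]⟩

theorem exists_youngSymmetrizer_mul_mul (l : Part n) (x : GroupAlg n) :
    ∃ t : ℂ, youngSymmetrizer l * x * youngSymmetrizer l = t • youngSymmetrizer l := by
  obtain ⟨t, ht⟩ := exists_rowSum_mul_mul_colSum l (colSum (colOf l) * x * rowSum (rowOf l))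
  refine ⟨t, ?_⟩
  rw [← ht, youngSymmetrizer_eq]
  simp only [mul_assoc]

theorem coeff_one_youngSymmetrizer (l : Part n) : (youngSymmetrizer l).coeff 1 = 1 := by
  rw [youngSymmetrizer_eq, rowSum, colSum, sum_mul_sum]
  simp only [MonoidAlgebra.single_mul_single, one_mul, MonoidAlgebra.coeff_sum,
    MonoidAlgebra.coeff_single, Finsupp.finsetSum_apply, Finsupp.single_apply]
  rw [sum_eq_single 1, sum_eq_single 1]
  · simp
  · intro q _ hq; rw [if_neg (by simpa using hq)]
  · intro h; exact absurd (by simp [one_mem]) h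
  · intro p hp hne
    refine sum_eq_zero fun q hq => if_neg fun hpq => hne ?_
    simp only [mem_filter, mem_univ, true_and, mem_labelGroup_univ] at hp hq
    ext i
    rw [Equiv.Perm.one_apply]
    have h1 : p i = i := (isTab_filling l).eq_of_eq (mem_univ _) (mem_univ _) (hp i) (by
      have := hq (p i)
      rwa [show q (p i) = i from by
        rw [← Equiv.Perm.mul_apply, (mul_eq_one_iff_eq_inv.1 hpq)]; simp, eq_comm] at this)
    rw [h1]
  · intro h; exact absurd (by simp [one_mem]) h

/-! ### Traces -/

theorem trace_mulRight (x : GroupAlg n) :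
    LinearMap.trace ℂ (GroupAlg n) (LinearMap.mulRight ℂ x) = (n.factorial : ℂ) * x.coeff 1 := by
  rw [LinearMap.trace_eq_matrix_trace ℂ (MonoidAlgebra.basis (Equiv.Perm (Fin n)) ℂ), Matrix.trace]
  have : ∀ g : Equiv.Perm (Fin n), Matrix.diag (LinearMap.toMatrix (MonoidAlgebra.basis _ ℂ)
      (MonoidAlgebra.basis _ ℂ) (LinearMap.mulRight ℂ x)) g = x.coeff 1 := by
    intro g
    rw [Matrix.diag_apply, LinearMap.toMatrix_apply, MonoidAlgebra.basis_apply,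
      LinearMap.mulRight_apply]
    change (MonoidAlgebra.single g 1 * x).coeff g = _
    simp [MonoidAlgebra.coeff_single_mul_apply]
  rw [sum_congr rfl fun g _ => this g, sum_const, card_univ, Fintype.card_perm, Fintype.card_fin,
    nsmul_eq_mul]

theorem mul_self_ne_zero_of_coeff {x : GroupAlg n} (h : x.coeff 1 ≠ 0) : x * x ≠ 0 := by
  intro hx
  have hnil : IsNilpotent (LinearMap.mulRight ℂ x) := ⟨2, by
    ext y; simp [pow_two, mul_assoc, hx]⟩
  have := (LinearMap.isNilpotent_trace_of_isNilpotent hnil).eq_zero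
  rw [trace_mulRight] at this
  exact h ((mul_eq_zero.1 this).resolve_left (Nat.cast_ne_zero.2 n.factorial_ne_zero))

/-- Right multiplication by the symmetrizer has trace n! ≠ 0, hence is not nilpotent. The exact
value of κ is not needed. -/
theorem exists_youngSymmetrizer_mul_self (l : Part n) :
    ∃ κ : ℂ, κ ≠ 0 ∧ youngSymmetrizer l * youngSymmetrizer l = κ • youngSymmetrizer l := by
  obtain ⟨κ, hκ⟩ := exists_youngSymmetrizer_mul_mul l 1
  rw [mul_one] at hκ
  refine ⟨κ, fun h0 => ?_, hκ⟩
  rw [h0, zero_smul] at hκ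
  exact mul_self_ne_zero_of_coeff (by rw [coeff_one_youngSymmetrizer]; exact one_ne_zero) hκ

end YoungSymmetrizers

/-! ### The Young symmetrizers generate the group algebra -/

section Completeness

variable {n : ℕ}

theorem sum_rowLens (Y : YoungDiagram) : Y.rowLens.sum = Y.card := by
  rw [← topCount_eq_card_of_le Y le_rfl, topCount, YoungDiagram.rowLens,
    Finset.sum_range, ← List.sum_ofFn, List.ofFn_eq_map, ← List.map_coe_finRange_eq_range,
    List.map_map]
  rfl

theorem sortedGE_sort (s : Multiset ℕ) : (s.sort (· ≥ ·)).SortedGE :=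
  (s.pairwise_sort (· ≥ ·)).sortedGE

/-- The diagram of a partition. -/
def diagram (p : Nat.Partition n) : Part n :=
  ⟨YoungDiagram.ofRowLens (p.parts.sort (· ≥ ·)) (sortedGE_sort _), by
    rw [← sum_rowLens, YoungDiagram.rowLens_ofRowLens_eq_self fun x hx => p.parts_pos (by simpa using hx),
      ← Multiset.sum_coe, Multiset.sort_eq, p.parts_sum]⟩

theorem diagram_injective : Function.Injective (diagram (n := n)) := by
  intro p q h
  have h1 := congrArg YoungDiagram.rowLens (Subtype.ext_iff.1 h)
  rw [diagram, diagram, YoungDiagram.rowLens_ofRowLens_eq_self fun x hx => p.parts_pos (by simpa using hx),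
    YoungDiagram.rowLens_ofRowLens_eq_self fun x hx => q.parts_pos (by simpa using hx)] at h1
  have h2 := congrArg (fun l : List ℕ => (l : Multiset ℕ)) h1
  simp only [Multiset.sort_eq] at h2
  exact Nat.Partition.ext h2

/-- The sum of the conjugates of a Young symmetrizer. -/
def classSum (l : Part n) : GroupAlg n :=
  ∑ g : Equiv.Perm (Fin n), MonoidAlgebra.single g 1 * youngSymmetrizer l *
    MonoidAlgebra.single g⁻¹ 1

theorem coeff_conj (x : GroupAlg n) (g h : Equiv.Perm (Fin n)) :
    (MonoidAlgebra.single g 1 * x * MonoidAlgebra.single g⁻¹ 1).coeff h = x.coeff (g⁻¹ * h * g) := by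
  rw [MonoidAlgebra.coeff_mul_single_apply, MonoidAlgebra.coeff_single_mul_apply]
  simp [mul_assoc]

theorem coeff_classSum (l : Part n) (h : Equiv.Perm (Fin n)) :
    (classSum l).coeff h = ∑ g : Equiv.Perm (Fin n), (youngSymmetrizer l).coeff (g⁻¹ * h * g) := by
  rw [classSum, MonoidAlgebra.coeff_sum, Finsupp.finsetSum_apply]
  exact sum_congr rfl fun g _ => coeff_conj _ _ _

theorem coeff_classSum_conj (l : Part n) {g h : Equiv.Perm (Fin n)} (hgh : IsConj g h) :
    (classSum l).coeff g = (classSum l).coeff h := by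
  obtain ⟨w, rfl⟩ := isConj_iff.1 hgh
  rw [coeff_classSum, coeff_classSum]
  refine Fintype.sum_equiv (Equiv.mulLeft w) _ _ fun x => ?_
  congr 1
  simp [mul_assoc]

theorem coeff_one_classSum (l : Part n) : (classSum l).coeff 1 ≠ 0 := by
  rw [coeff_classSum]
  have : ∀ g : Equiv.Perm (Fin n), (youngSymmetrizer l).coeff (g⁻¹ * 1 * g) = 1 := fun g => by
    rw [mul_one, inv_mul_cancel, coeff_one_youngSymmetrizer]
  rw [sum_congr rfl fun g _ => this g, sum_const, card_univ, nsmul_eq_mul, mul_one]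
  exact Nat.cast_ne_zero.2 Fintype.card_ne_zero

theorem classSum_mul_classSum {l m : Part n} (h : l ≠ m) : classSum l * classSum m = 0 := by
  rw [classSum, classSum, sum_mul_sum]
  refine sum_eq_zero fun g _ => sum_eq_zero fun k _ => ?_
  have := youngSymmetrizer_mul_mul_eq_zero h
    (MonoidAlgebra.single g⁻¹ 1 * MonoidAlgebra.single k 1)
  calc _ = MonoidAlgebra.single g 1 * (youngSymmetrizer l *
        (MonoidAlgebra.single g⁻¹ 1 * MonoidAlgebra.single k 1) * youngSymmetrizer m) *
          MonoidAlgebra.single k⁻¹ 1 := by simp only [mul_assoc]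
    _ = 0 := by rw [this, mul_zero, zero_mul]

theorem linearIndependent_classSum : LinearIndependent ℂ (classSum (n := n)) := by
  rw [linearIndependent_iff']
  intro s t hs l hl
  have h1 := congrArg (· * classSum l) hs
  simp only [sum_mul, zero_mul, smul_mul_assoc] at h1
  rw [sum_eq_single_of_mem l hl fun m _ hml => by rw [classSum_mul_classSum hml, smul_zero]] at h1
  exact (smul_eq_zero.1 h1).resolve_right (mul_self_ne_zero_of_coeff (coeff_one_classSum l))

/-- The class function with given values on the cycle types. -/
def ofCycleType : ((Fintype.card (Fin n)).Partition → ℂ) →ₗ[ℂ] GroupAlg n where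
  toFun f := ∑ g : Equiv.Perm (Fin n), MonoidAlgebra.single g (f g.partition)
  map_add' f f' := by simp [sum_add_distrib]
  map_smul' c f := by simp [smul_sum, MonoidAlgebra.smul_single]

theorem coeff_ofCycleType (f : (Fintype.card (Fin n)).Partition → ℂ) (g : Equiv.Perm (Fin n)) :
    (ofCycleType f).coeff g = f g.partition := by
  simp [ofCycleType, MonoidAlgebra.coeff_sum, Finsupp.finsetSum_apply, Finsupp.single_apply]

theorem mem_range_ofCycleType {x : GroupAlg n}
    (hx : ∀ g h, IsConj g h → x.coeff g = x.coeff h) : x ∈ LinearMap.range (ofCycleType (n := n)) := by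
  classical
  refine ⟨fun p => if h : ∃ g : Equiv.Perm (Fin n), g.partition = p then x.coeff h.choose else 0, ?_⟩
  refine MonoidAlgebra.coeff_injective (Finsupp.ext fun g => ?_)
  have h : ∃ g' : Equiv.Perm (Fin n), g'.partition = g.partition := ⟨g, rfl⟩
  rw [coeff_ofCycleType, dif_pos h]
  exact hx _ _ (Equiv.Perm.partition_eq_of_isConj.2 h.choose_spec)

/-- The class sums are class functions, linearly independent by orthogonality, and there are as many
as cycle types; so they span all class functions, among them 1. Every nonzero vector of an
𝔖_n-module is therefore detected by a conjugate of a Young symmetrizer. -/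
theorem one_mem_span_classSum :
    (1 : GroupAlg n) ∈ Submodule.span ℂ (Set.range (classSum (n := n))) := by
  set W := LinearMap.range (ofCycleType (n := n)) with hW
  have e : Fintype.card (Fin n) = n := Fintype.card_fin n
  let ι : (Fintype.card (Fin n)).Partition → Part n := fun p => diagram (e ▸ p)
  have hι : Function.Injective ι := by
    intro p q h
    have := diagram_injective h
    revert this
    generalize_proofs
    exact fun h' => by
      have aux : ∀ {a b : ℕ} (hab : a = b) (p q : a.Partition),
        (hab ▸ p : b.Partition) = hab ▸ q → p = q := by
          rintro a _ rfl p q h; exact h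
      exact aux e p q h'
  let f : (Fintype.card (Fin n)).Partition → W := fun p =>
    ⟨classSum (ι p), mem_range_ofCycleType fun g h => coeff_classSum_conj _⟩
  have hf : LinearIndependent ℂ f := by
    have := linearIndependent_classSum.comp ι hι
    exact LinearIndependent.of_comp W.subtype this
  have hcard : Fintype.card (Fintype.card (Fin n)).Partition = Module.finrank ℂ W := by
    refine le_antisymm hf.fintype_card_le_finrank ?_
    refine (LinearMap.finrank_range_le _).trans ?_
    rw [Module.finrank_fintype_fun_eq_card]
  have htop := hf.span_eq_top_of_card_eq_finrank' hcard
  have h1 : (1 : GroupAlg n) ∈ W := mem_range_ofCycleType fun g h hgh => by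
    rw [MonoidAlgebra.one_def, MonoidAlgebra.coeff_single, Finsupp.single_apply,
      Finsupp.single_apply]
    by_cases hg : 1 = g
    · subst hg; rw [isConj_one_right.1 hgh]
    · rw [if_neg hg, if_neg]
      rintro rfl; exact hg (isConj_one_right.1 hgh.symm).symm
  have h2 : (⟨1, h1⟩ : W) ∈ Submodule.span ℂ (Set.range f) := htop ▸ Submodule.mem_top
  have h3 := Submodule.mem_map_of_mem (f := W.subtype) h2
  rw [Submodule.map_span] at h3
  refine Submodule.span_mono ?_ h3
  rintro _ ⟨_, ⟨p, rfl⟩, rfl⟩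
  exact ⟨ι p, rfl⟩

theorem one_mem_span_conj_youngSymmetrizer :
    (1 : GroupAlg n) ∈ Submodule.span ℂ {x | ∃ (l : Part n) (g : Equiv.Perm (Fin n)),
      x = MonoidAlgebra.single g 1 * youngSymmetrizer l * MonoidAlgebra.single g⁻¹ 1} := by
  refine Submodule.span_le.2 ?_ one_mem_span_classSum
  rintro _ ⟨l, rfl⟩
  exact Submodule.sum_mem _ fun g _ => Submodule.subset_span ⟨l, g, rfl⟩

end Completeness

/-! ### Symmetrization of polynomials -/

section Symmetrization

variable {n : ℕ}

/-- The sum over the permutations that preserve the labels `ρ`. -/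
def rowSym (ρ : Fin n → ℕ) (p : Poly n) : Poly n :=
  ∑ σ : Equiv.Perm (Fin n) with σ ∈ labelGroup univ ρ, σ • p

/-- The signed sum over the permutations that preserve the labels `γ`. -/
def colSym (γ : Fin n → ℕ) : Poly n →ₗ[ℂ] Poly n :=
  ∑ q : Equiv.Perm (Fin n) with q ∈ labelGroup univ γ,
    ((Equiv.Perm.sign q : ℤ) : ℂ) • (MvPolynomial.rename (R := ℂ) q).toLinearMap

theorem colSym_apply (γ : Fin n → ℕ) (p : Poly n) :
    colSym γ p = ∑ q : Equiv.Perm (Fin n) with q ∈ labelGroup univ γ,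
      ((Equiv.Perm.sign q : ℤ) : ℂ) • q • p := by
  simp [colSym, LinearMap.sum_apply, perm_smul_def]

theorem coeff_colSym (r γ : Fin n → ℕ) (p : Poly n) :
    MvPolynomial.coeff (expVec univ r) (colSym γ p) = phi univ r γ p := by
  rw [phi_apply, colSym_apply, MvPolynomial.coeff_sum]
  exact sum_congr rfl fun q _ => by rw [MvPolynomial.coeff_smul, smul_eq_mul]

theorem colSym_perm_smul {γ : Fin n → ℕ} {σ : Equiv.Perm (Fin n)} (hσ : σ ∈ labelGroup univ γ)
    (p : Poly n) : colSym γ (σ • p) = ((Equiv.Perm.sign σ : ℤ) : ℂ) • colSym γ p := by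
  rw [colSym_apply, colSym_apply, smul_sum]
  refine sum_bij' (fun q _ => q * σ) (fun q _ => q * σ⁻¹) ?_ ?_ ?_ ?_ ?_
  · intro q hq; simp only [mem_filter, mem_univ, true_and] at hq ⊢; exact mul_mem hq hσ
  · intro q hq; simp only [mem_filter, mem_univ, true_and] at hq ⊢; exact mul_mem hq (inv_mem hσ)
  · intro q _; simp
  · intro q _; simp
  · intro q _
    rw [smul_smul, smul_smul, Equiv.Perm.sign_mul]
    push_cast
    rw [mul_comm ((Equiv.Perm.sign q : ℤ) : ℂ), ← mul_assoc, sign_mul_self, one_mul]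

theorem colSym_monomial_eq_zero {γ : Fin n → ℕ} {e : Fin n →₀ ℕ} (a : ℂ)
    (h : ¬ Function.Injective fun i => (e i, γ i)) :
    colSym γ (MvPolynomial.monomial e a) = 0 := by
  simp only [Function.Injective, not_forall] at h
  obtain ⟨i, k, hik, hne⟩ := h
  have h1 := colSym_perm_smul (swap_mem_labelGroup (mem_univ i) (mem_univ k) (Prod.ext_iff.1 hik).2)
    (MvPolynomial.monomial e a)
  rw [swap_smul_monomial (Prod.ext_iff.1 hik).1, Equiv.Perm.sign_swap hne] at h1
  exact eq_zero_of_eq_neg (by simpa using h1)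

theorem card_lt_le_of_injective {l : Part n} {e : Fin n → ℕ}
    (h : Function.Injective fun i => (e i, colOf l i)) (k : ℕ) :
    #{i | e i < k} ≤ topCount l.1 k :=
  card_lt_le_topCount (Y := l.1) (s := univ) (r := e) (γ := colOf l) (fun _ _ _ _ hab => h hab)
    (fun j => ((isTab_filling l).card_col j).le) k

/-- A monomial that survives antisymmetrization has exponents dominated by `m`. If `m` does not
dominate `l`, these exponents do not fit into `l`. -/
theorem colSym_mem_annIdeal {l m : Part n} (h : ¬ DomLE l m) (p : Poly n) :
    colSym (colOf m) p ∈ annIdeal l.1 univ := by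
  rw [p.as_sum, map_sum]
  refine Submodule.sum_mem _ fun e _ => ?_
  by_cases hinj : Function.Injective fun i => (e i, colOf m i)
  · rw [domLE_iff] at h
    push Not at h
    obtain ⟨k, hk⟩ := h
    have h1 := card_lt_le_of_injective hinj k
    have h2 : (MvPolynomial.monomial e (MvPolynomial.coeff e p) : Poly n) ∈ annIdeal l.1 univ := by
      have := Ideal.mul_mem_left _ (MvPolynomial.C (MvPolynomial.coeff e p))
        (monomial_mem_annIdeal (Y := l.1) (S := univ) (e := e) (k := k) (h1.trans_lt hk))
      rwa [MvPolynomial.C_mul_monomial, mul_one] at this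
    rw [colSym_apply]
    refine Submodule.sum_mem _ fun q _ => ?_
    rw [MvPolynomial.smul_eq_C_mul]
    exact Ideal.mul_mem_left _ _ (perm_smul_mem_annIdeal (fun _ => by simp) h2)
  · rw [colSym_monomial_eq_zero _ hinj]; exact zero_mem _

theorem sum_rowOf (l : Part n) : ∑ i, rowOf l i = nStat l := by
  rw [nStat, ← sum_fiberwise_of_maps_to (s := univ) (t := range n) (g := rowOf l)]
  · refine sum_congr rfl fun i _ => ?_
    rw [sum_congr rfl fun x hx => (mem_filter.1 hx).2, sum_const, smul_eq_mul, mul_comm,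
      YoungDiagram.rowLen_eq_card]
    congr 1
    exact (isTab_filling l).card_filter fun x => x.1 = i
  · intro i _
    have h1 := (isTab_filling l).mem (mem_univ i)
    have h2 := colLen_le_card l.1 (colOf l i)
    rw [YoungDiagram.mem_iff_lt_colLen] at h1
    rw [l.2] at h2
    exact mem_range.2 (by omega)

theorem nStat_le_sum {l : Part n} {e : Fin n → ℕ}
    (h : Function.Injective fun i => (e i, colOf l i)) : nStat l ≤ ∑ i, e i := by
  rw [← sum_rowOf]
  exact sum_le_sum_of_card_lt_le univ univ e (rowOf l) rfl fun k =>
    (card_lt_le_of_injective h k).trans (labelCount_rowOf l k).ge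

theorem colSym_monomial_eq_zero_of_degree {l : Part n} {e : Fin n →₀ ℕ} (a : ℂ)
    (h : ∑ i, e i < nStat l) : colSym (colOf l) (MvPolynomial.monomial e a) = 0 :=
  colSym_monomial_eq_zero a fun hinj => absurd (nStat_le_sum hinj) (not_le.2 h)

/-- Equality of the degrees forces equality in each of the threshold inequalities behind
`nStat_le_sum`. -/
theorem isTab_of_sum_eq {l : Part n} {e : Fin n → ℕ}
    (h : Function.Injective fun i => (e i, colOf l i)) (hs : ∑ i, e i = nStat l) :
    IsTab l.1 univ e (colOf l) := by
  refine isTab_of_injOn (fun _ _ _ _ hab => h hab) (fun j => (isTab_filling l).card_col j) ?_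
  have hle := card_lt_le_of_injective h
  obtain ⟨M, h1, h2⟩ : ∃ M, (∀ x ∈ univ, e x ≤ M) ∧ ∀ x ∈ univ, rowOf l x ≤ M :=
    ⟨max (univ.sup e) (univ.sup (rowOf l)), fun x hx => le_max_of_le_left (le_sup hx),
      fun x hx => le_max_of_le_right (le_sup hx)⟩
  have e1 := sum_eq_sum_card_lt univ e h1
  have e2 := sum_eq_sum_card_lt univ (rowOf l) h2
  rw [sum_rowOf] at e2
  rw [hs] at e1
  have hrow : ∀ k, #{i | rowOf l i < k} = topCount l.1 k := fun k => labelCount_rowOf l k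
  have e3 : ∑ k ∈ range M, #{x | e x < k + 1} = ∑ k ∈ range M, topCount l.1 (k + 1) := by
    rw [← sum_congr rfl fun k _ => hrow (k + 1)]; omega
  have e4 := (sum_eq_sum_iff_of_le fun k _ => hle (k + 1)).1 e3
  intro k
  rcases Nat.eq_zero_or_pos k with rfl | hk
  · simp [topCount]
  · by_cases hkM : k ≤ M
    · have := e4 (k - 1) (mem_range.2 (by omega))
      rwa [Nat.sub_add_cancel hk] at this
    · rw [← hrow k, filter_true_of_mem fun x hx => (h1 x hx).trans_lt (not_le.1 hkM),
        filter_true_of_mem fun x hx => (h2 x hx).trans_lt (not_le.1 hkM)]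

/-- In degree n(λ) the column-antisymmetric polynomials form a line, spanned by the product of the
Vandermonde determinants of the columns. -/
theorem exists_colSym_monomial {l : Part n} {e : Fin n →₀ ℕ} (hs : ∑ i, e i = nStat l) :
    ∃ t : ℂ, colSym (colOf l) (MvPolynomial.monomial e 1) =
      t • colSym (colOf l) (MvPolynomial.monomial (expVec univ (rowOf l)) 1) := by
  by_cases h : Function.Injective fun i => (e i, colOf l i)
  · obtain ⟨w, hw1, hw2⟩ := (isTab_filling l).exists_perm (isTab_of_sum_eq h hs)
    have hw : w ∈ labelGroup univ (colOf l) := mem_labelGroup_univ.2 hw2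
    refine ⟨((Equiv.Perm.sign w⁻¹ : ℤ) : ℂ), ?_⟩
    rw [← colSym_perm_smul (inv_mem hw), perm_smul_monomial]
    congr 3
    refine DFunLike.ext _ _ fun x => ?_
    obtain ⟨x, rfl⟩ := (w⁻¹).surjective x
    rw [mapDomain_perm_apply, expVec_apply, if_pos (mem_univ _), ← hw1]
    simp
  · exact ⟨0, by rw [colSym_monomial_eq_zero _ h, zero_smul]⟩

theorem phi_rowOf_self (l : Part n) :
    phi univ (rowOf l) (colOf l) (MvPolynomial.monomial (expVec univ (rowOf l)) 1) = 1 := by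
  rw [phi_apply, sum_eq_single 1]
  · simp
  · intro q hq hne
    rw [perm_smul_monomial, MvPolynomial.coeff_monomial, if_neg, mul_zero]
    intro h
    refine hne (Equiv.ext fun i => ?_)
    have h1 : rowOf l (q i) = rowOf l i := by
      have := DFunLike.congr_fun h (q i)
      rw [mapDomain_perm_apply, expVec_apply, expVec_apply, if_pos (mem_univ _),
        if_pos (mem_univ _)] at this
      exact this.symm
    have h2 : colOf l (q i) = colOf l i := mem_labelGroup_univ.1 (mem_filter.1 hq).2 i
    exact (isTab_filling l).eq_of_eq (mem_univ _) (mem_univ _) h1 h2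
  · intro h; exact absurd (by simp [one_mem]) h

theorem rowSym_monomial_rowOf (l : Part n) :
    rowSym (rowOf l) (MvPolynomial.monomial (expVec univ (rowOf l)) 1) =
      (#{σ : Equiv.Perm (Fin n) | σ ∈ labelGroup univ (rowOf l)} : ℂ) •
        MvPolynomial.monomial (expVec univ (rowOf l)) 1 := by
  rw [rowSym, sum_congr rfl (g := fun _ => MvPolynomial.monomial (expVec univ (rowOf l)) (1 : ℂ)),
    sum_const, Nat.cast_smul_eq_nsmul]
  intro σ hσ
  rw [perm_smul_monomial]
  congr 2
  refine DFunLike.ext _ _ fun x => ?_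
  obtain ⟨x, rfl⟩ := σ.surjective x
  rw [mapDomain_perm_apply, expVec_apply, expVec_apply, if_pos (mem_univ _), if_pos (mem_univ _)]
  exact (mem_labelGroup_univ.1 (mem_filter.1 hσ).2 x).symm

theorem phi_colSym (r γ : Fin n → ℕ) (p : Poly n) :
    phi univ r γ (colSym γ p) =
      (#{σ : Equiv.Perm (Fin n) | σ ∈ labelGroup univ γ} : ℂ) * phi univ r γ p := by
  rw [colSym_apply, map_sum, sum_congr rfl (g := fun _ => phi univ r γ p), sum_const, nsmul_eq_mul]
  intro q hq
  rw [map_smul, phi_perm_smul (mem_filter.1 hq).2, smul_eq_mul, ← mul_assoc, sign_mul_self, one_mul]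

theorem phi_symmetrized_ne_zero (l : Part n) :
    phi univ (rowOf l) (colOf l) (colSym (colOf l)
      (rowSym (rowOf l) (MvPolynomial.monomial (expVec univ (rowOf l)) 1))) ≠ 0 := by
  rw [rowSym_monomial_rowOf, map_smul, map_smul, phi_colSym, phi_rowOf_self, mul_one, smul_eq_mul]
  refine mul_ne_zero ?_ ?_ <;>
    exact Nat.cast_ne_zero.2 (card_pos.2 ⟨1, by simp [one_mem]⟩).ne'

theorem isHomogeneous_perm_smul {f : Poly n} {d : ℕ} (hf : f.IsHomogeneous d)
    (w : Equiv.Perm (Fin n)) : (w • f).IsHomogeneous d := hf.rename_isHomogeneous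

theorem isHomogeneous_colSym {f : Poly n} {d : ℕ} (hf : f.IsHomogeneous d) (γ : Fin n → ℕ) :
    (colSym γ f).IsHomogeneous d := by
  rw [colSym_apply]
  refine MvPolynomial.IsHomogeneous.sum _ _ _ fun q _ => ?_
  exact (MvPolynomial.homogeneousSubmodule (Fin n) ℂ d).smul_mem _ (isHomogeneous_perm_smul hf q)

theorem isHomogeneous_rowSym {f : Poly n} {d : ℕ} (hf : f.IsHomogeneous d) (ρ : Fin n → ℕ) :
    (rowSym ρ f).IsHomogeneous d :=
  MvPolynomial.IsHomogeneous.sum _ _ _ fun q _ => isHomogeneous_perm_smul hf q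

theorem phi_eq_zero_of_isHomogeneous {l : Part n} {f : Poly n} {d : ℕ} (hf : f.IsHomogeneous d)
    (hd : d ≠ nStat l) : phi univ (rowOf l) (colOf l) f = 0 := by
  rw [← coeff_colSym]
  refine (isHomogeneous_colSym hf _).coeff_eq_zero fun h => hd ?_
  rw [← h, ← sum_rowOf, Finsupp.degree_eq_sum]
  exact sum_congr rfl fun i _ => by rw [expVec_apply, if_pos (mem_univ _)]

theorem colSym_eq_zero_of_isHomogeneous {l : Part n} {f : Poly n} {d : ℕ} (hf : f.IsHomogeneous d)
    (hd : d < nStat l) : colSym (colOf l) f = 0 := by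
  rw [f.as_sum, map_sum]
  refine sum_eq_zero fun e he => colSym_monomial_eq_zero_of_degree _ ?_
  have : e.degree = d := by
    by_contra h
    exact MvPolynomial.mem_support_iff.1 he (hf.coeff_eq_zero h)
  rw [Finsupp.degree_eq_sum] at this
  omega

/-! ### The Garsia–Procesi module -/

theorem tanisakiIdeal_eq (l : Part n) : tanisakiIdeal l = annIdeal l.1 univ := by
  have hd : ∀ r, dStat l r = lastCols l.1 #(univ : Finset (Fin n)) r := fun r => by
    rw [card_univ, Fintype.card_fin]; rfl
  rw [annIdeal_eq_tanIdeal n l.1 univ (by simp) l.2]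
  refine le_antisymm (Ideal.span_mono ?_) (Ideal.span_mono ?_)
  · rintro _ ⟨I, t, h1, h2, h3, rfl⟩
    exact Or.inr ⟨I, subset_univ I, t, h1, h2, by rwa [← hd], rfl⟩
  · rintro _ (⟨i, hi, -⟩ | ⟨I, -, t, h1, h2, h3, rfl⟩)
    · exact absurd (mem_univ i) hi
    · exact ⟨I, t, h1, h2, by rwa [hd], rfl⟩

/-- The class of a polynomial in `R l`. -/
def mkR (l : Part n) : Poly n →ₗ[A n] R l := (tanisakiSubmodule l).mkQ

theorem mkR_surjective (l : Part n) : Function.Surjective (mkR l) := Submodule.mkQ_surjective _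

theorem mkR_eq_zero_iff {l : Part n} {p : Poly n} : mkR l p = 0 ↔ p ∈ annIdeal l.1 univ := by
  rw [← tanisakiIdeal_eq]
  exact Submodule.Quotient.mk_eq_zero _

/-- The functional on `R l` induced by a functional on polynomials. -/
def descend (l : Part n) (L : Poly n →ₗ[ℂ] ℂ) (h : ∀ p ∈ annIdeal l.1 univ, L p = 0) :
    Module.Dual ℂ (R l) :=
  ((tanisakiSubmodule l).restrictScalars ℂ).liftQ L (fun p hp => h p (by
    rw [← tanisakiIdeal_eq]; exact hp)) ∘ₗ
    (Submodule.Quotient.restrictScalarsEquiv ℂ (tanisakiSubmodule l)).symm.toLinearMap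

theorem phi_eq_zero_of_mem {l : Part n} {r c : Fin n → ℕ} (hT : IsTab l.1 univ r c) (p : Poly n)
    (hp : p ∈ annIdeal l.1 univ) : phi univ r c p = 0 := by
  have := hp r c hT 1; rwa [one_mul] at this

/-- The functional on `R l` attached to a tableau. -/
def tabFunctional {l : Part n} {r c : Fin n → ℕ} (hT : IsTab l.1 univ r c) : Module.Dual ℂ (R l) :=
  descend l (phi univ r c) (phi_eq_zero_of_mem hT)

theorem tabFunctional_mkR {l : Part n} {r c : Fin n → ℕ} (hT : IsTab l.1 univ r c) (p : Poly n) :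
    tabFunctional hT (mkR l p) = phi univ r c p := rfl

instance finiteDimensional_R (l : Part n) : FiniteDimensional ℂ (R l) := by
  let f : (Fin n → Fin n) → R l := fun e =>
    mkR l (MvPolynomial.monomial (expVec univ fun i => (e i : ℕ)) 1)
  suffices h : Submodule.span ℂ (Set.range f) = ⊤ from
    ⟨⟨(Set.finite_range f).toFinset, by rw [Set.Finite.coe_toFinset, h]⟩⟩
  rw [eq_top_iff]
  rintro x -
  obtain ⟨p, rfl⟩ := mkR_surjective l x
  rw [p.as_sum, map_sum]
  refine Submodule.sum_mem _ fun e _ => ?_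
  have h1 : (MvPolynomial.monomial e (MvPolynomial.coeff e p) : Poly n) =
      MvPolynomial.coeff e p • MvPolynomial.monomial e 1 := by
    rw [MvPolynomial.smul_monomial, smul_eq_mul, mul_one]
  rw [h1, LinearMap.map_smul_of_tower]
  refine Submodule.smul_mem _ _ ?_
  by_cases he : ∀ i, e i < n
  · refine Submodule.subset_span ⟨fun i => ⟨e i, he i⟩, ?_⟩
    change mkR l (MvPolynomial.monomial _ 1) = _
    have h2 : (expVec univ fun i => e i) = e := by ext i; simp [expVec_apply]
    rw [h2]
  · push Not at he
    obtain ⟨i, hi⟩ := he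
    have h2 : mkR l (MvPolynomial.monomial e 1) = 0 := by
      rw [mkR_eq_zero_iff]
      have h3 := Ideal.mul_mem_left _ (MvPolynomial.monomial (e - Finsupp.single i n) 1)
        (X_pow_mem_annIdeal (Y := l.1) (S := univ) (by simp [l.2]) (mem_univ i)
          ((colLen_le_card l.1 0).trans l.2.le))
      rwa [MvPolynomial.X_pow_eq_monomial, MvPolynomial.monomial_mul, one_mul,
        tsub_add_cancel_of_le (Finsupp.single_le_iff.2 hi)] at h3
    rw [h2]; exact zero_mem _

end Symmetrization

/-! ### The algebra `A n` -/

section Algebra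

variable {n : ℕ}

theorem groupIncl_single (w : Equiv.Perm (Fin n)) (a : ℂ) :
    groupIncl n (MonoidAlgebra.single w a) = elt w (MvPolynomial.C a) := by
  rw [groupIncl, MonoidAlgebra.lift_single]
  change a • elt w 1 = _
  rw [smul_elt, MvPolynomial.smul_eq_C_mul, mul_one]

theorem groupIncl_single_one (w : Equiv.Perm (Fin n)) :
    groupIncl n (MonoidAlgebra.single w 1) = elt w 1 := by
  rw [groupIncl_single, MvPolynomial.C_1]

theorem elt_eq_mul (w : Equiv.Perm (Fin n)) (f : Poly n) : elt w f = elt 1 f * elt w 1 := by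
  rw [elt_mul_elt, one_mul, one_smul, mul_one]

theorem elt_one_mul_elt_one (f g : Poly n) : elt 1 f * elt 1 g = elt 1 (f * g) := by
  rw [elt_mul_elt, one_mul, one_smul]

theorem elt_mul_elt_one (w : Equiv.Perm (Fin n)) (f : Poly n) :
    elt w 1 * elt 1 f = elt 1 (w • f) * elt w 1 := by
  rw [elt_mul_elt, elt_mul_elt, mul_one, one_mul, one_mul, smul_one, mul_one]

theorem elt_sum {ι : Type*} (w : Equiv.Perm (Fin n)) (s : Finset ι) (f : ι → Poly n) :
    elt w (∑ i ∈ s, f i) = ∑ i ∈ s, elt w (f i) :=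
  map_sum (AddMonoidHom.mk' (elt w) (elt_add w)) f s

theorem elt_monomial_induction {p : A n → Prop} (a : A n) (zero : p 0)
    (monomial : ∀ w e c, p (elt w (MvPolynomial.monomial e c)))
    (add : ∀ a b, p a → p b → p (a + b)) : p a := by
  induction a using elt_induction with
  | zero => exact zero
  | elt w f =>
    rw [f.as_sum, elt_sum]
    exact sum_induction _ p add zero fun e _ => monomial w e _
  | add a b ha hb => exact add a b ha hb

theorem antiInv_elt (w : Equiv.Perm (Fin n)) (f : Poly n) :
    (antiInv n (elt w f)).unop = elt w⁻¹ 1 * elt 1 f := by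
  rw [antiInv, algLift_elt]; rfl

theorem elt_smul_dual {l : Part n} (w : Equiv.Perm (Fin n)) (f : Poly n) (ψ : Module.Dual ℂ (R l))
    (p : Poly n) : (elt w f • ψ) (mkR l p) = ψ (mkR l (w⁻¹ • (f * p))) := by
  change ψ ((antiInv n (elt w f)).unop • mkR l p) = _
  rw [antiInv_elt, ← map_smul, mul_smul, elt_smul_poly, elt_smul_poly, one_mul, one_smul]

theorem mkR_smul (l : Part n) (c : ℂ) (p : Poly n) : mkR l (c • p) = c • mkR l p :=
  LinearMap.map_smul_of_tower _ _ _

theorem groupIncl_rowSum (ρ : Fin n → ℕ) : groupIncl n (rowSum ρ) =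
    ∑ σ : Equiv.Perm (Fin n) with σ ∈ labelGroup univ ρ, elt σ 1 := by
  rw [rowSum, map_sum]
  exact sum_congr rfl fun σ _ => groupIncl_single_one σ

theorem groupIncl_colSum (γ : Fin n → ℕ) : groupIncl n (colSum γ) =
    ∑ σ : Equiv.Perm (Fin n) with σ ∈ labelGroup univ γ,
      ((Equiv.Perm.sign σ : ℤ) : ℂ) • elt σ 1 := by
  rw [colSum, map_sum]
  refine sum_congr rfl fun σ _ => ?_
  rw [groupIncl_single, smul_elt, MvPolynomial.smul_eq_C_mul, mul_one]

instance (l : Part n) : IsScalarTower ℂ (A n) (Module.Dual ℂ (R l)) where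
  smul_assoc c a ψ := by
    refine LinearMap.ext fun x => ?_
    obtain ⟨p, rfl⟩ := mkR_surjective l x
    rw [LinearMap.smul_apply]
    induction a using elt_induction with
    | zero => rw [smul_zero, zero_smul]; simp
    | elt w f =>
      rw [smul_elt, elt_smul_dual, elt_smul_dual, smul_mul_assoc, smul_comm w⁻¹ c,
        LinearMap.map_smul_of_tower, map_smul]
    | add a b ha hb => rw [smul_add, add_smul, add_smul, LinearMap.add_apply, LinearMap.add_apply,
        smul_add, ha, hb]

theorem dual_ext {l : Part n} {ψ χ : Module.Dual ℂ (R l)}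
    (h : ∀ p, ψ (mkR l p) = χ (mkR l p)) : ψ = χ :=
  LinearMap.ext fun x => by obtain ⟨p, rfl⟩ := mkR_surjective l x; exact h p

theorem rowSum_smul_dual {l : Part n} (ρ : Fin n → ℕ) (ψ : Module.Dual ℂ (R l)) (p : Poly n) :
    (groupIncl n (rowSum ρ) • ψ) (mkR l p) = ψ (mkR l (rowSym ρ p)) := by
  rw [groupIncl_rowSum, sum_smul, LinearMap.sum_apply, rowSym, map_sum, map_sum]
  refine sum_bij' (fun σ _ => σ⁻¹) (fun σ _ => σ⁻¹) ?_ ?_ ?_ ?_ ?_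
  · intro q hq; simp only [mem_filter, mem_univ, true_and] at hq ⊢; exact inv_mem hq
  · intro q hq; simp only [mem_filter, mem_univ, true_and] at hq ⊢; exact inv_mem hq
  · intro q _; simp
  · intro q _; simp
  · intro q _; rw [elt_smul_dual, one_mul]

theorem colSum_smul_dual {l : Part n} (γ : Fin n → ℕ) (ψ : Module.Dual ℂ (R l)) (p : Poly n) :
    (groupIncl n (colSum γ) • ψ) (mkR l p) = ψ (mkR l (colSym γ p)) := by
  rw [groupIncl_colSum, sum_smul, LinearMap.sum_apply, colSym_apply, map_sum, map_sum]
  refine sum_bij' (fun σ _ => σ⁻¹) (fun σ _ => σ⁻¹) ?_ ?_ ?_ ?_ ?_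
  · intro q hq; simp only [mem_filter, mem_univ, true_and] at hq ⊢; exact inv_mem hq
  · intro q hq; simp only [mem_filter, mem_univ, true_and] at hq ⊢; exact inv_mem hq
  · intro q _; simp
  · intro q _; simp
  · intro q _
    rw [smul_assoc, LinearMap.smul_apply, elt_smul_dual, one_mul, Equiv.Perm.sign_inv,
      mkR_smul, LinearMap.map_smul ψ]

/-- The image of the Young symmetrizer in `A n`. -/
def youngElt (l : Part n) : A n := groupIncl n (youngSymmetrizer l)

theorem youngElt_smul_dual {l : Part n} (m : Part n) (ψ : Module.Dual ℂ (R l)) (p : Poly n) :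
    (youngElt m • ψ) (mkR l p) = ψ (mkR l (colSym (colOf m) (rowSym (rowOf m) p))) := by
  rw [youngElt, youngSymmetrizer_eq, map_mul, mul_smul, rowSum_smul_dual, colSum_smul_dual]

theorem youngElt_smul_dual_eq_zero {l m : Part n} (h : ¬ DomLE l m) (ψ : Module.Dual ℂ (R l)) :
    youngElt m • ψ = 0 :=
  dual_ext fun p => by
    rw [youngElt_smul_dual, mkR_eq_zero_iff.2 (colSym_mem_annIdeal h _), map_zero]; rfl

theorem exists_youngElt_mul_self (l : Part n) :
    ∃ κ : ℂ, κ ≠ 0 ∧ youngElt l * youngElt l = κ • youngElt l := by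
  obtain ⟨κ, hκ, h⟩ := exists_youngSymmetrizer_mul_self l
  exact ⟨κ, hκ, by rw [youngElt, ← map_mul, h, map_smul]⟩

/-! ### Generation of the dual of the Garsia–Procesi module -/

variable (l : Part n)

/-- The functional attached to the standard filling. -/
def stdFunctional : Module.Dual ℂ (R l) := tabFunctional (isTab_filling l)

theorem stdFunctional_mkR (p : Poly n) :
    stdFunctional l (mkR l p) = phi univ (rowOf l) (colOf l) p := rfl

/-- The generator of the dual of the Garsia–Procesi module. -/
def topFunctional : Module.Dual ℂ (R l) := youngElt l • stdFunctional l

theorem topFunctional_mkR (p : Poly n) : topFunctional l (mkR l p) =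
    phi univ (rowOf l) (colOf l) (colSym (colOf l) (rowSym (rowOf l) p)) := by
  rw [topFunctional, youngElt_smul_dual, stdFunctional_mkR]

theorem topFunctional_ne_zero : topFunctional l ≠ 0 := fun h => by
  have := topFunctional_mkR l (MvPolynomial.monomial (expVec univ (rowOf l)) 1)
  rw [h] at this
  exact phi_symmetrized_ne_zero l this.symm

theorem topFunctional_eq_zero_of_isHomogeneous {f : Poly n} {d : ℕ} (hf : f.IsHomogeneous d)
    (hd : d ≠ nStat l) : topFunctional l (mkR l f) = 0 := by
  rw [topFunctional_mkR]
  exact phi_eq_zero_of_isHomogeneous (isHomogeneous_colSym (isHomogeneous_rowSym hf _) _) hd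

/-- The left side depends on a polynomial only through its antisymmetrization in degree n(λ), which
runs over a line. This is how the standard functional is recovered from `topFunctional`. -/
theorem exists_colSum_smul_topFunctional : ∃ t : ℂ, t ≠ 0 ∧
    groupIncl n (colSum (colOf l)) • topFunctional l = t • stdFunctional l := by
  set m : Poly n := MvPolynomial.monomial (expVec univ (rowOf l)) 1 with hm
  set t := topFunctional l (mkR l (colSym (colOf l) m)) with ht
  have key : groupIncl n (colSum (colOf l)) • topFunctional l = t • stdFunctional l := by
    refine dual_ext fun p => ?_
    rw [colSum_smul_dual, LinearMap.smul_apply, smul_eq_mul, stdFunctional_mkR]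
    let L : Poly n →ₗ[ℂ] ℂ := topFunctional l ∘ₗ (mkR l).restrictScalars ℂ ∘ₗ colSym (colOf l) -
      t • phi univ (rowOf l) (colOf l)
    have hL : ∀ e, L (MvPolynomial.monomial e 1) = 0 := by
      intro e
      change topFunctional l (mkR l (colSym (colOf l) (MvPolynomial.monomial e 1))) -
        t * phi univ (rowOf l) (colOf l) (MvPolynomial.monomial e 1) = 0
      by_cases he : ∑ i, e i = nStat l
      · obtain ⟨s, hs⟩ := exists_colSym_monomial he
        rw [← coeff_colSym, hs, LinearMap.map_smul_of_tower, map_smul, MvPolynomial.coeff_smul,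
          coeff_colSym, phi_rowOf_self, ← hm, ← ht, smul_eq_mul, smul_eq_mul]
        ring
      · have hhom : (MvPolynomial.monomial e (1 : ℂ)).IsHomogeneous (∑ i, e i) :=
          MvPolynomial.isHomogeneous_monomial _ (Finsupp.degree_eq_sum e)
        rw [topFunctional_eq_zero_of_isHomogeneous l (isHomogeneous_colSym hhom _) he,
          phi_eq_zero_of_isHomogeneous hhom he, mul_zero, sub_zero]
    exact sub_eq_zero.1 (linear_eq_zero_of_monomial L hL p)
  -- If `t` were zero, the Young symmetrizer would kill `topFunctional`, on which it acts by κ ≠ 0.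
  refine ⟨t, fun h0 => ?_, key⟩
  obtain ⟨κ, hκ, hκ'⟩ := exists_youngElt_mul_self l
  have h1 : youngElt l • topFunctional l = κ • topFunctional l := by
    rw [topFunctional, smul_smul, hκ', smul_assoc]
  rw [youngElt, youngSymmetrizer_eq, map_mul, mul_smul, key, h0, zero_smul, smul_zero] at h1
  exact topFunctional_ne_zero l ((smul_eq_zero.1 h1.symm).resolve_left hκ)

variable {l}

theorem smul_mem_of_tower (N : Submodule (A n) (Module.Dual ℂ (R l))) (t : ℂ)
    {ψ : Module.Dual ℂ (R l)} (h : ψ ∈ N) : t • ψ ∈ N := by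
  have := N.smul_mem (t • (1 : A n)) h
  rwa [smul_assoc, one_smul] at this

/-- The dual of the Garsia–Procesi module is generated by `topFunctional l`. -/
theorem eq_top_of_topFunctional_mem {N : Submodule (A n) (Module.Dual ℂ (R l))}
    (h : topFunctional l ∈ N) : N = ⊤ := by
  obtain ⟨t, ht, hts⟩ := exists_colSum_smul_topFunctional l
  have h1 : stdFunctional l ∈ N := by
    have := smul_mem_of_tower N t⁻¹ (hts ▸ N.smul_mem (groupIncl n (colSum (colOf l))) h)
    rwa [smul_smul, inv_mul_cancel₀ ht, one_smul] at this
  have h2 : ∀ r c (hT : IsTab l.1 univ r c), tabFunctional hT ∈ N := by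
    intro r c hT
    obtain ⟨w, hw1, hw2⟩ := (isTab_filling l).exists_perm hT
    have : tabFunctional hT = elt w⁻¹ 1 • stdFunctional l := by
      refine dual_ext fun p => ?_
      rw [elt_smul_dual, one_mul, inv_inv, stdFunctional_mkR, phi_conj w (by simp),
        tabFunctional_mkR]
      congr 2 <;> ext i
      · exact (hw1 i).symm
      · exact (hw2 i).symm
    rw [this]; exact N.smul_mem _ h1
  let N' : Submodule ℂ (Module.Dual ℂ (R l)) :=
    { N with smul_mem' := fun t ψ hψ => smul_mem_of_tower N t hψ }
  -- A class killed by all polynomial multiples of all tableau functionals lies in the annihilator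
  -- ideal, hence is zero in `R l`.
  have h3 : N'.dualCoannihilator = ⊥ := by
    rw [eq_bot_iff]
    intro x hx
    obtain ⟨p, rfl⟩ := mkR_surjective l x
    rw [Submodule.mem_bot, mkR_eq_zero_iff]
    intro r c hT q
    have h4 := (Submodule.mem_dualCoannihilator _ ).1 hx (elt 1 q • tabFunctional hT)
      (N.smul_mem _ (h2 r c hT))
    rwa [elt_smul_dual, inv_one, one_smul, tabFunctional_mkR] at h4
  have h5 : N' = ⊤ := by
    rw [← Subspace.dualCoannihilator_dualAnnihilator_eq (W := N'), h3,
      Submodule.dualAnnihilator_bot]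
  rw [eq_top_iff]
  rintro ψ -
  have : ψ ∈ N' := h5 ▸ Submodule.mem_top
  exact this

end Algebra

/-! ### Gradings -/

section Gradings

variable {n : ℕ}

theorem coeffAt_elt (w v : Equiv.Perm (Fin n)) (f : Poly n) :
    coeffAt w (elt v f) = if v = w then f else 0 := by
  classical
  rw [coeffAt, elt, SkewMonoidAlgebra.coeff_single, Finsupp.single_apply]

theorem coeffAt_add (w : Equiv.Perm (Fin n)) (a b : A n) :
    coeffAt w (a + b) = coeffAt w a + coeffAt w b :=
  DFunLike.congr_fun (SkewMonoidAlgebra.coeff_add a b) w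

theorem sum_elt_coeffAt (a : A n) : ∑ w, elt w (coeffAt w a) = a := by
  induction a using elt_induction with
  | zero => exact sum_eq_zero fun w _ => elt_zero w
  | elt v f =>
    rw [sum_eq_single v]
    · rw [coeffAt_elt, if_pos rfl]
    · intro w _ hw; rw [coeffAt_elt, if_neg hw.symm, elt_zero]
    · intro h; exact absurd (mem_univ _) h
  | add a b ha hb =>
    simp only [coeffAt_add, elt_add, sum_add_distrib]
    rw [ha, hb]

theorem mem_polyGrading_natCast {d : ℕ} {f : Poly n} :
    f ∈ polyGrading n (d : ℤ) ↔ f.IsHomogeneous d := by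
  rw [polyGrading, if_pos (Int.natCast_nonneg d), Int.toNat_natCast]; rfl

theorem eq_zero_or_isHomogeneous {i : ℤ} {f : Poly n} (hf : f ∈ polyGrading n i) :
    f = 0 ∨ ∃ d : ℕ, i = d ∧ f.IsHomogeneous d := by
  by_cases hi : 0 ≤ i
  · obtain ⟨d, rfl⟩ := Int.eq_ofNat_of_zero_le hi
    exact Or.inr ⟨d, rfl, mem_polyGrading_natCast.1 hf⟩
  · rw [polyGrading, if_neg hi] at hf
    exact Or.inl hf

theorem mul_mem_polyGrading {i j : ℤ} {f g : Poly n} (hf : f ∈ polyGrading n i)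
    (hg : g ∈ polyGrading n j) (w : Equiv.Perm (Fin n)) :
    f * (w • g) ∈ polyGrading n (i + j) := by
  rcases eq_zero_or_isHomogeneous hf with rfl | ⟨d, rfl, hf⟩
  · rw [zero_mul]; exact zero_mem _
  rcases eq_zero_or_isHomogeneous hg with rfl | ⟨d', rfl, hg⟩
  · rw [smul_zero, mul_zero]; exact zero_mem _
  rw [← Nat.cast_add, mem_polyGrading_natCast]
  exact hf.mul (isHomogeneous_perm_smul hg w)

theorem elt_mem_algGrading {i : ℤ} {f : Poly n} (hf : f ∈ polyGrading n i)
    (w : Equiv.Perm (Fin n)) : elt w f ∈ algGrading n i := by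
  intro v
  rw [coeffAt_elt]
  split_ifs
  · exact hf
  · exact zero_mem _

theorem mul_mem_algGrading {i j : ℤ} {a b : A n} (ha : a ∈ algGrading n i)
    (hb : b ∈ algGrading n j) : a * b ∈ algGrading n (i + j) := by
  rw [← sum_elt_coeffAt a, ← sum_elt_coeffAt b, sum_mul_sum]
  refine Submodule.sum_mem _ fun w _ => Submodule.sum_mem _ fun v _ => ?_
  rw [elt_mul_elt]
  exact elt_mem_algGrading (mul_mem_polyGrading (ha w) (hb v) w) _

theorem groupIncl_mem_algGrading (x : GroupAlg n) : groupIncl n x ∈ algGrading n 0 := by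
  induction x using MonoidAlgebra.induction_on with
  | of g =>
    rw [MonoidAlgebra.of_apply, groupIncl_single_one]
    exact elt_mem_algGrading (by
      rw [← Nat.cast_zero, mem_polyGrading_natCast]; exact MvPolynomial.isHomogeneous_one _ _) _
  | add a b ha hb => rw [map_add]; exact add_mem ha hb
  | smul c a ha => rw [map_smul]; exact Submodule.smul_mem _ _ ha

theorem monomial_mem_polyGrading (e : Fin n →₀ ℕ) (c : ℂ) :
    MvPolynomial.monomial e c ∈ polyGrading n (e.degree : ℤ) :=
  mem_polyGrading_natCast.2 (MvPolynomial.isHomogeneous_monomial _ rfl)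

end Gradings

/-! ### The modules `P l`, `KTilde l` and `K l` -/

section Kostka

variable {n : ℕ}

theorem youngSymmetrizer_ne_zero (l : Part n) : youngSymmetrizer l ≠ 0 := fun h => by
  have := coeff_one_youngSymmetrizer l
  rw [h] at this
  simp at this

theorem finrank_specht_ne_zero (l : Part n) : Module.finrank ℂ (specht l) ≠ 0 := by
  have hmem : youngSymmetrizer l ∈ specht l := Submodule.mem_span_singleton_self _
  have : Nontrivial (specht l) :=
    ⟨⟨⟨_, hmem⟩, 0, fun h => youngSymmetrizer_ne_zero l (Subtype.ext_iff.1 h)⟩⟩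
  have : FiniteDimensional ℂ (specht l) :=
    FiniteDimensional.of_injective ((specht l).subtype.restrictScalars ℂ)
      (Submodule.injective_subtype _)
  exact Module.finrank_pos.ne'

theorem P_eq (l : Part n) : P l = Submodule.span (A n) {youngElt l} := by
  have hs : (Module.finrank ℂ (specht l) : ℂ) / (n.factorial : ℂ) ≠ 0 :=
    div_ne_zero (Nat.cast_ne_zero.2 (finrank_specht_ne_zero l))
      (Nat.cast_ne_zero.2 n.factorial_ne_zero)
  rw [P, youngIdempotent, map_smul]
  set s := (Module.finrank ℂ (specht l) : ℂ) / (n.factorial : ℂ)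
  refine le_antisymm ?_ ?_ <;> rw [Submodule.span_singleton_le_iff_mem, Submodule.mem_span_singleton]
  · exact ⟨s • 1, by rw [smul_assoc, one_smul]; rfl⟩
  · exact ⟨s⁻¹ • 1, by
      rw [smul_assoc, one_smul, smul_smul, inv_mul_cancel₀ hs, one_smul]; rfl⟩

/-- The generator of `P l`. -/
def gen (l : Part n) : P l := ⟨youngElt l, by rw [P_eq]; exact Submodule.mem_span_singleton_self _⟩

theorem exists_smul_gen {l : Part n} (x : P l) : ∃ a : A n, a • gen l = x := by
  obtain ⟨a, ha⟩ := Submodule.mem_span_singleton.1 ((P_eq l).le x.2)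
  exact ⟨a, Subtype.ext ha⟩

theorem gen_mem (l : Part n) : gen l ∈ PGrading l 0 := groupIncl_mem_algGrading _

theorem smul_mem_PGrading {l : Part n} {i j : ℤ} {a : A n} {x : P l} (ha : a ∈ algGrading n i)
    (hx : x ∈ PGrading l j) : a • x ∈ PGrading l (i + j) := mul_mem_algGrading ha hx

theorem smul_gen_mem {l : Part n} {i : ℤ} {a : A n} (ha : a ∈ algGrading n i) :
    a • gen l ∈ PGrading l i := by
  simpa using smul_mem_PGrading ha (gen_mem l)

section Hom

variable {N : Type} [AddCommGroup N] [Module ℂ N] [Module (A n) N] [IsScalarTower ℂ (A n) N]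

/-- A homomorphism from `P m` is determined by an element of the isotypic part of the target. -/
theorem exists_map_gen (m : Part n) :
    ∃ s : ℂ, ∀ f : P m →ₗ[A n] N, f (gen m) = s • (youngElt m • f (gen m)) := by
  obtain ⟨κ, hκ, h⟩ := exists_youngElt_mul_self m
  refine ⟨κ⁻¹, fun f => ?_⟩
  have h1 : youngElt m • gen m = κ • gen m := Subtype.ext h
  rw [← map_smul, h1, LinearMap.map_smul_of_tower, smul_smul, inv_mul_cancel₀ hκ, one_smul]

theorem hom_eq_zero {m : Part n} (f : P m →ₗ[A n] N) (h : youngElt m • f (gen m) = 0) : f = 0 := by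
  obtain ⟨s, hs⟩ := exists_map_gen (N := N) m
  refine LinearMap.ext fun x => ?_
  obtain ⟨a, rfl⟩ := exists_smul_gen x
  rw [map_smul, hs, h, smul_zero, smul_zero]; rfl

/-- Right multiplication by an element. -/
def rightMul (m : Part n) (x : N) : P m →ₗ[A n] N :=
  (LinearMap.toSpanSingleton (A n) N x).domRestrict (P m)

end Hom

variable (l : Part n)

/-- The generator of `KTilde l`. -/
def genTilde : KTilde l := (KTildeRel l).mkQ (gen l)

/-- The generator of `K l`. -/
def genK : K l := (KRel l).mkQ (genTilde l)

variable {l}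

theorem exists_smul_genK (x : K l) : ∃ a : A n, a • genK l = x := by
  obtain ⟨y, rfl⟩ := (KRel l).mkQ_surjective x
  obtain ⟨z, rfl⟩ := (KTildeRel l).mkQ_surjective y
  obtain ⟨a, rfl⟩ := exists_smul_gen z
  exact ⟨a, rfl⟩

/-- Right multiplication by a homogeneous element of `P l` is a graded homomorphism from `P m`, so
its values lie in the relations. Monomials suffice and are homogeneous. -/
theorem youngElt_smul_genTilde {m : Part n} (h : ¬ DomLE l m) (a : A n) :
    youngElt m • a • genTilde l = 0 := by
  induction a using elt_monomial_induction with
  | zero => rw [zero_smul, smul_zero]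
  | monomial w e c =>
    set x : P l := elt w (MvPolynomial.monomial e c) • gen l with hx
    have hxm : x ∈ PGrading l (e.degree : ℤ) :=
      smul_gen_mem (elt_mem_algGrading (monomial_mem_polyGrading e c) w)
    have hf : rightMul m x ∈ gradedHom (PGrading m) (PGrading l) := by
      refine AddSubgroup.mem_iSup_of_mem (e.degree : ℤ) fun i y hy => ?_
      exact smul_mem_PGrading hy hxm
    have h1 : youngElt m • x ∈ KTildeRel l :=
      Submodule.mem_iSup_of_mem m (Submodule.mem_iSup_of_mem h (Submodule.mem_iSup_of_mem _
        (Submodule.mem_iSup_of_mem hf ⟨gen m, rfl⟩)))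
    have h2 := (Submodule.Quotient.mk_eq_zero _).2 h1
    exact h2
  | add a b ha hb => rw [add_smul, smul_add, ha, hb, add_zero]

theorem youngElt_smul_eq_zero {m : Part n} (h : ¬ DomLE l m) (x : K l) : youngElt m • x = 0 := by
  obtain ⟨a, rfl⟩ := exists_smul_genK x
  have := congrArg (KRel l).mkQ (youngElt_smul_genTilde h a)
  rw [map_zero] at this
  exact this

theorem youngElt_smul_elt_smul_genK {j : ℕ} (hj : 0 < j) {f : Poly n} (hf : f.IsHomogeneous j)
    (w : Equiv.Perm (Fin n)) : youngElt l • elt w f • genK l = 0 := by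
  set x : KTilde l := elt w f • genTilde l with hx
  have hf' : rightMul l x ∈ homDeg (PGrading l) (KTildeGrading l) (j : ℤ) := by
    intro i y hy
    refine ⟨y.1 • elt w f • gen l, ?_, rfl⟩
    exact smul_mem_PGrading hy (smul_gen_mem (elt_mem_algGrading (mem_polyGrading_natCast.2 hf) w))
  have h1 : youngElt l • x ∈ KRel l :=
    Submodule.mem_iSup_of_mem (j : ℤ) (Submodule.mem_iSup_of_mem (by exact_mod_cast hj)
      (Submodule.mem_iSup_of_mem _ (Submodule.mem_iSup_of_mem hf' ⟨gen l, rfl⟩)))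
  exact (Submodule.Quotient.mk_eq_zero _).2 h1

theorem groupIncl_smul_genK (x : GroupAlg n) :
    ∃ t : ℂ, youngElt l • groupIncl n x • genK l = t • genK l := by
  obtain ⟨t, ht⟩ := exists_youngSymmetrizer_mul_mul l x
  obtain ⟨κ, hκ, hκκ⟩ := exists_youngElt_mul_self l
  have h1 : youngElt l • gen l = κ • gen l := Subtype.ext hκκ
  have h2 : κ • (youngElt l • groupIncl n x • gen l) = (κ * t) • gen l := by
    refine Subtype.ext ?_
    change κ • (youngElt l * (groupIncl n x * youngElt l)) = (κ * t) • youngElt l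
    rw [youngElt, ← map_mul, ← map_mul, ← mul_assoc, ht, map_smul, smul_smul]
  have h3 : youngElt l • groupIncl n x • gen l = t • gen l := by
    have := congrArg (κ⁻¹ • ·) h2
    simpa [smul_smul, inv_mul_cancel₀ hκ, ← mul_assoc] using this
  have h4 := congrArg (fun y => (KRel l).mkQ ((KTildeRel l).mkQ y)) h3
  exact ⟨t, by
    simp only [LinearMap.map_smul_of_tower] at h4
    exact h4⟩

/-- L_λ occurs in `K l` only through the generator: in degree 0 the symmetrizer is idempotent up to
scalars, and in positive degree its image was divided out. -/
theorem exists_youngElt_smul (x : K l) : ∃ t : ℂ, youngElt l • x = t • genK l := by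
  obtain ⟨a, rfl⟩ := exists_smul_genK x
  induction a using elt_monomial_induction with
  | zero => exact ⟨0, by rw [zero_smul, zero_smul, smul_zero]⟩
  | monomial w e c =>
    by_cases he : e = 0
    · subst he
      have : elt w (MvPolynomial.monomial 0 c) = groupIncl n (MonoidAlgebra.single w c) :=
        (groupIncl_single w c).symm
      rw [this]
      exact groupIncl_smul_genK _
    · exact ⟨0, by
        rw [zero_smul]
        exact youngElt_smul_elt_smul_genK (Nat.pos_of_ne_zero fun h =>
          he ((Finsupp.degree_eq_zero_iff e).1 h)) (MvPolynomial.isHomogeneous_monomial _ rfl) w⟩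
  | add a b ha hb =>
    obtain ⟨s, hs⟩ := ha
    obtain ⟨t, ht⟩ := hb
    exact ⟨s + t, by rw [add_smul, smul_add, hs, ht, add_smul]⟩

/-! ### The comparison map -/

/-- Pair with a monomial of degree e. If e < n(λ), column antisymmetrization kills its row
symmetrization; otherwise the total degree exceeds n(λ), where `phi` vanishes. -/
theorem youngElt_smul_smul_stdFunctional {j : ℤ} (hj : 0 < j) {y : A n} (hy : y ∈ algGrading n j) :
    youngElt l • y • stdFunctional l = 0 := by
  rw [← sum_elt_coeffAt y, sum_smul, smul_sum]
  refine sum_eq_zero fun w _ => ?_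
  rcases eq_zero_or_isHomogeneous (hy w) with h0 | ⟨d, rfl, hf⟩
  · rw [h0, elt_zero, zero_smul, smul_zero]
  set f := coeffAt w y
  refine dual_ext fun p => ?_
  refine linear_eq_zero_of_monomial ((youngElt l • elt w f • stdFunctional l) ∘ₗ
    (mkR l).restrictScalars ℂ) (fun e => ?_) p
  change (youngElt l • elt w f • stdFunctional l) (mkR l (MvPolynomial.monomial e 1)) = 0
  have hhom : (MvPolynomial.monomial e (1 : ℂ)).IsHomogeneous e.degree :=
    MvPolynomial.isHomogeneous_monomial _ rfl
  have hrow := isHomogeneous_rowSym hhom (rowOf l)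
  rw [youngElt_smul_dual, elt_smul_dual, stdFunctional_mkR]
  by_cases he : e.degree < nStat l
  · rw [colSym_eq_zero_of_isHomogeneous hrow he, mul_zero, smul_zero, map_zero]
  · refine phi_eq_zero_of_isHomogeneous (isHomogeneous_perm_smul
      (hf.mul (isHomogeneous_colSym hrow _)) _) ?_
    have : 0 < d := by exact_mod_cast hj
    omega

variable (l)

theorem KTildeRel_le_ker : KTildeRel l ≤ LinearMap.ker (rightMul l (stdFunctional l)) := by
  refine iSup_le fun m => iSup_le fun hm => iSup_le fun f => iSup_le fun _ => ?_
  rw [LinearMap.range_le_ker_iff]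
  exact hom_eq_zero _ (youngElt_smul_dual_eq_zero hm _)

/-- The map from `KTilde l` to the dual of the Garsia–Procesi module. -/
def tildeToDual : KTilde l →ₗ[A n] Module.Dual ℂ (R l) :=
  (KTildeRel l).liftQ (rightMul l (stdFunctional l)) (KTildeRel_le_ker l)

theorem KRel_le_ker : KRel l ≤ LinearMap.ker (tildeToDual l) := by
  refine iSup_le fun j => iSup_le fun hj => iSup_le fun f => iSup_le fun hf => ?_
  rw [LinearMap.range_le_ker_iff]
  refine hom_eq_zero _ ?_
  obtain ⟨y, hy, hy'⟩ := hf 0 _ (gen_mem l)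
  rw [zero_add] at hy
  rw [LinearMap.comp_apply, ← hy']
  exact youngElt_smul_smul_stdFunctional hj hy

/-- The map from `K l` to the dual of the Garsia–Procesi module. -/
def toDual : K l →ₗ[A n] Module.Dual ℂ (R l) := (KRel l).liftQ (tildeToDual l) (KRel_le_ker l)

theorem toDual_genK : toDual l (genK l) = topFunctional l := rfl

theorem toDual_surjective : Function.Surjective (toDual l) :=
  LinearMap.range_eq_top.1 (eq_top_of_topFunctional_mem ⟨genK l, rfl⟩)

variable {l}

theorem toDual_apply_eq_zero {i k : ℤ} (hik : i + k ≠ nStat l) {x : K l} (hx : x ∈ KGrading l i)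
    {p : Poly n} (hp : p ∈ polyGrading n k) : toDual l x (mkR l p) = 0 := by
  obtain ⟨y, ⟨z, hz, rfl⟩, rfl⟩ := hx
  change (z.1 • stdFunctional l) (mkR l p) = 0
  rw [← sum_elt_coeffAt z.1, sum_smul, LinearMap.sum_apply]
  refine sum_eq_zero fun w _ => ?_
  rw [elt_smul_dual, stdFunctional_mkR]
  rcases eq_zero_or_isHomogeneous (hz w) with h0 | ⟨d, rfl, hf⟩
  · change coeffAt w z.1 = 0 at h0
    rw [h0, zero_mul, smul_zero, map_zero]
  rcases eq_zero_or_isHomogeneous hp with rfl | ⟨d', rfl, hp⟩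
  · rw [mul_zero, smul_zero, map_zero]
  exact phi_eq_zero_of_isHomogeneous (isHomogeneous_perm_smul (hf.mul hp) _) (by omega)

theorem smul_genK_mem {i : ℤ} {a : A n} (ha : a ∈ algGrading n i) : a • genK l ∈ KGrading l i :=
  ⟨a • genTilde l, ⟨a • gen l, smul_gen_mem ha, rfl⟩, rfl⟩

/-- The component need only be correct after pairing in complementary degree. Together with
injectivity of `toDual` this determines membership in `KGrading`. -/
theorem exists_component (i : ℤ) (x : K l) : ∃ x' ∈ KGrading l i,
    ∀ k : ℤ, i + k = nStat l → ∀ p ∈ polyGrading n k, toDual l (x - x') (mkR l p) = 0 := by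
  obtain ⟨a, rfl⟩ := exists_smul_genK x
  induction a using elt_monomial_induction with
  | zero => exact ⟨0, zero_mem _, fun _ _ _ _ => by rw [zero_smul, sub_zero, map_zero]; rfl⟩
  | monomial w e c =>
    have hx : elt w (MvPolynomial.monomial e c) • genK l ∈ KGrading l (e.degree : ℤ) :=
      smul_genK_mem (elt_mem_algGrading (monomial_mem_polyGrading e c) w)
    by_cases hi : (e.degree : ℤ) = i
    · exact ⟨_, hi ▸ hx, fun _ _ _ _ => by rw [sub_self, map_zero]; rfl⟩
    · refine ⟨0, zero_mem _, fun k hk p hp => ?_⟩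
      rw [sub_zero]
      exact toDual_apply_eq_zero (by omega) hx hp
  | add a b ha hb =>
    obtain ⟨x, hx, hx'⟩ := ha
    obtain ⟨y, hy, hy'⟩ := hb
    refine ⟨x + y, add_mem hx hy, fun k hk p hp => ?_⟩
    rw [add_smul, add_sub_add_comm, map_add, LinearMap.add_apply, hx' k hk p hp, hy' k hk p hp,
      add_zero]

theorem dual_eq_zero_of_polyGrading {ψ : Module.Dual ℂ (R l)}
    (h : ∀ k : ℤ, ∀ p ∈ polyGrading n k, ψ (mkR l p) = 0) : ψ = 0 :=
  dual_ext fun p => linear_eq_zero_of_monomial (ψ ∘ₗ (mkR l).restrictScalars ℂ)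
    (fun e => h _ _ (monomial_mem_polyGrading e 1)) p

theorem mem_KGrading_iff (hinj : Function.Injective (toDual l)) (i : ℤ) (x : K l) :
    toDual l x ∈ shift (dualGrading (RGrading l)) (nStat l : ℤ) i ↔ x ∈ KGrading l i := by
  constructor
  · intro hx
    obtain ⟨x', hx', h⟩ := exists_component i x
    have h0 : toDual l (x - x') = 0 := by
      refine dual_eq_zero_of_polyGrading fun k p hp => ?_
      by_cases hk : i + k = nStat l
      · exact h k hk p hp
      · rw [map_sub, LinearMap.sub_apply, toDual_apply_eq_zero hk hx' hp, sub_zero]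
        exact hx k (by omega) _ ⟨p, hp, rfl⟩
    have h1 : x - x' = 0 := hinj (by rw [h0, map_zero])
    rw [sub_eq_zero.1 h1]; exact hx'
  · rintro hx k hk _ ⟨p, hp, rfl⟩
    exact toDual_apply_eq_zero (by omega) hx hp

end Kostka

/-! ### Injectivity of the comparison map -/

section Injectivity

variable {n : ℕ} {l : Part n}

/-- Multiplication by a variable. -/
abbrev varElt (i : Fin n) : A n := elt 1 (MvPolynomial.X i)

/-- Symmetric polynomials are central, so the symmetrizer can be moved past e_t to the generator,
where it acts by κ ≠ 0; but its value on e_t times the generator is a relation of `K l`. -/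
theorem esymmOn_univ_smul {t : ℕ} (ht : 1 ≤ t) (x : K l) :
    (elt 1 (esymmOn univ t) : A n) • x = 0 := by
  have hinv : ∀ w : Equiv.Perm (Fin n), w • esymmOn (univ : Finset (Fin n)) t = esymmOn univ t := by
    intro w
    rw [perm_smul_esymmOn]
    congr 1
    ext i; simp
  have hhom : (esymmOn (univ : Finset (Fin n)) t).IsHomogeneous t := by
    refine MvPolynomial.IsHomogeneous.sum _ _ _ fun S hS => ?_
    rw [← (mem_powersetCard.1 hS).2, card_eq_sum_ones]
    exact MvPolynomial.IsHomogeneous.prod _ _ _ fun i _ => MvPolynomial.isHomogeneous_X _ _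
  have hcomm : ∀ a : A n, elt 1 (esymmOn univ t) * a = a * elt 1 (esymmOn univ t) := by
    intro a
    induction a using elt_induction with
    | zero => rw [mul_zero, zero_mul]
    | elt w f => rw [elt_mul_elt, elt_mul_elt, one_mul, mul_one, one_smul, hinv, mul_comm]
    | add a b ha hb => rw [mul_add, add_mul, ha, hb]
  obtain ⟨a, rfl⟩ := exists_smul_genK x
  rw [smul_smul, hcomm, ← smul_smul]
  suffices h : elt 1 (esymmOn univ t) • genK l = 0 by rw [h, smul_zero]
  obtain ⟨κ, hκ, hκκ⟩ := exists_youngElt_mul_self l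
  have h1 : youngElt l • genK l = κ • genK l := by
    have h2 : youngElt l • gen l = κ • gen l := Subtype.ext hκκ
    have h3 := congrArg (fun y => (KRel l).mkQ ((KTildeRel l).mkQ y)) h2
    simp only [LinearMap.map_smul_of_tower] at h3
    exact h3
  have h4 := youngElt_smul_elt_smul_genK (l := l) ht hhom 1
  rw [smul_smul, ← hcomm, ← smul_smul, h1, smul_comm] at h4
  exact (smul_eq_zero.1 h4).resolve_left hκ

/-- With all e_u of the full set acting by zero, X_i^n is up to sign e_n of the other n - 1
variables. -/
theorem X_pow_smul (i : Fin n) (x : K l) : elt 1 (MvPolynomial.X i ^ n) • x = 0 := by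
  let J : Ideal (Poly n) :=
    { carrier := {f | ∀ x : K l, (elt 1 f : A n) • x = 0}
      zero_mem' := fun x => by rw [elt_zero, zero_smul]
      add_mem' := fun {f g} hf hg x => by rw [elt_add, add_smul, hf, hg, add_zero]
      smul_mem' := fun a f hf x => by
        rw [smul_eq_mul, ← elt_one_mul_elt_one, mul_smul, hf, smul_zero] }
  have h1 := X_pow_mul_esymmOn_mem (J := J) (notMem_erase i univ) n (t := 0)
    (fun u hu x => by rw [insert_erase (mem_univ i), zero_add]; exact esymmOn_univ_smul hu x)
    (by
      rw [zero_add, esymmOn_eq_zero]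
      · exact J.zero_mem
      · rw [card_erase_of_mem (mem_univ i), card_univ, Fintype.card_fin]
        have := i.2; omega)
  rw [esymmOn_zero, mul_one] at h1
  exact h1 x

/-- The complex span of `X_i y`, `y ∈ Y`. -/
def maxSpan (Y : Submodule (A n) (K l)) : Submodule ℂ (K l) :=
  Submodule.span ℂ {x | ∃ i : Fin n, ∃ y ∈ Y, x = varElt i • y}

theorem varElt_smul_mem_maxSpan {Y : Submodule (A n) (K l)} (i : Fin n) {y : K l} (hy : y ∈ Y) :
    varElt i • y ∈ maxSpan Y := Submodule.subset_span ⟨i, y, hy, rfl⟩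

theorem groupIncl_smul_mem_maxSpan {Y : Submodule (A n) (K l)} (x : GroupAlg n) {y : K l}
    (hy : y ∈ maxSpan Y) : groupIncl n x • y ∈ maxSpan Y := by
  induction x using MonoidAlgebra.induction_on with
  | of g =>
    rw [MonoidAlgebra.of_apply, groupIncl_single_one]
    refine Submodule.span_induction (p := fun y _ => elt g 1 • y ∈ maxSpan Y) ?_ ?_ ?_ ?_ hy
    · rintro _ ⟨i, y, hy, rfl⟩
      rw [smul_smul, elt_mul_elt_one, perm_smul_X, mul_smul]
      exact varElt_smul_mem_maxSpan _ (Y.smul_mem _ hy)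
    · rw [smul_zero]; exact zero_mem _
    · intro a b _ _ ha hb; rw [smul_add]; exact add_mem ha hb
    · intro c a _ ha; rw [smul_comm]; exact Submodule.smul_mem _ _ ha
  | add a b ha hb => rw [map_add, add_smul]; exact add_mem ha hb
  | smul c a ha => rw [map_smul, smul_assoc]; exact Submodule.smul_mem _ _ ha

/-- Nakayama for the nilpotent action of the variables: `Y` is spanned by monomials of any given
degree applied to `Y`. -/
theorem eq_zero_of_le_maxSpan {Y : Submodule (A n) (K l)} (h : ∀ y ∈ Y, y ∈ maxSpan Y) {y : K l}
    (hy : y ∈ Y) : y = 0 := by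
  let T : ℕ → Submodule ℂ (K l) := fun M => Submodule.span ℂ {x | ∃ e : Fin n →₀ ℕ,
    e.degree = M ∧ ∃ y ∈ Y, x = elt 1 (MvPolynomial.monomial e 1) • y}
  have key : ∀ M : ℕ, ∀ y ∈ Y, y ∈ T M := by
    intro M
    induction M with
    | zero =>
      intro y hy
      refine Submodule.subset_span ⟨0, by simp, y, hy, ?_⟩
      change y = elt 1 1 • y
      rw [elt_one_one, one_smul]
    | succ M ih =>
      intro y hy
      have hle : maxSpan Y ≤ T (M + 1) := by
        refine Submodule.span_le.2 ?_
        rintro _ ⟨i, y', hy', rfl⟩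
        refine Submodule.span_induction (p := fun x _ => varElt i • x ∈ T (M + 1)) ?_ ?_ ?_ ?_
          (ih y' hy')
        · rintro _ ⟨e, he, y'', hy'', rfl⟩
          refine Submodule.subset_span ⟨Finsupp.single i 1 + e, ?_, y'', hy'', ?_⟩
          · rw [map_add, Finsupp.degree_single, he, add_comm]
          · rw [smul_smul, elt_one_mul_elt_one, MvPolynomial.X, MvPolynomial.monomial_mul, one_mul]
        · rw [smul_zero]; exact zero_mem _
        · intro a b _ _ ha hb; rw [smul_add]; exact add_mem ha hb
        · intro c a _ ha; rw [smul_comm]; exact Submodule.smul_mem _ _ ha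
      exact hle (h y hy)
  -- In degree above n² some exponent is at least n, and X_i^n acts by zero.
  have h1 := key (n * n + 1) y hy
  refine Submodule.span_induction (p := fun x _ => x = 0) ?_ rfl
    (fun a b _ _ ha hb => by rw [ha, hb, add_zero]) (fun c a _ ha => by rw [ha, smul_zero]) h1
  rintro _ ⟨e, he, y', -, rfl⟩
  obtain ⟨i, hi⟩ : ∃ i, n ≤ e i := by
    by_contra hc
    push Not at hc
    have h2 : ∑ i, e i ≤ ∑ _i : Fin n, n := sum_le_sum fun i _ => (hc i).le
    rw [sum_const, card_univ, Fintype.card_fin, smul_eq_mul, ← Finsupp.degree_eq_sum, he] at h2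
    omega
  have h3 : (MvPolynomial.monomial e 1 : Poly n) =
      MvPolynomial.monomial (e - Finsupp.single i n) 1 * MvPolynomial.X i ^ n := by
    rw [MvPolynomial.X_pow_eq_monomial, MvPolynomial.monomial_mul, one_mul,
      tsub_add_cancel_of_le (Finsupp.single_le_iff.2 hi)]
  rw [h3, ← elt_one_mul_elt_one, mul_smul, X_pow_smul, smul_zero]

/-- The degree 0 part of `K l` is generated by a Young symmetrizer of `l`, which that of `m`
annihilates. Everything of positive degree is divisible by variables. -/
theorem youngElt_smul_mem_maxSpan {m : Part n} (hm : m ≠ l) (x : K l) :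
    youngElt m • x ∈ maxSpan (⊤ : Submodule (A n) (K l)) := by
  obtain ⟨a, rfl⟩ := exists_smul_genK x
  induction a using elt_monomial_induction with
  | zero => rw [zero_smul, smul_zero]; exact zero_mem _
  | monomial w e c =>
    by_cases he : e = 0
    · subst he
      have h1 : elt w (MvPolynomial.monomial 0 c) = groupIncl n (MonoidAlgebra.single w c) :=
        (groupIncl_single w c).symm
      have h2 : youngElt m • elt w (MvPolynomial.monomial 0 c) • gen l = 0 := by
        refine Subtype.ext ?_
        change youngElt m * (elt w (MvPolynomial.monomial 0 c) * youngElt l) = 0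
        rw [h1, youngElt, youngElt, ← map_mul, ← map_mul, ← mul_assoc,
          youngSymmetrizer_mul_mul_eq_zero hm, map_zero]
      have h3 := congrArg (fun y => (KRel l).mkQ ((KTildeRel l).mkQ y)) h2
      simp only [map_zero] at h3
      have h4 : youngElt m • elt w (MvPolynomial.monomial 0 c) • genK l = 0 := h3
      rw [h4]; exact zero_mem _
    · obtain ⟨i, hi⟩ := Finsupp.ne_iff.1 he
      have h1 : (MvPolynomial.monomial e c : Poly n) =
          MvPolynomial.X i * MvPolynomial.monomial (e - Finsupp.single i 1) c := by
        rw [MvPolynomial.X, MvPolynomial.monomial_mul, one_mul,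
          add_tsub_cancel_of_le (Finsupp.single_le_iff.2 (Nat.one_le_iff_ne_zero.2 hi))]
      rw [h1, elt_eq_mul, ← elt_one_mul_elt_one, mul_assoc, mul_smul]
      exact groupIncl_smul_mem_maxSpan _ (varElt_smul_mem_maxSpan i trivial)
  | add a b ha hb => rw [add_smul, smul_add]; exact add_mem ha hb

/-- Functionals on `K l` that vanish on the kernel of `toDual l` are evaluations. -/
theorem exists_eval {χ : K l →ₗ[ℂ] ℂ} (h : ∀ x, toDual l x = 0 → χ x = 0) :
    ∃ p : Poly n, ∀ x, χ x = toDual l x (mkR l p) := by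
  obtain ⟨s, hs⟩ := ((toDual l).restrictScalars ℂ).exists_rightInverse_of_surjective
    (LinearMap.range_eq_top.2 (toDual_surjective l))
  obtain ⟨r, hr⟩ := (Module.evalEquiv ℂ (R l)).surjective (χ ∘ₗ s)
  obtain ⟨p, rfl⟩ := mkR_surjective l r
  refine ⟨p, fun x => ?_⟩
  have h1 : toDual l (s (toDual l x)) = toDual l x := LinearMap.congr_fun hs (toDual l x)
  have h2 : χ (x - s (toDual l x)) = 0 := h _ (by rw [map_sub, h1, sub_self])
  rw [map_sub, sub_eq_zero] at h2
  rw [h2]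
  exact (LinearMap.congr_fun hr (toDual l x)).symm

theorem toDual_varElt_smul (i : Fin n) (x : K l) (p : Poly n) :
    toDual l (varElt i • x) (mkR l p) = toDual l x (mkR l (MvPolynomial.X i * p)) := by
  rw [map_smul, elt_smul_dual, inv_one, one_smul]

theorem toDual_perm_smul (w : Equiv.Perm (Fin n)) (x : K l) (p : Poly n) :
    toDual l (elt w 1 • x) (mkR l p) = toDual l x (mkR l (w⁻¹ • p)) := by
  rw [map_smul, elt_smul_dual, one_mul]

theorem mem_annIdeal_of_toDual {p : Poly n} (h : ∀ x, toDual l x (mkR l p) = 0) :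
    p ∈ annIdeal l.1 univ := by
  rw [← mkR_eq_zero_iff, ← Module.forall_dual_apply_eq_zero_iff ℂ]
  intro ψ
  obtain ⟨x, rfl⟩ := toDual_surjective l ψ
  exact h x

theorem antitoneLabels_rowOf (m : Part n) : AntitoneLabels univ (rowOf m) := by
  have h : ∀ i, #{x | rowOf m x = i} = m.1.rowLen i := fun i => by
    rw [YoungDiagram.rowLen_eq_card]
    exact (isTab_filling m).card_filter fun x => x.1 = i
  intro i j hij
  rw [h, h]
  exact m.1.rowLen_anti i j hij

theorem exists_lt_of_domLE {m : Part n} (h : DomLE l m) (hne : m ≠ l) :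
    ∃ k, topCount l.1 k < topCount m.1 k := by
  by_contra hc
  push Not at hc
  exact hne (eq_of_domLE hc h)

/-- A row-invariant functional whose derivatives vanish on the kernel is an evaluation, up to a
functional that vanishes on `maxSpan ⊤`. -/
theorem exists_eval_of_invariant {m : Part n} (hm : DomLE l m) (hne : m ≠ l) {χ : K l →ₗ[ℂ] ℂ}
    (hχ : ∀ (i : Fin n) x, toDual l x = 0 → χ (varElt i • x) = 0)
    (hinv : ∀ σ ∈ labelGroup univ (rowOf m), ∀ x, χ (elt σ 1 • x) = χ x) :
    ∃ g : Poly n, ∀ x ∈ maxSpan (⊤ : Submodule (A n) (K l)), χ x = toDual l x (mkR l g) := by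
  have key : ∀ i, ∃ p : Poly n, ∀ x, χ (varElt i • x) = toDual l x (mkR l p) := fun i =>
    exists_eval (χ := χ ∘ₗ Algebra.lsmul ℂ ℂ (K l) (varElt i)) (hχ i)
  choose y hy using key
  -- The representatives y_i of χ(X_i ·) form a cocycle because the variables commute, and an
  -- equivariant one because χ is invariant under the row group of `m`.
  obtain ⟨g, -, hg⟩ := (vanishFor n l.1 univ (rowOf m) (by simp) (by simp [l.2])
    (antitoneLabels_rowOf m) (fun k => by rw [labelCount_rowOf]; exact hm k)
    (by simpa only [labelCount_rowOf] using exists_lt_of_domLE hm hne)).h1 y (fun _ => trivial)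
    (fun i k => mem_annIdeal_of_toDual fun x => by
      rw [map_sub, map_sub, ← toDual_varElt_smul, ← toDual_varElt_smul, ← hy, ← hy, smul_smul,
        smul_smul, elt_one_mul_elt_one, elt_one_mul_elt_one, mul_comm, sub_self])
    (fun σ hσ i => mem_annIdeal_of_toDual fun x => by
      have h1 := toDual_perm_smul σ⁻¹ x (y i)
      rw [inv_inv] at h1
      rw [map_sub, map_sub, ← h1, ← hy, ← hy, sub_eq_zero, ← hinv σ hσ, smul_smul,
        elt_mul_elt_one, perm_smul_X, mul_smul, smul_smul (elt σ 1), elt_mul_elt, mul_inv_cancel,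
        smul_one, mul_one, elt_one_one, one_smul])
  refine ⟨g, fun x hx => ?_⟩
  refine Submodule.span_induction (p := fun x _ => χ x = toDual l x (mkR l g)) ?_ ?_ ?_ ?_ hx
  · rintro _ ⟨i, z, -, rfl⟩
    have h1 := mkR_eq_zero_iff.2 (hg i)
    rw [map_sub, sub_eq_zero] at h1
    rw [hy, toDual_varElt_smul, h1]
  · rw [map_zero, map_zero]; rfl
  · intro a b _ _ ha hb; rw [map_add, map_add, LinearMap.add_apply, ha, hb]
  · intro c a _ ha
    rw [map_smul, LinearMap.map_smul_of_tower, LinearMap.smul_apply, ha]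

theorem toDual_injective (l : Part n) : Function.Injective (toDual l) := by
  rw [← LinearMap.ker_eq_bot]
  set Y := LinearMap.ker (toDual l) with hY
  by_contra hne
  obtain ⟨y₀, hy₀, hy₀'⟩ := Submodule.exists_mem_ne_zero_of_ne_bot hne
  -- The top of the kernel is nonzero, and χ₀ below is a functional on it, extended to `K l`.
  obtain ⟨y, hy, hyM⟩ : ∃ y ∈ Y, y ∉ maxSpan Y := by
    by_contra hc
    push Not at hc
    exact hy₀' (eq_zero_of_le_maxSpan hc hy₀)
  obtain ⟨χ₀, hχ₀, hM⟩ := Submodule.exists_le_ker_of_notMem hyM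
  obtain ⟨m, g, hmg⟩ : ∃ (m : Part n) (g : Equiv.Perm (Fin n)),
      χ₀ (groupIncl n (MonoidAlgebra.single g 1 * youngSymmetrizer m *
        MonoidAlgebra.single g⁻¹ 1) • y) ≠ 0 := by
    by_contra hc
    push Not at hc
    have h1 : χ₀ (groupIncl n 1 • y) = 0 := by
      refine Submodule.span_induction (p := fun x _ => χ₀ (groupIncl n x • y) = 0) ?_ ?_ ?_ ?_
        one_mem_span_conj_youngSymmetrizer
      · rintro _ ⟨m, g, rfl⟩; exact hc m g
      · rw [map_zero, zero_smul, map_zero]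
      · intro a b _ _ ha hb; rw [map_add, add_smul, map_add, ha, hb, add_zero]
      · intro c a _ ha; rw [map_smul (groupIncl n), smul_assoc, map_smul χ₀, ha, smul_zero]
    rw [map_one, one_smul] at h1
    exact hχ₀ h1
  set y' := groupIncl n (MonoidAlgebra.single g⁻¹ 1) • y with hy'
  have hy'Y : y' ∈ Y := Y.smul_mem _ hy
  rw [map_mul, map_mul, mul_smul, mul_smul, ← hy'] at hmg
  change χ₀ (groupIncl n (MonoidAlgebra.single g 1) • youngElt m • y') ≠ 0 at hmg
  have hml : DomLE l m := by
    by_contra hc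
    rw [youngElt_smul_eq_zero hc, smul_zero, map_zero] at hmg
    exact hmg rfl
  -- For `m = l` the symmetrized element is a multiple of the generator lying in the kernel;
  -- `toDual` does not kill the generator, so it would be zero.
  have hml' : m ≠ l := by
    rintro rfl
    obtain ⟨t, ht⟩ := exists_youngElt_smul y'
    have h1 : toDual m (youngElt m • y') = 0 := by rw [map_smul, hy'Y, smul_zero]
    rw [ht, LinearMap.map_smul_of_tower, toDual_genK] at h1
    have h2 := (smul_eq_zero.1 h1).resolve_right (topFunctional_ne_zero m)
    rw [ht, h2, zero_smul, smul_zero, map_zero] at hmg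
    exact hmg rfl
  -- Averaging χ₀ over the rows of `m` gives the invariance that the vanishing theorem needs; the
  -- factor `g` comes from the conjugated symmetrizer.
  set u := groupIncl n (MonoidAlgebra.single g 1 * rowSum (rowOf m)) with hu
  let χ : K l →ₗ[ℂ] ℂ := χ₀ ∘ₗ Algebra.lsmul ℂ ℂ (K l) u
  have hχ : ∀ (i : Fin n) x, toDual l x = 0 → χ (varElt i • x) = 0 := fun i x hx => by
    have h1 := groupIncl_smul_mem_maxSpan (MonoidAlgebra.single g 1 * rowSum (rowOf m))
      (varElt_smul_mem_maxSpan (Y := Y) i (y := x) hx)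
    exact hM h1
  have hinv : ∀ σ ∈ labelGroup univ (rowOf m), ∀ x, χ (elt σ 1 • x) = χ x := fun σ hσ x => by
    change χ₀ (u • elt σ 1 • x) = χ₀ (u • x)
    rw [smul_smul, hu, ← groupIncl_single_one, ← map_mul, mul_assoc, rowSum_mul_single hσ]
  -- On `maxSpan ⊤` the functional χ now factors through `toDual`, so it kills the symmetrized
  -- kernel element. Since the row sum acts under χ by the order of the row group, this contradicts
  -- `hmg`.
  obtain ⟨p, hp⟩ := exists_eval_of_invariant hml hml' hχ hinv
  have h1 := hp _ (youngElt_smul_mem_maxSpan hml' y')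
  rw [map_smul (toDual l), show toDual l y' = 0 from hy'Y, smul_zero] at h1
  have h2 : youngElt m • y' =
      groupIncl n (rowSum (rowOf m)) • groupIncl n (colSum (colOf m)) • y' := by
    rw [youngElt, youngSymmetrizer_eq, map_mul, mul_smul]
  have h3 : ∀ x, χ (groupIncl n (rowSum (rowOf m)) • x) =
      (#{σ : Equiv.Perm (Fin n) | σ ∈ labelGroup univ (rowOf m)} : ℂ) * χ x := fun x => by
    rw [groupIncl_rowSum, sum_smul, map_sum, sum_congr rfl fun σ hσ =>
      hinv σ (mem_filter.1 hσ).2 x, sum_const, nsmul_eq_mul]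
  rw [h2, h3] at h1
  have h4 := (mul_eq_zero.1 h1).resolve_left
    (Nat.cast_ne_zero.2 (card_pos.2 ⟨1, by simp [one_mem]⟩).ne')
  refine hmg ?_
  rw [h2, smul_smul, ← map_mul]
  exact h4

end Injectivity

end GarsiaProcesi

end

open GarsiaProcesi in
theorem proposition2p9 (n : ℕ) (l : Part n) :
    ∃ φ : Module.Dual ℂ (R l) ≃ₗ[A n] K l,
      ∀ (i : ℤ) (x : Module.Dual ℂ (R l)),
        x ∈ shift (dualGrading (RGrading l)) (nStat l : ℤ) i ↔ φ x ∈ KGrading l i := by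
  let e := LinearEquiv.ofBijective (toDual l) ⟨toDual_injective l, toDual_surjective l⟩
  refine ⟨e.symm, fun i x => ?_⟩
  rw [← mem_KGrading_iff (toDual_injective l)]
  change _ ↔ e (e.symm x) ∈ _
  rw [e.apply_symm_apply]
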